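/- Let $R$ be a commutative Banach ring: a commutative unital ring with a function $|\cdot|:R\to\mathbb R_{\ge 0}$ such that $|a|=0\iff a=0$, $|a+b|\le |a|+|b|$, $|ab|\le C|a||b|$ for some constant $C>0$, and such that $|a-b|$ is a complete metric. Let $\mathrm{Ban}_R$ be the category of Banach $R$-modules (complete normed $R$-modules with $\|am\|\le C|a|\|m\|$ for some $C>0$) and bounded $R$-linear maps, with the symmetric monoidal structure $\widehat\otimes_R$ given by the completion of $M\otimes_R N$ for the seminorm $x\mapsto\inf\{\sum_i\|m_i\|\|n_i\| : x=\sum_i m_i\otimes n_i\}$. Extend $\widehat\otimes_R$ to the category of ind-objects $\mathrm{Ind}(\mathrm{Ban}_R)$ by $$\Big(``\mathrm{colim}_i"\,E_i\Big)\widehat\otimes_R\Big(``\mathrm{colim}_j"\,F_j\Big)=``\mathrm{colim}_{(i,j)}"\,E_i\widehat\otimes_R F_j,$$ and let $\mathrm{Comm}(\mathrm{Ind}(\mathrm{Ban}_R))$ be the category of commutative algebra objects. For $r\in(0,\infty)^n$ let $R\{x/r\}$ be the Banach algebra of power series $f=\sum_{J\in\mathbb N^n}a_Jx^J$ over $R$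 with $\|f\|=\sum_J|a_J|r^J<\infty$. For $\tau\in(0,\infty]^n$ put $$\mathcal O(D^n_{<\tau})=\lim_{r\in(0,\infty)^n,\ r_i<\tau_i\ \forall i}R\{x/r\},\qquad \mathcal O(\mathbb A^n_R)=\lim_{k\in\mathbb Z_{>0}}R\{x/(k,\dots,k)\},$$ the limits being taken in $\mathrm{Comm}(\mathrm{Ind}(\mathrm{Ban}_R))$ along the restriction maps $R\{x/r'\}\to R\{x/r\}$ for $r\le r'$. Let $R\{x/r\}\widehat\otimes_R R\{y/s\}\to R\{x/r,y/s\}$ be the canonical map $f\otimes g\mapsto f(x)g(y)$. Then for all $n,m\ge 0$, $\tau\in(0,\infty]^n$ and $\rho\in(0,\infty]^m$ there is an isomorphism of algebra objects of $\mathrm{Ind}(\mathrm{Ban}_R)$ $$\mathcal O(D^n_{<\tau})\,\widehat\otimes_R\,\mathcal O(D^m_{<\rho})\;\cong\;\mathcal O(D^{n+m}_{<(\tau,\rho)})$$ which is compatible with the projections to $R\{x/r\}\widehat\otimes_R R\{y/s\}$ and $R\{x/r,y/s\}$ and the canonical map between these, for all $r<\tau$ and $s<\rho$. Likewise there is an isomorphism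 of algebra objects $$\mathcal O(\mathbb A^n_R)\,\widehat\otimes_R\,\mathcal O(\mathbb A^m_R)\;\cong\;\mathcal O(\mathbb A^{n+m}_R)$$ which is compatible with the projections to $R\{x/(k,\dots,k)\}\widehat\otimes_R R\{y/(k,\dots,k)\}$ and $R\{(x,y)/(k,\dots,k)\}$ for all $k\in\mathbb Z_{>0}$. -/

import Mathlib

open CategoryTheory Limits Opposite MonoidalCategory

universe v u

/-! ### Ind-objects as formal filtered systems -/

/-- A formal filtered colimit in `C`, indexed by a small filtered category. -/
structure IndSystem (C : Type u) [Category.{v} C] where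
  Idx : Type v
  [cat : SmallCategory Idx]
  [filtered : IsFiltered Idx]
  sys : Idx ⥤ C

attribute [instance] IndSystem.cat IndSystem.filtered

namespace IndSystem

section Category

variable {C : Type u} [Category.{v} C]

/-- The ind-object in the sense of Mathlib which is presented by a system. -/
noncomputable def toInd (X : IndSystem C) : Ind C := (Ind.lim X.Idx).obj X.sys

/-- Morphisms of systems are the morphisms of the ind-objects that they present. -/
noncomputable instance : Category.{v} (IndSystem C) :=
  inferInstanceAs (Category.{v} (InducedCategory (Ind C) toInd))

/-- The functor to Mathlib's category of ind-objects. -/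
noncomputable def toIndFunctor : IndSystem C ⥤ Ind C :=
  inducedFunctor (toInd (C := C))

noncomputable instance : (toIndFunctor (C := C)).Full :=
  inferInstanceAs (inducedFunctor (toInd (C := C))).Full

noncomputable instance : (toIndFunctor (C := C)).Faithful :=
  inferInstanceAs (inducedFunctor (toInd (C := C))).Faithful

instance : (toIndFunctor (C := C)).EssSurj where
  mem_essImage Y := ⟨⟨Y.presentation.I, Y.presentation.F⟩, ⟨Y.colimitPresentationCompYoneda⟩⟩

/-- The category of systems is equivalent to Mathlib's category of ind-objects. -/
instance : (toIndFunctor (C := C)).IsEquivalence where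

/-- The constant system on an object of `C`. -/
def constObj (c : C) : IndSystem C where
  Idx := Discrete PUnit.{v + 1}
  sys := (Functor.const _).obj c

noncomputable def constIso (c : C) : (constObj c).toInd ≅ Ind.yoneda.obj c :=
  (colimit.isColimit _).coconePointUniqueUpToIso
    (colimitOfDiagramTerminal (J := Discrete PUnit.{v + 1}) (X := ⟨PUnit.unit⟩)
      ⟨fun _ => 𝟙 _, by cat_disch, by intros; subsingleton⟩
      ((constObj c).sys ⋙ Ind.yoneda))

@[simp] theorem comp_hom' {X Y Z : IndSystem C} (f : X ⟶ Y) (g : Y ⟶ Z) :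
    (f ≫ g).hom = f.hom ≫ g.hom := rfl

@[simp] theorem id_hom' (X : IndSystem C) : InducedCategory.Hom.hom (𝟙 X) = 𝟙 X.toInd := rfl

theorem hom_ext' {X Y : IndSystem C} {f g : X ⟶ Y} (h : f.hom = g.hom) : f = g :=
  InducedCategory.hom_ext h

/-- The embedding of `C` in its category of ind-objects by constant systems. -/
noncomputable def const : C ⥤ IndSystem C where
  obj := constObj
  map {c d} f := ⟨(constIso c).hom ≫ Ind.yoneda.map f ≫ (constIso d).inv⟩
  map_id c := hom_ext' (by simp)
  map_comp f g := hom_ext' (by simp)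

/-- The constant system on `c` presents the ind-object `Ind.yoneda.obj c`. -/
noncomputable def cIso (c : C) : (const.obj c).toInd ≅ Ind.yoneda.obj c := constIso c

theorem const_map_hom {c d : C} (f : c ⟶ d) :
    (const.map f).hom = (cIso c).hom ≫ Ind.yoneda.map f ≫ (cIso d).inv := rfl

/-- The structure morphisms of the formal colimit. -/
noncomputable def toIndι (X : IndSystem C) (i : X.Idx) :
    Ind.yoneda.obj (X.sys.obj i) ⟶ X.toInd :=
  colimit.ι (X.sys ⋙ Ind.yoneda) i

theorem toIndι_w (X : IndSystem C) {i j : X.Idx} (a : i ⟶ j) :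
    Ind.yoneda.map (X.sys.map a) ≫ X.toIndι j = X.toIndι i :=
  colimit.w (X.sys ⋙ Ind.yoneda) a

/-- The canonical morphism from a member of a system to the system. -/
noncomputable def incl (X : IndSystem C) (i : X.Idx) : const.obj (X.sys.obj i) ⟶ X :=
  ⟨(cIso _).hom ≫ X.toIndι i⟩

theorem const_map_incl_hom {c : C} {X : IndSystem C} {i : X.Idx} (g : c ⟶ X.sys.obj i) :
    (const.map g ≫ X.incl i).hom = (cIso c).hom ≫ Ind.yoneda.map g ≫ X.toIndι i := by
  rw [comp_hom', const_map_hom, incl]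
  simp only [Category.assoc, Iso.inv_hom_id_assoc]

@[simp]
theorem incl_w (X : IndSystem C) {i j : X.Idx} (a : i ⟶ j) :
    const.map (X.sys.map a) ≫ X.incl j = X.incl i :=
  hom_ext' (by rw [const_map_incl_hom, toIndι_w]; rfl)

theorem hom_ext {X Y : IndSystem C} {f g : X ⟶ Y} (h : ∀ i, X.incl i ≫ f = X.incl i ≫ g) :
    f = g := by
  refine hom_ext' (colimit.hom_ext fun i => ?_)
  have h1 : ((cIso _).hom ≫ X.toIndι i) ≫ f.hom = ((cIso _).hom ≫ X.toIndι i) ≫ g.hom :=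
    congrArg InducedCategory.Hom.hom (h i)
  rw [Category.assoc, Category.assoc, Iso.cancel_iso_hom_left] at h1
  exact h1

/-- Morphisms out of a system are compatible families of morphisms out of its members. -/
noncomputable def desc {X Y : IndSystem C} (f : ∀ i, const.obj (X.sys.obj i) ⟶ Y)
    (hf : ∀ (i j : X.Idx) (a : i ⟶ j), const.map (X.sys.map a) ≫ f j = f i) : X ⟶ Y :=
  ⟨colimit.desc (X.sys ⋙ Ind.yoneda)
    { pt := Y.toInd
      ι := { app := fun i => (cIso _).inv ≫ (f i).hom
             naturality := fun i j a => by
              have h := congrArg InducedCategory.Hom.hom (hf i j a)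
              rw [comp_hom', const_map_hom] at h
              change Ind.yoneda.map (X.sys.map a) ≫ (cIso _).inv ≫ (f j).hom =
                ((cIso _).inv ≫ (f i).hom) ≫ 𝟙 _
              rw [← h]
              simp } }⟩

@[simp]
theorem incl_desc {X Y : IndSystem C} (f : ∀ i, const.obj (X.sys.obj i) ⟶ Y)
    (hf : ∀ (i j : X.Idx) (a : i ⟶ j), const.map (X.sys.map a) ≫ f j = f i) (i : X.Idx) :
    X.incl i ≫ desc f hf = f i :=
  hom_ext' (by
    have h : X.toIndι i ≫ (desc f hf).hom = (cIso _).inv ≫ (f i).hom :=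
      colimit.ι_desc _ _
    rw [comp_hom', incl, Category.assoc, h, Iso.hom_inv_id_assoc])

theorem yoneda_preserves (c : C) :
    PreservesFilteredColimitsOfSize.{v, v} (coyoneda.obj (op (Ind.yoneda.obj c))) := by
  have e : coyoneda.obj (op (Ind.yoneda.obj c)) ≅
      Ind.inclusion C ⋙ (evaluation _ _).obj (op c) :=
    NatIso.ofComponents
      (fun X => ((Ind.inclusion.fullyFaithful (C := C)).homEquiv.trans
        (((Ind.yonedaCompInclusion (C := C)).app c).homFromEquiv.trans yonedaEquiv)).toIso)
      (fun {X Y} f => by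
        ext x
        simp [Functor.FullyFaithful.homEquiv, yonedaEquiv])
  refine ⟨fun J _ _ => ?_⟩
  exact preservesColimitsOfShape_of_natIso e.symm

theorem exists_fac {c : C} {X : IndSystem C} (x : const.obj c ⟶ X) :
    ∃ (i : X.Idx) (g : c ⟶ X.sys.obj i), x = const.map g ≫ X.incl i := by
  have := (yoneda_preserves c).preserves_filtered_colimits X.Idx
  obtain ⟨i, g, hg⟩ := Types.jointly_surjective_of_isColimit
    (isColimitOfPreserves (coyoneda.obj (op (Ind.yoneda.obj c)))
      (colimit.isColimit (X.sys ⋙ Ind.yoneda))) ((cIso c).inv ≫ x.hom)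
  refine ⟨i, Ind.yoneda.preimage g, hom_ext' ?_⟩
  have hg' : g ≫ X.toIndι i = (cIso c).inv ≫ x.hom := hg
  rw [const_map_incl_hom, Functor.map_preimage, hg', Iso.hom_inv_id_assoc]

theorem incl_eq {c : C} {X : IndSystem C} {i j : X.Idx} {g : c ⟶ X.sys.obj i}
    {h : c ⟶ X.sys.obj j} (e : const.map g ≫ X.incl i = const.map h ≫ X.incl j) :
    ∃ (k : X.Idx) (a : i ⟶ k) (b : j ⟶ k), g ≫ X.sys.map a = h ≫ X.sys.map b := by
  have := (yoneda_preserves c).preserves_filtered_colimits X.Idx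
  have e' : Ind.yoneda.map g ≫ X.toIndι i = Ind.yoneda.map h ≫ X.toIndι j := by
    have := congrArg InducedCategory.Hom.hom e
    rwa [const_map_incl_hom, const_map_incl_hom, Iso.cancel_iso_hom_left] at this
  obtain ⟨k, a, b, hk⟩ := (Types.FilteredColimit.isColimit_eq_iff _
    (isColimitOfPreserves (coyoneda.obj (op (Ind.yoneda.obj c)))
      (colimit.isColimit (X.sys ⋙ Ind.yoneda)))).1 e'
  refine ⟨k, a, b, Ind.yoneda.map_injective ?_⟩
  have hk' : Ind.yoneda.map g ≫ Ind.yoneda.map (X.sys.map a) =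
    Ind.yoneda.map h ≫ Ind.yoneda.map (X.sys.map b) := hk
  simpa using hk'

noncomputable instance : (const (C := C)).Full where
  map_surjective {c d} f :=
    ⟨Ind.yoneda.preimage ((cIso c).inv ≫ f.hom ≫ (cIso d).hom), hom_ext' (by
      rw [const_map_hom]
      simp)⟩

instance : (const (C := C)).Faithful where
  map_injective {c d} f g h := Ind.yoneda.map_injective (by
    have h' := congrArg InducedCategory.Hom.hom h
    simpa [const_map_hom] using h')

/-- Two morphisms agreeing on generalized elements are equal. -/
theorem elt_ext {X Y : IndSystem C} {f g : X ⟶ Y}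
    (h : ∀ (c : C) (x : const.obj c ⟶ X), x ≫ f = x ≫ g) : f = g :=
  hom_ext fun _ => h _ _

end Category

section Monoidal

variable {C : Type u} [Category.{v} C] [MonoidalCategory C]

/-- The tensor product of `"colim" X i` and `"colim" Y j` is `"colim" (X i ⊗ Y j)`. -/
def tensor (X Y : IndSystem C) : IndSystem C where
  Idx := X.Idx × Y.Idx
  sys :=
    { obj := fun p => X.sys.obj p.1 ⊗ Y.sys.obj p.2
      map := fun a => X.sys.map a.1 ⊗ₘ Y.sys.map a.2
      map_id := fun p => by simp
      map_comp := fun a b => by simp [MonoidalCategory.tensorHom_comp_tensorHom] }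

noncomputable def tincl (X Y : IndSystem C) (i : X.Idx) (j : Y.Idx) :
    const.obj (X.sys.obj i ⊗ Y.sys.obj j) ⟶ tensor X Y :=
  (tensor X Y).incl (i, j)

theorem tincl_w (X Y : IndSystem C) {i i' : X.Idx} {j j' : Y.Idx} (a : i ⟶ i') (b : j ⟶ j') :
    const.map (X.sys.map a ⊗ₘ Y.sys.map b) ≫ tincl X Y i' j' = tincl X Y i j :=
  (tensor X Y).incl_w ((a, b) : (i, j) ⟶ (i', j'))

theorem exists_tfac {X Y : IndSystem C} {c : C} (w : const.obj c ⟶ tensor X Y) :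
    ∃ (i : X.Idx) (j : Y.Idx) (g : c ⟶ X.sys.obj i ⊗ Y.sys.obj j),
      w = const.map g ≫ tincl X Y i j := by
  obtain ⟨⟨i, j⟩, g, h⟩ := exists_fac w
  exact ⟨i, j, g, h⟩

/-- The external product of generalized elements `x` of `X` and `y` of `Y`. -/
noncomputable def box {X Y : IndSystem C} {c d : C} (x : const.obj c ⟶ X) (y : const.obj d ⟶ Y) :
    const.obj (c ⊗ d) ⟶ tensor X Y :=
  const.map ((exists_fac x).choose_spec.choose ⊗ₘ (exists_fac y).choose_spec.choose) ≫
    tincl X Y (exists_fac x).choose (exists_fac y).choose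

theorem box_eq {X Y : IndSystem C} {c d : C} {i : X.Idx} {j : Y.Idx} (g : c ⟶ X.sys.obj i)
    (h : d ⟶ Y.sys.obj j) :
    box (const.map g ≫ X.incl i) (const.map h ≫ Y.incl j) =
      const.map (g ⊗ₘ h) ≫ tincl X Y i j := by
  obtain ⟨k, a, b, hk⟩ := incl_eq (exists_fac (const.map g ≫ X.incl i)).choose_spec.choose_spec
  obtain ⟨l, a', b', hl⟩ := incl_eq (exists_fac (const.map h ≫ Y.incl j)).choose_spec.choose_spec
  rw [box, ← tincl_w X Y b b', ← tincl_w X Y a a', ← Functor.map_comp_assoc,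
    ← Functor.map_comp_assoc, MonoidalCategory.tensorHom_comp_tensorHom,
    MonoidalCategory.tensorHom_comp_tensorHom, hk, hl]

theorem tincl_eq_box (X Y : IndSystem C) (i : X.Idx) (j : Y.Idx) :
    tincl X Y i j = box (X.incl i) (Y.incl j) := by
  have := box_eq (𝟙 (X.sys.obj i)) (𝟙 (Y.sys.obj j))
  rw [MonoidalCategory.id_tensorHom_id] at this
  simpa only [CategoryTheory.Functor.map_id, Category.id_comp] using this.symm

theorem map_box {X Y : IndSystem C} {c d c' d' : C} (g : c' ⟶ c) (h : d' ⟶ d)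
    (x : const.obj c ⟶ X) (y : const.obj d ⟶ Y) :
    const.map (g ⊗ₘ h) ≫ box x y = box (const.map g ≫ x) (const.map h ≫ y) := by
  obtain ⟨i, x, rfl⟩ := exists_fac x
  obtain ⟨j, y, rfl⟩ := exists_fac y
  rw [← Functor.map_comp_assoc, ← Functor.map_comp_assoc, box_eq, box_eq,
    ← Functor.map_comp_assoc, MonoidalCategory.tensorHom_comp_tensorHom]

theorem tensor_ext {X Y Z : IndSystem C} {f g : tensor X Y ⟶ Z}
    (h : ∀ (c d : C) (x : const.obj c ⟶ X) (y : const.obj d ⟶ Y), box x y ≫ f = box x y ≫ g) :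
    f = g :=
  hom_ext fun ⟨i, j⟩ => by
    change tincl X Y i j ≫ f = tincl X Y i j ≫ g
    rw [tincl_eq_box]
    exact h _ _ _ _

/-- Morphisms out of a tensor product are natural families of operations on generalized
elements. -/
noncomputable def tensorDesc {X Y Z : IndSystem C}
    (f : ∀ (c d : C) (_ : const.obj c ⟶ X) (_ : const.obj d ⟶ Y), const.obj (c ⊗ d) ⟶ Z)
    (hf : ∀ (c d c' d' : C) (g : c' ⟶ c) (h : d' ⟶ d) (x : const.obj c ⟶ X)
      (y : const.obj d ⟶ Y),
      const.map (g ⊗ₘ h) ≫ f c d x y = f c' d' (const.map g ≫ x) (const.map h ≫ y)) :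
    tensor X Y ⟶ Z :=
  desc (X := tensor X Y) (fun p => f _ _ (X.incl p.1) (Y.incl p.2)) (fun p q a => by
    have e := hf _ _ _ _ (X.sys.map a.1) (Y.sys.map a.2) (X.incl q.1) (Y.incl q.2)
    rw [incl_w, incl_w] at e
    exact e)

theorem box_tensorDesc {X Y Z : IndSystem C}
    (f : ∀ (c d : C) (_ : const.obj c ⟶ X) (_ : const.obj d ⟶ Y), const.obj (c ⊗ d) ⟶ Z)
    (hf : ∀ (c d c' d' : C) (g : c' ⟶ c) (h : d' ⟶ d) (x : const.obj c ⟶ X)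
      (y : const.obj d ⟶ Y),
      const.map (g ⊗ₘ h) ≫ f c d x y = f c' d' (const.map g ≫ x) (const.map h ≫ y))
    {c d : C} (x : const.obj c ⟶ X) (y : const.obj d ⟶ Y) :
    box x y ≫ tensorDesc f hf = f c d x y := by
  obtain ⟨i, x, rfl⟩ := exists_fac x
  obtain ⟨j, y, rfl⟩ := exists_fac y
  have e : tincl X Y i j ≫ tensorDesc f hf = f _ _ (X.incl i) (Y.incl j) := by
    delta tincl tensorDesc
    exact incl_desc (X := tensor X Y) _ _ (i, j)
  rw [box_eq, Category.assoc, e, hf]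

/-- The tensor product of morphisms. -/
noncomputable def tensorMap {X Y X' Y' : IndSystem C} (f : X ⟶ X') (g : Y ⟶ Y') :
    tensor X Y ⟶ tensor X' Y' :=
  tensorDesc (fun _ _ x y => box (x ≫ f) (y ≫ g)) (fun _ _ _ _ _ _ _ _ => by simp [map_box])

@[simp]
theorem box_tensorMap {X Y X' Y' : IndSystem C} (f : X ⟶ X') (g : Y ⟶ Y') {c d : C}
    (x : const.obj c ⟶ X) (y : const.obj d ⟶ Y) :
    box x y ≫ tensorMap f g = box (x ≫ f) (y ≫ g) :=
  box_tensorDesc _ _ _ _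

@[simp]
theorem box_tensorMap_assoc {X Y X' Y' : IndSystem C} (f : X ⟶ X') (g : Y ⟶ Y') {c d : C}
    (x : const.obj c ⟶ X) (y : const.obj d ⟶ Y)
    {W : IndSystem C} (w : tensor X' Y' ⟶ W) :
    box x y ≫ tensorMap f g ≫ w =
      box (x ≫ f) (y ≫ g) ≫ w := by
  rw [← Category.assoc, box_tensorMap]

theorem tensor_ext₃ {X Y Z W : IndSystem C} {f g : tensor (tensor X Y) Z ⟶ W}
    (h : ∀ (c d e : C) (x : const.obj c ⟶ X) (y : const.obj d ⟶ Y) (z : const.obj e ⟶ Z),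
      box (box x y) z ≫ f = box (box x y) z ≫ g) : f = g :=
  tensor_ext fun c d w z => by
    obtain ⟨i, j, w, rfl⟩ := exists_tfac w
    have := map_box w (𝟙 d) (tincl X Y i j) z
    rw [CategoryTheory.Functor.map_id, Category.id_comp] at this
    rw [← this, Category.assoc, Category.assoc, tincl_eq_box, h]

theorem tensor_ext₃' {X Y Z W : IndSystem C} {f g : tensor X (tensor Y Z) ⟶ W}
    (h : ∀ (c d e : C) (x : const.obj c ⟶ X) (y : const.obj d ⟶ Y) (z : const.obj e ⟶ Z),
      box x (box y z) ≫ f = box x (box y z) ≫ g) : f = g :=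
  tensor_ext fun c d x w => by
    obtain ⟨i, j, w, rfl⟩ := exists_tfac w
    have := map_box (𝟙 c) w x (tincl Y Z i j)
    rw [CategoryTheory.Functor.map_id, Category.id_comp] at this
    rw [← this, Category.assoc, Category.assoc, tincl_eq_box, h]

theorem tensor_ext₄ {X Y Z V W : IndSystem C} {f g : tensor (tensor (tensor X Y) Z) V ⟶ W}
    (h : ∀ (b c d e : C) (x : const.obj b ⟶ X) (y : const.obj c ⟶ Y) (z : const.obj d ⟶ Z)
      (v : const.obj e ⟶ V),
      box (box (box x y) z) v ≫ f = box (box (box x y) z) v ≫ g) : f = g :=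
  tensor_ext₃ fun c d e w z v => by
    obtain ⟨i, j, w, rfl⟩ := exists_tfac w
    have h1 := map_box w (𝟙 d) (tincl X Y i j) z
    rw [CategoryTheory.Functor.map_id, Category.id_comp] at h1
    have h2 := map_box (w ⊗ₘ 𝟙 d) (𝟙 e) (box (tincl X Y i j) z) v
    rw [CategoryTheory.Functor.map_id, Category.id_comp] at h2
    rw [← h1, ← h2, Category.assoc, Category.assoc, tincl_eq_box, h]

theorem assoc_w (X Y Z : IndSystem C) {i i' : X.Idx} {j j' : Y.Idx} {k k' : Z.Idx} (a : i ⟶ i')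
    (b : j ⟶ j') (c : k ⟶ k') :
    const.map ((X.sys.map a ⊗ₘ Y.sys.map b) ⊗ₘ Z.sys.map c) ≫ const.map (α_ _ _ _).hom ≫
      box (X.incl i') (box (Y.incl j') (Z.incl k')) =
    const.map (α_ _ _ _).hom ≫ box (X.incl i) (box (Y.incl j) (Z.incl k)) := by
  rw [← Functor.map_comp_assoc, associator_naturality, Functor.map_comp_assoc, map_box, map_box]
  simp only [incl_w]

theorem assoc_w' (X Y Z : IndSystem C) {i i' : X.Idx} {j j' : Y.Idx} {k k' : Z.Idx} (a : i ⟶ i')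
    (b : j ⟶ j') (c : k ⟶ k') :
    const.map (X.sys.map a ⊗ₘ (Y.sys.map b ⊗ₘ Z.sys.map c)) ≫ const.map (α_ _ _ _).inv ≫
      box (box (X.incl i') (Y.incl j')) (Z.incl k') =
    const.map (α_ _ _ _).inv ≫ box (box (X.incl i) (Y.incl j)) (Z.incl k) := by
  rw [← Functor.map_comp_assoc, associator_inv_naturality, Functor.map_comp_assoc, map_box,
    map_box]
  simp only [incl_w]

noncomputable def assocHom (X Y Z : IndSystem C) :
    tensor (tensor X Y) Z ⟶ tensor X (tensor Y Z) :=
  desc (X := tensor (tensor X Y) Z)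
    (fun p => const.map (α_ (X.sys.obj p.1.1) (Y.sys.obj p.1.2) (Z.sys.obj p.2)).hom ≫
      box (X.incl p.1.1) (box (Y.incl p.1.2) (Z.incl p.2)))
    (fun _ _ a => assoc_w X Y Z a.1.1 a.1.2 a.2)

noncomputable def assocInv (X Y Z : IndSystem C) :
    tensor X (tensor Y Z) ⟶ tensor (tensor X Y) Z :=
  desc (X := tensor X (tensor Y Z))
    (fun p => const.map (α_ (X.sys.obj p.1) (Y.sys.obj p.2.1) (Z.sys.obj p.2.2)).inv ≫
      box (box (X.incl p.1) (Y.incl p.2.1)) (Z.incl p.2.2))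
    (fun _ _ a => assoc_w' X Y Z a.1 a.2.1 a.2.2)

theorem tincl_assocHom (X Y Z : IndSystem C) (i : X.Idx) (j : Y.Idx) (k : Z.Idx) :
    tincl (tensor X Y) Z (i, j) k ≫ assocHom X Y Z =
      const.map (α_ (X.sys.obj i) (Y.sys.obj j) (Z.sys.obj k)).hom ≫
        box (X.incl i) (box (Y.incl j) (Z.incl k)) := by
  delta tincl assocHom
  exact incl_desc (X := tensor (tensor X Y) Z) _ _ ((i, j), k)

theorem tincl_assocInv (X Y Z : IndSystem C) (i : X.Idx) (j : Y.Idx) (k : Z.Idx) :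
    tincl X (tensor Y Z) i (j, k) ≫ assocInv X Y Z =
      const.map (α_ (X.sys.obj i) (Y.sys.obj j) (Z.sys.obj k)).inv ≫
        box (box (X.incl i) (Y.incl j)) (Z.incl k) := by
  delta tincl assocInv
  exact incl_desc (X := tensor X (tensor Y Z)) _ _ (i, (j, k))

@[simp]
theorem box_assocHom {X Y Z : IndSystem C} {c d e : C} (x : const.obj c ⟶ X)
    (y : const.obj d ⟶ Y) (z : const.obj e ⟶ Z) :
    box (box x y) z ≫ assocHom X Y Z = const.map (α_ c d e).hom ≫ box x (box y z) := by
  obtain ⟨i, x, rfl⟩ := exists_fac x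
  obtain ⟨j, y, rfl⟩ := exists_fac y
  obtain ⟨k, z, rfl⟩ := exists_fac z
  have e1 : box (box (X.incl i) (Y.incl j)) (Z.incl k) ≫ assocHom X Y Z =
      const.map (α_ _ _ _).hom ≫ box (X.incl i) (box (Y.incl j) (Z.incl k)) := by
    rw [← tincl_assocHom, ← tincl_eq_box X Y]
    exact congrArg (· ≫ _) (tincl_eq_box (tensor X Y) Z (i, j) k).symm
  simp only [← map_box, Category.assoc, e1, ← Functor.map_comp_assoc, associator_naturality]

@[simp]
theorem box_assocHom_assoc {X Y Z : IndSystem C} {c d e : C} (x : const.obj c ⟶ X)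
    (y : const.obj d ⟶ Y) (z : const.obj e ⟶ Z)
    {W : IndSystem C} (w : tensor X (tensor Y Z) ⟶ W) :
    box (box x y) z ≫ assocHom X Y Z ≫ w =
      const.map (α_ c d e).hom ≫ box x (box y z) ≫ w := by
  rw [← Category.assoc, box_assocHom, Category.assoc]

@[simp]
theorem box_assocInv {X Y Z : IndSystem C} {c d e : C} (x : const.obj c ⟶ X)
    (y : const.obj d ⟶ Y) (z : const.obj e ⟶ Z) :
    box x (box y z) ≫ assocInv X Y Z = const.map (α_ c d e).inv ≫ box (box x y) z := by
  obtain ⟨i, x, rfl⟩ := exists_fac x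
  obtain ⟨j, y, rfl⟩ := exists_fac y
  obtain ⟨k, z, rfl⟩ := exists_fac z
  have e1 : box (X.incl i) (box (Y.incl j) (Z.incl k)) ≫ assocInv X Y Z =
      const.map (α_ _ _ _).inv ≫ box (box (X.incl i) (Y.incl j)) (Z.incl k) := by
    rw [← tincl_assocInv, ← tincl_eq_box Y Z]
    exact congrArg (· ≫ _) (tincl_eq_box X (tensor Y Z) i (j, k)).symm
  simp only [← map_box, Category.assoc, e1, ← Functor.map_comp_assoc, associator_inv_naturality]

@[simp]
theorem box_assocInv_assoc {X Y Z : IndSystem C} {c d e : C} (x : const.obj c ⟶ X)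
    (y : const.obj d ⟶ Y) (z : const.obj e ⟶ Z)
    {W : IndSystem C} (w : tensor (tensor X Y) Z ⟶ W) :
    box x (box y z) ≫ assocInv X Y Z ≫ w =
      const.map (α_ c d e).inv ≫ box (box x y) z ≫ w := by
  rw [← Category.assoc, box_assocInv, Category.assoc]

noncomputable def leftHom (X : IndSystem C) : tensor (const.obj (𝟙_ C)) X ⟶ X :=
  tensorDesc (fun c d x y => const.map (const.preimage x ▷ d ≫ (λ_ d).hom) ≫ y)
    (fun c d c' d' g h x y => by
      obtain ⟨x, rfl⟩ := const.map_surjective x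
      rw [← Functor.map_comp, Functor.preimage_map, Functor.preimage_map,
        ← Functor.map_comp_assoc, ← Functor.map_comp_assoc]
      congr 2
      simp [MonoidalCategory.tensorHom_def, whisker_exchange_assoc])

@[simp]
theorem box_leftHom {X : IndSystem C} {c d : C} (x : c ⟶ 𝟙_ C) (y : const.obj d ⟶ X) :
    box (const.map x) y ≫ leftHom X = const.map (x ▷ d ≫ (λ_ d).hom) ≫ y := by
  rw [leftHom, box_tensorDesc, Functor.preimage_map]

@[simp]
theorem box_leftHom_assoc {X : IndSystem C} {c d : C} (x : c ⟶ 𝟙_ C) (y : const.obj d ⟶ X)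
    {W : IndSystem C} (w : X ⟶ W) :
    box (const.map x) y ≫ leftHom X ≫ w =
      const.map (x ▷ d ≫ (λ_ d).hom) ≫ y ≫ w := by
  rw [← Category.assoc, box_leftHom, Category.assoc]

noncomputable def leftInv (X : IndSystem C) : X ⟶ tensor (const.obj (𝟙_ C)) X :=
  desc (fun i => const.map (λ_ _).inv ≫ box (const.map (𝟙 _)) (X.incl i)) (fun i j a => by
    have := map_box (𝟙 (𝟙_ C)) (X.sys.map a) (const.map (𝟙 _)) (X.incl j)
    rw [incl_w, ← Functor.map_comp, Category.comp_id] at this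
    rw [← this, ← Functor.map_comp_assoc, ← Functor.map_comp_assoc, leftUnitor_inv_naturality,
      MonoidalCategory.id_tensorHom])

@[simp]
theorem comp_leftInv {X : IndSystem C} {c : C} (x : const.obj c ⟶ X) :
    x ≫ leftInv X = const.map (λ_ c).inv ≫ box (const.map (𝟙 _)) x := by
  obtain ⟨i, x, rfl⟩ := exists_fac x
  have := map_box (𝟙 (𝟙_ C)) x (const.map (𝟙 _)) (X.incl i)
  rw [← Functor.map_comp, Category.comp_id] at this
  rw [← this, Category.assoc, leftInv, incl_desc, ← Functor.map_comp_assoc,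
    ← Functor.map_comp_assoc, leftUnitor_inv_naturality, MonoidalCategory.id_tensorHom]

@[simp]
theorem comp_leftInv_assoc {X : IndSystem C} {c : C} (x : const.obj c ⟶ X)
    {W : IndSystem C} (w : tensor (const.obj (𝟙_ C)) X ⟶ W) :
    x ≫ leftInv X ≫ w =
      const.map (λ_ c).inv ≫ box (const.map (𝟙 _)) x ≫ w := by
  rw [← Category.assoc, comp_leftInv, Category.assoc]

noncomputable def rightHom (X : IndSystem C) : tensor X (const.obj (𝟙_ C)) ⟶ X :=
  tensorDesc (fun c d x y => const.map (c ◁ const.preimage y ≫ (ρ_ c).hom) ≫ x)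
    (fun c d c' d' g h x y => by
      obtain ⟨y, rfl⟩ := const.map_surjective y
      rw [← Functor.map_comp, Functor.preimage_map, Functor.preimage_map,
        ← Functor.map_comp_assoc, ← Functor.map_comp_assoc]
      congr 2
      simp [MonoidalCategory.tensorHom_def', ← whisker_exchange_assoc])

@[simp]
theorem box_rightHom {X : IndSystem C} {c d : C} (x : const.obj c ⟶ X) (y : d ⟶ 𝟙_ C) :
    box x (const.map y) ≫ rightHom X = const.map (c ◁ y ≫ (ρ_ c).hom) ≫ x := by
  rw [rightHom, box_tensorDesc, Functor.preimage_map]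

@[simp]
theorem box_rightHom_assoc {X : IndSystem C} {c d : C} (x : const.obj c ⟶ X) (y : d ⟶ 𝟙_ C)
    {W : IndSystem C} (w : X ⟶ W) :
    box x (const.map y) ≫ rightHom X ≫ w =
      const.map (c ◁ y ≫ (ρ_ c).hom) ≫ x ≫ w := by
  rw [← Category.assoc, box_rightHom, Category.assoc]

noncomputable def rightInv (X : IndSystem C) : X ⟶ tensor X (const.obj (𝟙_ C)) :=
  desc (fun i => const.map (ρ_ _).inv ≫ box (X.incl i) (const.map (𝟙 _))) (fun i j a => by
    have := map_box (X.sys.map a) (𝟙 (𝟙_ C)) (X.incl j) (const.map (𝟙 _))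
    rw [incl_w, ← Functor.map_comp, Category.comp_id] at this
    rw [← this, ← Functor.map_comp_assoc, ← Functor.map_comp_assoc, rightUnitor_inv_naturality,
      MonoidalCategory.tensorHom_id])

@[simp]
theorem comp_rightInv {X : IndSystem C} {c : C} (x : const.obj c ⟶ X) :
    x ≫ rightInv X = const.map (ρ_ c).inv ≫ box x (const.map (𝟙 _)) := by
  obtain ⟨i, x, rfl⟩ := exists_fac x
  have := map_box x (𝟙 (𝟙_ C)) (X.incl i) (const.map (𝟙 _))
  rw [← Functor.map_comp, Category.comp_id] at this
  rw [← this, Category.assoc, rightInv, incl_desc, ← Functor.map_comp_assoc,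
    ← Functor.map_comp_assoc, rightUnitor_inv_naturality, MonoidalCategory.tensorHom_id]

@[simp]
theorem comp_rightInv_assoc {X : IndSystem C} {c : C} (x : const.obj c ⟶ X)
    {W : IndSystem C} (w : tensor X (const.obj (𝟙_ C)) ⟶ W) :
    x ≫ rightInv X ≫ w =
      const.map (ρ_ c).inv ≫ box x (const.map (𝟙 _)) ≫ w := by
  rw [← Category.assoc, comp_rightInv, Category.assoc]

/-- `map_box` in the form of a normalization rule. -/
theorem box_map_left {X Y : IndSystem C} {c d c' : C} (g : c' ⟶ c)
    (x : const.obj c ⟶ X) (y : const.obj d ⟶ Y) :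
    box (const.map g ≫ x) y = const.map (g ▷ d) ≫ box x y := by
  have := map_box g (𝟙 d) x y
  rw [CategoryTheory.Functor.map_id, Category.id_comp, MonoidalCategory.tensorHom_id] at this
  exact this.symm

theorem box_map_right {X Y : IndSystem C} {c d d' : C} (h : d' ⟶ d)
    (x : const.obj c ⟶ X) (y : const.obj d ⟶ Y) :
    box x (const.map h ≫ y) = const.map (c ◁ h) ≫ box x y := by
  have := map_box (𝟙 c) h x y
  rw [CategoryTheory.Functor.map_id, Category.id_comp, MonoidalCategory.id_tensorHom] at this
  exact this.symm

/-- `map_box` for a constant left factor. -/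
theorem box_const_left {Y : IndSystem C} {c d c' : C} (g : c' ⟶ c) (y : const.obj d ⟶ Y) :
    box (const.map g) y = const.map (g ▷ d) ≫ box (const.map (𝟙 c)) y := by
  rw [← box_map_left, ← Functor.map_comp, Category.comp_id]

theorem box_const_right {X : IndSystem C} {c d d' : C} (h : d' ⟶ d) (x : const.obj c ⟶ X) :
    box x (const.map h) = const.map (c ◁ h) ≫ box x (const.map (𝟙 d)) := by
  rw [← box_map_right, ← Functor.map_comp, Category.comp_id]

theorem triangle_aux (X Y : IndSystem C) :
    assocHom X (const.obj (𝟙_ C)) Y ≫ tensorMap (𝟙 X) (leftHom Y) =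
      tensorMap (rightHom X) (𝟙 Y) :=
  tensor_ext₃ fun c d e x u y => by
    obtain ⟨u, rfl⟩ := const.map_surjective u
    rw [box_assocHom_assoc, box_tensorMap, box_tensorMap, box_leftHom, box_rightHom, box_map_left,
      box_map_right, Category.comp_id, Category.comp_id, ← Functor.map_comp_assoc]
    simp

noncomputable instance : MonoidalCategoryStruct (IndSystem C) where
  tensorObj := tensor
  tensorUnit := const.obj (𝟙_ C)
  tensorHom := tensorMap
  whiskerLeft X _ _ f := tensorMap (𝟙 X) f
  whiskerRight f Y := tensorMap f (𝟙 Y)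
  associator X Y Z :=
    { hom := assocHom X Y Z
      inv := assocInv X Y Z
      hom_inv_id := tensor_ext₃ fun _ _ _ _ _ _ => by
        rw [box_assocHom_assoc, box_assocInv, ← Functor.map_comp_assoc]
        simp
      inv_hom_id := tensor_ext₃' fun _ _ _ _ _ _ => by
        rw [box_assocInv_assoc, box_assocHom, ← Functor.map_comp_assoc]
        simp }
  leftUnitor X :=
    { hom := leftHom X
      inv := leftInv X
      hom_inv_id := tensor_ext fun c d x y => by
        obtain ⟨x, rfl⟩ := const.map_surjective x
        rw [box_leftHom_assoc, comp_leftInv, ← Functor.map_comp_assoc]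
        simpa using (box_const_left x y).symm
      inv_hom_id := elt_ext fun c x => by
        rw [comp_leftInv_assoc, box_leftHom, ← Functor.map_comp_assoc]
        simp }
  rightUnitor X :=
    { hom := rightHom X
      inv := rightInv X
      hom_inv_id := tensor_ext fun c d x y => by
        obtain ⟨y, rfl⟩ := const.map_surjective y
        rw [box_rightHom_assoc, comp_rightInv, ← Functor.map_comp_assoc]
        simpa using (box_const_right y x).symm
      inv_hom_id := elt_ext fun c x => by
        rw [comp_rightInv_assoc, box_rightHom, ← Functor.map_comp_assoc]
        simp }

noncomputable instance : MonoidalCategory (IndSystem C) :=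
  MonoidalCategory.ofTensorHom
    (id_tensorHom_id := fun X Y => tensor_ext fun c d x y => by
      change box x y ≫ tensorMap _ _ = _ ≫ 𝟙 (tensor X Y)
      simp)
    (id_tensorHom := fun _ _ _ _ => rfl)
    (tensorHom_id := fun _ _ => rfl)
    (tensorHom_comp_tensorHom := fun f₁ f₂ g₁ g₂ => tensor_ext fun c d x y => by
      change box x y ≫ tensorMap _ _ ≫ tensorMap _ _ = _ ≫ tensorMap _ _
      simp)
    (associator_naturality := fun f₁ f₂ f₃ => tensor_ext₃ fun c d e x y z => by
      change box _ _ ≫ tensorMap (tensorMap _ _) _ ≫ assocHom _ _ _ =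
        box _ _ ≫ assocHom _ _ _ ≫ tensorMap _ (tensorMap _ _)
      simp)
    (leftUnitor_naturality := fun f => tensor_ext fun c d x y => by
      obtain ⟨x, rfl⟩ := const.map_surjective x
      change box _ _ ≫ tensorMap (𝟙 (const.obj (𝟙_ C))) _ ≫ leftHom _ = box _ _ ≫ leftHom _ ≫ _
      simp)
    (rightUnitor_naturality := fun f => tensor_ext fun c d x y => by
      obtain ⟨y, rfl⟩ := const.map_surjective y
      change box _ _ ≫ tensorMap _ (𝟙 (const.obj (𝟙_ C))) ≫ rightHom _ =
        box _ _ ≫ rightHom _ ≫ _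
      simp)
    (pentagon := fun W X Y Z => tensor_ext₄ fun b c d e w x y z => by
      change box _ _ ≫ tensorMap (assocHom _ _ _) (𝟙 _) ≫ assocHom _ _ _ ≫
        tensorMap (𝟙 _) (assocHom _ _ _) = box _ _ ≫ assocHom _ _ _ ≫ assocHom _ _ _
      simp only [box_tensorMap_assoc, box_tensorMap, box_assocHom, box_assocHom_assoc,
        box_map_left, box_map_right, Category.assoc, Category.comp_id]
      simp only [← Functor.map_comp_assoc, MonoidalCategory.pentagon])
    (triangle := triangle_aux)

/-- The comparison of the tensor product of the constant systems on `c` and `d` with the constant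
system on `c ⊗ d`. -/
noncomputable def constMul (c d : C) : tensor (const.obj c) (const.obj d) ⟶ const.obj (c ⊗ d) :=
  tensorDesc (fun _ _ x y => const.map (const.preimage x ⊗ₘ const.preimage y))
    (fun _ _ _ _ g h x y => by
      obtain ⟨x, rfl⟩ := const.map_surjective x
      obtain ⟨y, rfl⟩ := const.map_surjective y
      simp only [← Functor.map_comp, Functor.preimage_map,
        MonoidalCategory.tensorHom_comp_tensorHom])

@[simp]
theorem box_constMul {c d c' d' : C} (x : c' ⟶ c) (y : d' ⟶ d) :
    box (const.map x) (const.map y) ≫ constMul c d = const.map (x ⊗ₘ y) := by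
  rw [constMul, box_tensorDesc, Functor.preimage_map, Functor.preimage_map]

@[simp]
theorem box_constMul_assoc {c d c' d' : C} (x : c' ⟶ c) (y : d' ⟶ d)
    {W : IndSystem C} (w : const.obj (c ⊗ d) ⟶ W) :
    box (const.map x) (const.map y) ≫ constMul c d ≫ w =
      const.map (x ⊗ₘ y) ≫ w := by
  rw [← Category.assoc, box_constMul]

end Monoidal

section Braided

variable {C : Type u} [Category.{v} C] [MonoidalCategory C] [SymmetricCategory C]

noncomputable def braidHom (X Y : IndSystem C) : tensor X Y ⟶ tensor Y X :=
  tensorDesc (fun c d x y => const.map (β_ c d).hom ≫ box y x) (fun _ _ _ _ g h x y => by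
    rw [← map_box, ← Functor.map_comp_assoc, ← Functor.map_comp_assoc,
      BraidedCategory.braiding_naturality])

@[simp]
theorem box_braidHom {X Y : IndSystem C} {c d : C} (x : const.obj c ⟶ X) (y : const.obj d ⟶ Y) :
    box x y ≫ braidHom X Y = const.map (β_ c d).hom ≫ box y x :=
  box_tensorDesc _ _ _ _

@[simp]
theorem box_braidHom_assoc {X Y : IndSystem C} {c d : C} (x : const.obj c ⟶ X) (y : const.obj d ⟶ Y)
    {W : IndSystem C} (w : tensor Y X ⟶ W) :
    box x y ≫ braidHom X Y ≫ w =
      const.map (β_ c d).hom ≫ box y x ≫ w := by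
  rw [← Category.assoc, box_braidHom, Category.assoc]

theorem braidHom_braidHom (X Y : IndSystem C) : braidHom X Y ≫ braidHom Y X = 𝟙 _ :=
  tensor_ext fun c d x y => by
    rw [box_braidHom_assoc, box_braidHom, ← Functor.map_comp_assoc]
    simp

noncomputable instance : SymmetricCategory (IndSystem C) where
  braiding X Y := ⟨braidHom X Y, braidHom Y X, braidHom_braidHom X Y, braidHom_braidHom Y X⟩
  braiding_naturality_right X Y Z f := tensor_ext fun c d x y => by
    change box _ _ ≫ tensorMap (𝟙 _) f ≫ braidHom _ _ = box _ _ ≫ braidHom _ _ ≫ tensorMap f (𝟙 _)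
    simp
  braiding_naturality_left f Z := tensor_ext fun c d x y => by
    change box _ _ ≫ tensorMap f (𝟙 _) ≫ braidHom _ _ = box _ _ ≫ braidHom _ _ ≫ tensorMap (𝟙 _) f
    simp
  hexagon_forward X Y Z := tensor_ext₃ fun c d e x y z => by
    change box _ _ ≫ assocHom _ _ _ ≫ braidHom _ (tensor _ _) ≫ assocHom _ _ _ =
      box _ _ ≫ tensorMap (braidHom _ _) (𝟙 _) ≫ assocHom _ _ _ ≫ tensorMap (𝟙 _) (braidHom _ _)
    simp only [box_tensorMap_assoc, box_tensorMap, box_assocHom, box_assocHom_assoc,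
      box_braidHom, box_braidHom_assoc, box_map_left, box_map_right, Category.assoc,
      Category.comp_id]
    simp only [← Functor.map_comp_assoc, BraidedCategory.hexagon_forward]
  hexagon_reverse X Y Z := tensor_ext₃' fun c d e x y z => by
    change box _ _ ≫ assocInv _ _ _ ≫ braidHom (tensor _ _) _ ≫ assocInv _ _ _ =
      box _ _ ≫ tensorMap (𝟙 _) (braidHom _ _) ≫ assocInv _ _ _ ≫ tensorMap (braidHom _ _) (𝟙 _)
    simp only [box_tensorMap_assoc, box_tensorMap, box_assocInv, box_assocInv_assoc,
      box_braidHom, box_braidHom_assoc, box_map_left, box_map_right, Category.assoc,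
      Category.comp_id]
    simp only [← Functor.map_comp_assoc, BraidedCategory.hexagon_reverse]
  symmetry X Y := braidHom_braidHom X Y

/-- The embedding of `C` in its ind-objects is a symmetric monoidal functor. -/
noncomputable instance : (const (C := C)).LaxBraided where
  ε := 𝟙 _
  μ := constMul
  μ_natural_left f Z := tensor_ext fun c d x y => by
    obtain ⟨x, rfl⟩ := const.map_surjective x
    obtain ⟨y, rfl⟩ := const.map_surjective y
    change box _ _ ≫ tensorMap _ (𝟙 _) ≫ constMul _ _ = box _ _ ≫ constMul _ _ ≫ _
    rw [box_tensorMap_assoc, box_constMul_assoc, ← Functor.map_comp, Category.comp_id,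
      box_constMul, ← Functor.map_comp]
    simp [← MonoidalCategory.tensorHom_id, MonoidalCategory.tensorHom_comp_tensorHom]
  μ_natural_right Z f := tensor_ext fun c d x y => by
    obtain ⟨x, rfl⟩ := const.map_surjective x
    obtain ⟨y, rfl⟩ := const.map_surjective y
    change box _ _ ≫ tensorMap (𝟙 _) _ ≫ constMul _ _ = box _ _ ≫ constMul _ _ ≫ _
    rw [box_tensorMap_assoc, box_constMul_assoc, ← Functor.map_comp, Category.comp_id,
      box_constMul, ← Functor.map_comp]
    simp [← MonoidalCategory.id_tensorHom, MonoidalCategory.tensorHom_comp_tensorHom]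
  associativity X Y Z := tensor_ext₃ fun c d e x y z => by
    obtain ⟨x, rfl⟩ := const.map_surjective x
    obtain ⟨y, rfl⟩ := const.map_surjective y
    obtain ⟨z, rfl⟩ := const.map_surjective z
    change box _ _ ≫ tensorMap (constMul _ _) (𝟙 _) ≫ constMul _ _ ≫ _ =
      box _ _ ≫ assocHom _ _ _ ≫ tensorMap (𝟙 _) (constMul _ _) ≫ constMul _ _
    simp only [box_tensorMap_assoc, box_constMul, box_constMul_assoc, box_assocHom_assoc,
      Category.comp_id, ← Functor.map_comp, associator_naturality]
  left_unitality X := tensor_ext fun c d x y => by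
    obtain ⟨x, rfl⟩ := const.map_surjective x
    obtain ⟨y, rfl⟩ := const.map_surjective y
    change box _ _ ≫ leftHom _ = box _ _ ≫ tensorMap (𝟙 _) (𝟙 _) ≫ constMul _ _ ≫ _
    simp only [box_leftHom, box_tensorMap_assoc, Category.comp_id, box_constMul_assoc,
      ← Functor.map_comp]
    simp [MonoidalCategory.tensorHom_def]
  right_unitality X := tensor_ext fun c d x y => by
    obtain ⟨x, rfl⟩ := const.map_surjective x
    obtain ⟨y, rfl⟩ := const.map_surjective y
    change box _ _ ≫ rightHom _ = box _ _ ≫ tensorMap (𝟙 _) (𝟙 _) ≫ constMul _ _ ≫ _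
    simp only [box_rightHom, box_tensorMap_assoc, Category.comp_id, box_constMul_assoc,
      ← Functor.map_comp]
    simp [MonoidalCategory.tensorHom_def']
  braided X Y := tensor_ext fun c d x y => by
    obtain ⟨x, rfl⟩ := const.map_surjective x
    obtain ⟨y, rfl⟩ := const.map_surjective y
    change box _ _ ≫ constMul _ _ ≫ _ = box _ _ ≫ braidHom _ _ ≫ constMul _ _
    simp only [box_constMul_assoc, box_braidHom_assoc, box_constMul, ← Functor.map_comp,
      BraidedCategory.braiding_naturality]

end Braided

end IndSystem
/-! ### Banach rings and Banach modules -/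

/-- A commutative Banach ring: the multiplication is bounded for a complete norm on the
additive group. -/
class BanachCommRing (R : Type u) extends NormedAddCommGroup R, CommRing R where
  complete : CompleteSpace R
  exists_norm_mul_le : ∃ C : ℝ, 0 < C ∧ ∀ a b : R, ‖a * b‖ ≤ C * ‖a‖ * ‖b‖

attribute [instance] BanachCommRing.complete

/-- A Banach module over a commutative Banach ring. -/
structure BanMod (R : Type u) [BanachCommRing R] where
  carrier : Type u
  [group : NormedAddCommGroup carrier]
  [module : Module R carrier]
  [complete : CompleteSpace carrier]
  exists_norm_smul_le : ∃ C : ℝ, 0 < C ∧ ∀ (a : R) (m : carrier), ‖a • m‖ ≤ C * ‖a‖ * ‖m‖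

attribute [instance] BanMod.group BanMod.module BanMod.complete

namespace BanMod

variable {R : Type u} [BanachCommRing R]

instance : CoeSort (BanMod R) (Type u) := ⟨carrier⟩

/-- Morphisms of Banach modules are the bounded linear maps. -/
@[ext]
structure Hom (M N : BanMod R) where
  toLin : M →ₗ[R] N
  bounded : ∃ C : ℝ, ∀ x, ‖toLin x‖ ≤ C * ‖x‖

theorem exists_bound_nonneg {M N : BanMod R} (f : Hom M N) :
    ∃ C : ℝ, 0 ≤ C ∧ ∀ x, ‖f.toLin x‖ ≤ C * ‖x‖ := by
  obtain ⟨C, hC⟩ := f.bounded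
  exact ⟨max C 0, le_max_right _ _, fun x => (hC x).trans
    (mul_le_mul_of_nonneg_right (le_max_left _ _) (norm_nonneg x))⟩

instance : LargeCategory (BanMod R) where
  Hom := Hom
  id M := ⟨LinearMap.id, 1, fun x => by simp⟩
  comp f g := ⟨g.toLin ∘ₗ f.toLin, by
    obtain ⟨C, -, hC⟩ := exists_bound_nonneg f
    obtain ⟨D, hD0, hD⟩ := exists_bound_nonneg g
    exact ⟨D * C, fun x => (hD _).trans (by
      rw [mul_assoc]; exact mul_le_mul_of_nonneg_left (hC x) hD0)⟩⟩

@[simp] theorem id_apply (M : BanMod R) (x : M) : (𝟙 M : M ⟶ M).toLin x = x := rfl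

@[simp] theorem comp_apply {M N P : BanMod R} (f : M ⟶ N) (g : N ⟶ P) (x : M) :
    (f ≫ g).toLin x = g.toLin (f.toLin x) := rfl

theorem hom_ext {M N : BanMod R} {f g : M ⟶ N} (h : ∀ x, f.toLin x = g.toLin x) : f = g :=
  Hom.ext (LinearMap.ext h)

theorem continuous {M N : BanMod R} (f : M ⟶ N) : Continuous f.toLin := by
  obtain ⟨C, hC⟩ := f.bounded
  exact AddMonoidHomClass.continuous_of_bound f.toLin C hC

/-! ### The completed projective tensor product -/

open TensorProduct

/-- The algebraic tensor product, which carries the projective seminorm. -/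
def PreTensor (M N : BanMod R) : Type u := M ⊗[R] N

noncomputable instance (M N : BanMod R) : AddCommGroup (PreTensor M N) :=
  inferInstanceAs (AddCommGroup (M ⊗[R] N))

noncomputable instance (M N : BanMod R) : Module R (PreTensor M N) :=
  inferInstanceAs (Module R (M ⊗[R] N))

/-- The representations of a tensor as a finite sum of pure tensors. -/
def Reps {M N : BanMod R} (t : PreTensor M N) : Type u :=
  {l : List (M × N) // (l.map fun p => p.1 ⊗ₜ[R] p.2).sum = (show M ⊗[R] N from t)}

/-- The sum of the products of the norms. -/
def cost {M N : BanMod R} (l : List (M × N)) : ℝ := (l.map fun p => ‖p.1‖ * ‖p.2‖).sum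

theorem cost_nonneg {M N : BanMod R} (l : List (M × N)) : 0 ≤ cost l :=
  List.sum_nonneg fun x hx => by
    obtain ⟨p, -, rfl⟩ := List.mem_map.1 hx
    positivity

/-- The projective seminorm. -/
noncomputable def projNorm {M N : BanMod R} (t : PreTensor M N) : ℝ :=
  ⨅ l : Reps t, cost l.1

instance {M N : BanMod R} (t : PreTensor M N) : Nonempty (Reps t) := by
  suffices ∃ l : List (M × N), (l.map fun p => p.1 ⊗ₜ[R] p.2).sum = (show M ⊗[R] N from t) by
    obtain ⟨l, hl⟩ := this
    exact ⟨⟨l, hl⟩⟩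
  refine TensorProduct.induction_on (motive := fun t =>
    ∃ l : List (M × N), (l.map fun p => p.1 ⊗ₜ[R] p.2).sum = t) t ⟨[], rfl⟩ ?_ ?_
  · exact fun x y => ⟨[(x, y)], by simp⟩
  · rintro _ _ ⟨l, rfl⟩ ⟨l', rfl⟩
    exact ⟨l ++ l', by simp⟩

theorem projNorm_le {M N : BanMod R} {t : PreTensor M N} (l : List (M × N))
    (hl : (l.map fun p => p.1 ⊗ₜ[R] p.2).sum = (show M ⊗[R] N from t)) : projNorm t ≤ cost l :=
  ciInf_le ⟨0, by rintro _ ⟨l, rfl⟩; exact cost_nonneg _⟩ (⟨l, hl⟩ : Reps t)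

theorem projNorm_nonneg {M N : BanMod R} (t : PreTensor M N) : 0 ≤ projNorm t :=
  le_ciInf fun l => cost_nonneg l.1

/-- A seminorm estimate can be checked on representations. -/
theorem le_projNorm {M N : BanMod R} {t : PreTensor M N} {c K : ℝ} (hK : 0 ≤ K)
    (h : ∀ l : List (M × N), (l.map fun p => p.1 ⊗ₜ[R] p.2).sum = (show M ⊗[R] N from t) →
      c ≤ K * cost l) : c ≤ K * projNorm t := by
  rw [projNorm, Real.mul_iInf_of_nonneg hK]
  exact le_ciInf fun l => h l.1 l.2

theorem projNorm_add {M N : BanMod R} (s t : PreTensor M N) :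
    projNorm (s + t) ≤ projNorm s + projNorm t := by
  have h1 : ∀ l : Reps s, projNorm (s + t) - cost l.1 ≤ projNorm t := fun l => le_ciInf fun l' => by
    have := projNorm_le (t := s + t) (l.1 ++ l'.1) (by
      rw [List.map_append, List.sum_append, l.2, l'.2]
      rfl)
    rw [cost, List.map_append, List.sum_append] at this
    exact sub_le_iff_le_add'.2 this
  have h2 : projNorm (s + t) - projNorm t ≤ projNorm s := le_ciInf fun l => by
    have := h1 l
    linarith
  linarith

theorem projNorm_tmul_le {M N : BanMod R} (m : M) (n : N) :
    projNorm (m ⊗ₜ[R] n : M ⊗[R] N) ≤ ‖m‖ * ‖n‖ := by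
  simpa [cost] using projNorm_le (t := m ⊗ₜ[R] n) [(m, n)] (by simp)

/-- A linear map which is bounded on pure tensors is bounded. -/
theorem norm_le_projNorm {M N P : BanMod R} (f : M ⊗[R] N →ₗ[R] P) {K : ℝ} (hK : 0 ≤ K)
    (h : ∀ m n, ‖f (m ⊗ₜ n)‖ ≤ K * (‖m‖ * ‖n‖)) (t : PreTensor M N) :
    ‖f t‖ ≤ K * projNorm t :=
  le_projNorm hK fun l hl => by
    rw [← hl]
    clear hl
    induction l with
    | nil => simp [cost]
    | cons p l ih =>
      simp only [List.map_cons, List.sum_cons, map_add, cost, mul_add]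
      exact (norm_add_le _ _).trans (add_le_add (h _ _) ih)

theorem projNorm_smul_le {M N : BanMod R} : ∃ C : ℝ, 0 < C ∧ ∀ (a : R) (t : PreTensor M N),
    projNorm (a • t) ≤ C * ‖a‖ * projNorm t := by
  obtain ⟨C, hC0, hC⟩ := M.exists_norm_smul_le
  refine ⟨C, hC0, fun a t => le_projNorm (by positivity) fun l hl => ?_⟩
  refine (projNorm_le (l.map fun p => (a • p.1, p.2)) ?_).trans ?_
  · change _ = a • (show M ⊗[R] N from t)
    rw [← hl, List.smul_sum, List.map_map, List.map_map]
    rfl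
  · clear hl
    induction l with
    | nil => simp [cost]
    | cons p l ih =>
      simp only [List.map_cons, List.sum_cons, cost, mul_add] at ih ⊢
      refine add_le_add ?_ ih
      rw [← mul_assoc]
      exact mul_le_mul_of_nonneg_right (hC _ _) (norm_nonneg _)

theorem projNorm_neg_le {M N : BanMod R} (t : PreTensor M N) : projNorm (-t) ≤ projNorm t := by
  rw [← one_mul (projNorm t)]
  refine le_projNorm zero_le_one fun l hl => ?_
  refine (projNorm_le (l.map fun p => (-p.1, p.2)) ?_).trans (le_of_eq ?_)
  · change _ = -(show M ⊗[R] N from t)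
    rw [← hl, List.sum_neg, List.map_map, List.map_map]
    congr 2
  · simp [cost, Function.comp_def]

noncomputable instance (M N : BanMod R) : SeminormedAddCommGroup (PreTensor M N) :=
  AddGroupSeminorm.toSeminormedAddCommGroup
    { toFun := projNorm
      map_zero' := le_antisymm (by simpa [cost] using projNorm_le (M := M) (N := N) (t := 0) [] rfl)
        (projNorm_nonneg _)
      add_le' := projNorm_add
      neg' := fun t => le_antisymm (projNorm_neg_le t) (by
        simpa using projNorm_neg_le (-t)) }

theorem norm_def {M N : BanMod R} (t : PreTensor M N) : ‖t‖ = projNorm t := rfl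

instance (M N : BanMod R) : UniformContinuousConstSMul R (PreTensor M N) where
  uniformContinuous_const_smul a := by
    obtain ⟨C, -, hC⟩ := projNorm_smul_le (M := M) (N := N)
    exact (AddMonoidHomClass.uniformContinuous_of_bound
      (DistribSMul.toAddMonoidHom (PreTensor M N) a) (C * ‖a‖) (hC a))

open UniformSpace

/-- The completed tensor product of Banach modules. -/
noncomputable def tensor (M N : BanMod R) : BanMod R where
  carrier := Completion (PreTensor M N)
  exists_norm_smul_le := by
    obtain ⟨C, hC0, hC⟩ := projNorm_smul_le (M := M) (N := N)
    refine ⟨C, hC0, fun a x => ?_⟩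
    induction x using Completion.induction_on with
    | hp => exact isClosed_le (continuous_const_smul a).norm (continuous_const.mul continuous_norm)
    | ih x =>
      rw [← Completion.coe_smul, Completion.norm_coe, Completion.norm_coe]
      exact hC a x

/-- The map from the algebraic tensor product to its completion. -/
noncomputable def ofTensor {M N : BanMod R} (t : M ⊗[R] N) : tensor M N :=
  (show PreTensor M N from t : Completion (PreTensor M N))

/-- A pure tensor. -/
noncomputable def tmul {M N : BanMod R} (m : M) (n : N) : tensor M N :=
  ofTensor (m ⊗ₜ[R] n)

theorem norm_tmul_le {M N : BanMod R} (m : M) (n : N) : ‖tmul m n‖ ≤ ‖m‖ * ‖n‖ :=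
  (Completion.norm_coe (E := PreTensor M N) _).le.trans (projNorm_tmul_le m n)

theorem add_tmul {M N : BanMod R} (m m' : M) (n : N) :
    tmul (m + m') n = tmul m n + tmul m' n :=
  (congrArg ofTensor (TensorProduct.add_tmul m m' n)).trans
    (Completion.coe_add (α := PreTensor M N) _ _)

theorem tmul_add {M N : BanMod R} (m : M) (n n' : N) :
    tmul m (n + n') = tmul m n + tmul m n' :=
  (congrArg ofTensor (TensorProduct.tmul_add m n n')).trans
    (Completion.coe_add (α := PreTensor M N) _ _)

theorem smul_tmul' {M N : BanMod R} (a : R) (m : M) (n : N) :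
    tmul (a • m) n = a • tmul m n :=
  (congrArg ofTensor (TensorProduct.smul_tmul' a m n).symm).trans
    (Completion.coe_smul (X := PreTensor M N) a _)

theorem tmul_smul {M N : BanMod R} (a : R) (m : M) (n : N) :
    tmul m (a • n) = a • tmul m n :=
  (congrArg ofTensor (TensorProduct.tmul_smul a m n)).trans
    (Completion.coe_smul (X := PreTensor M N) a _)

/-- Morphisms which agree on the pure tensors are equal. -/
theorem tensor_ext {M N P : BanMod R} {f g : tensor M N ⟶ P}
    (h : ∀ m n, f.toLin (tmul m n) = g.toLin (tmul m n)) : f = g := by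
  refine hom_ext fun x => ?_
  refine Completion.induction_on (p := fun x => f.toLin x = g.toLin x) x
    (isClosed_eq (continuous f) (continuous g)) fun t => ?_
  refine TensorProduct.induction_on (motive := fun t : M ⊗[R] N =>
    f.toLin (ofTensor t) = g.toLin (ofTensor t)) t ?_ h ?_
  · exact (map_zero f.toLin).trans (map_zero g.toLin).symm
  · intro s t hs ht
    have e : (ofTensor (s + t) : tensor M N) = ofTensor s + ofTensor t :=
      Completion.coe_add (α := PreTensor M N) _ _
    rw [e, map_add, map_add, hs, ht]

/-- The extension to the completion of a bounded map on the algebraic tensor product. -/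
noncomputable def liftLin {M N P : BanMod R} (f : M ⊗[R] N →ₗ[R] P)
    (h : ∃ K : ℝ, 0 ≤ K ∧ ∀ m n, ‖f (m ⊗ₜ n)‖ ≤ K * (‖m‖ * ‖n‖)) : tensor M N →ₗ[R] P :=
  have hf : Continuous (show PreTensor M N →+ P from f.toAddMonoidHom) := by
    obtain ⟨K, hK, hb⟩ := h
    exact AddMonoidHomClass.continuous_of_bound (show PreTensor M N →+ P from f.toAddMonoidHom) K
      (norm_le_projNorm f hK hb)
  { (show PreTensor M N →+ P from f.toAddMonoidHom).extension hf with
    map_smul' := fun a x => by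
      obtain ⟨C, -, hC⟩ := P.exists_norm_smul_le
      have hc : Continuous fun y : P => a • y :=
        AddMonoidHomClass.continuous_of_bound (DistribSMul.toAddMonoidHom P a) (C * ‖a‖) (hC a)
      refine Completion.induction_on (p := fun x =>
        (show PreTensor M N →+ P from f.toAddMonoidHom).extension hf (a • x) =
          a • (show PreTensor M N →+ P from f.toAddMonoidHom).extension hf x) x ?_ fun t => ?_
      · exact isClosed_eq ((AddMonoidHom.continuous_extension _ _).comp
          (continuous_const_smul a)) (hc.comp (AddMonoidHom.continuous_extension _ _))
      · rw [← Completion.coe_smul, AddMonoidHom.extension_coe, AddMonoidHom.extension_coe]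
        exact f.map_smul a t }

theorem liftLin_coe {M N P : BanMod R} (f : M ⊗[R] N →ₗ[R] P)
    (h : ∃ K : ℝ, 0 ≤ K ∧ ∀ m n, ‖f (m ⊗ₜ n)‖ ≤ K * (‖m‖ * ‖n‖)) (t : M ⊗[R] N) :
    liftLin f h (ofTensor t) = f t := by
  obtain ⟨K, hK, hb⟩ := h
  exact AddMonoidHom.extension_coe (show PreTensor M N →+ P from f.toAddMonoidHom)
    (AddMonoidHomClass.continuous_of_bound (show PreTensor M N →+ P from f.toAddMonoidHom) K
      (norm_le_projNorm f hK hb)) (t : PreTensor M N)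

theorem continuous_liftLin {M N P : BanMod R} (f : M ⊗[R] N →ₗ[R] P)
    (h : ∃ K : ℝ, 0 ≤ K ∧ ∀ m n, ‖f (m ⊗ₜ n)‖ ≤ K * (‖m‖ * ‖n‖)) :
    Continuous (liftLin f h) := by
  obtain ⟨K, hK, hb⟩ := h
  exact AddMonoidHom.continuous_extension (show PreTensor M N →+ P from f.toAddMonoidHom)
    (AddMonoidHomClass.continuous_of_bound (show PreTensor M N →+ P from f.toAddMonoidHom) K
      (norm_le_projNorm f hK hb))

theorem norm_liftLin_le {M N P : BanMod R} (f : M ⊗[R] N →ₗ[R] P) {K : ℝ} (hK : 0 ≤ K)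
    (h : ∀ m n, ‖f (m ⊗ₜ n)‖ ≤ K * (‖m‖ * ‖n‖)) (x : tensor M N) :
    ‖liftLin f ⟨K, hK, h⟩ x‖ ≤ K * ‖x‖ :=
  Completion.induction_on (p := fun x => ‖liftLin f ⟨K, hK, h⟩ x‖ ≤ K * ‖x‖) x
    (isClosed_le (continuous_liftLin f _).norm (continuous_const.mul continuous_norm)) fun t => by
      rw [Completion.norm_coe]
      exact (congrArg norm (liftLin_coe f _ t)).le.trans (norm_le_projNorm f hK h t)

/-- The bounded linear map on the completed tensor product which is given by a bounded bilinear
map. -/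
noncomputable def lift {M N P : BanMod R} (f : M →ₗ[R] N →ₗ[R] P)
    (h : ∃ K : ℝ, 0 ≤ K ∧ ∀ m n, ‖f m n‖ ≤ K * (‖m‖ * ‖n‖)) : tensor M N ⟶ P where
  toLin := liftLin (TensorProduct.lift f) (by simpa using h)
  bounded := by
    obtain ⟨K, hK, hb⟩ := h
    exact ⟨K, norm_liftLin_le (TensorProduct.lift f) hK (by simpa using hb)⟩

@[simp]
theorem lift_tmul {M N P : BanMod R} (f : M →ₗ[R] N →ₗ[R] P)
    (h : ∃ K : ℝ, 0 ≤ K ∧ ∀ m n, ‖f m n‖ ≤ K * (‖m‖ * ‖n‖)) (m : M) (n : N) :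
    (lift f h).toLin (tmul m n) = f m n :=
  (liftLin_coe (TensorProduct.lift f) (by simpa using h) _).trans (TensorProduct.lift.tmul m n)

theorem norm_lift_le {M N P : BanMod R} (f : M →ₗ[R] N →ₗ[R] P) {K : ℝ} (hK : 0 ≤ K)
    (h : ∀ m n, ‖f m n‖ ≤ K * (‖m‖ * ‖n‖)) (x : tensor M N) :
    ‖(lift f ⟨K, hK, h⟩).toLin x‖ ≤ K * ‖x‖ :=
  norm_liftLin_le (TensorProduct.lift f) hK (by simpa using h) x

/-- The pure tensors as a bilinear map. -/
noncomputable def tmulBilin (M N : BanMod R) : M →ₗ[R] N →ₗ[R] tensor M N :=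
  LinearMap.mk₂ R (tmul (M := M) (N := N)) add_tmul smul_tmul' tmul_add tmul_smul

@[simp] theorem tmulBilin_apply {M N : BanMod R} (m : M) (n : N) :
    tmulBilin M N m n = tmul m n := rfl

/-- The map `m ↦ m ⊗ n`. -/
noncomputable def tmulRight (M : BanMod R) {N : BanMod R} (n : N) : M ⟶ tensor M N where
  toLin := (tmulBilin M N).flip n
  bounded := ⟨‖n‖, fun m => (norm_tmul_le m n).trans (mul_comm _ _).le⟩

@[simp] theorem tmulRight_apply {M N : BanMod R} (m : M) (n : N) :
    (tmulRight M n).toLin m = tmul m n := rfl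

/-- The map `n ↦ m ⊗ n`. -/
noncomputable def tmulLeft {M : BanMod R} (N : BanMod R) (m : M) : N ⟶ tensor M N where
  toLin := tmulBilin M N m
  bounded := ⟨‖m‖, fun n => norm_tmul_le m n⟩

@[simp] theorem tmulLeft_apply {M N : BanMod R} (m : M) (n : N) :
    (tmulLeft N m).toLin n = tmul m n := rfl

theorem tensor_ext₃ {M N P Q : BanMod R} {f g : tensor (tensor M N) P ⟶ Q}
    (h : ∀ m n p, f.toLin (tmul (tmul m n) p) = g.toLin (tmul (tmul m n) p)) : f = g :=
  tensor_ext fun x p => by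
    have : tmulRight (tensor M N) p ≫ f = tmulRight (tensor M N) p ≫ g :=
      tensor_ext fun m n => h m n p
    exact congrArg (fun k => k.toLin x) this

theorem tensor_ext₃' {M N P Q : BanMod R} {f g : tensor M (tensor N P) ⟶ Q}
    (h : ∀ m n p, f.toLin (tmul m (tmul n p)) = g.toLin (tmul m (tmul n p))) : f = g :=
  tensor_ext fun m x => by
    have : tmulLeft (tensor N P) m ≫ f = tmulLeft (tensor N P) m ≫ g :=
      tensor_ext fun n p => h m n p
    exact congrArg (fun k => k.toLin x) this

theorem tensor_ext₄ {M N P Q S : BanMod R} {f g : tensor (tensor (tensor M N) P) Q ⟶ S}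
    (h : ∀ m n p q, f.toLin (tmul (tmul (tmul m n) p) q) = g.toLin (tmul (tmul (tmul m n) p) q)) :
    f = g :=
  tensor_ext fun x q => by
    have : tmulRight (tensor (tensor M N) P) q ≫ f = tmulRight (tensor (tensor M N) P) q ≫ g :=
      tensor_ext₃ fun m n p => h m n p q
    exact congrArg (fun k => k.toLin x) this

/-- The tensor product of bounded maps. -/
noncomputable def tensorMap {M N M' N' : BanMod R} (f : M ⟶ M') (g : N ⟶ N') :
    tensor M N ⟶ tensor M' N' :=
  lift ((tmulBilin M' N').compl₁₂ f.toLin g.toLin) (by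
    obtain ⟨C, hC0, hC⟩ := exists_bound_nonneg f
    obtain ⟨D, hD0, hD⟩ := exists_bound_nonneg g
    refine ⟨C * D, mul_nonneg hC0 hD0, fun m n => ?_⟩
    calc ‖tmul (f.toLin m) (g.toLin n)‖ ≤ ‖f.toLin m‖ * ‖g.toLin n‖ := norm_tmul_le _ _
      _ ≤ (C * ‖m‖) * (D * ‖n‖) :=
        mul_le_mul (hC m) (hD n) (norm_nonneg _) (mul_nonneg hC0 (norm_nonneg _))
      _ = C * D * (‖m‖ * ‖n‖) := by ring)

@[simp]
theorem tensorMap_tmul {M N M' N' : BanMod R} (f : M ⟶ M') (g : N ⟶ N') (m : M) (n : N) :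
    (tensorMap f g).toLin (tmul m n) = tmul (f.toLin m) (g.toLin n) :=
  lift_tmul _ _ _ _

/-- The partial associator `(m ⊗ n) ↦ m ⊗ (n ⊗ p)`. -/
noncomputable def assocAux (M N : BanMod R) {P : BanMod R} (p : P) :
    tensor M N ⟶ tensor M (tensor N P) :=
  tensorMap (𝟙 M) (tmulRight N p)

theorem norm_assocAux_le {M N P : BanMod R} (p : P) (x : tensor M N) :
    ‖(assocAux M N p).toLin x‖ ≤ ‖p‖ * ‖x‖ := by
  refine norm_lift_le _ (norm_nonneg p) (fun m n => ?_) x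
  calc ‖tmul m (tmul n p)‖ ≤ ‖m‖ * ‖tmul n p‖ := norm_tmul_le _ _
    _ ≤ ‖m‖ * (‖n‖ * ‖p‖) := mul_le_mul_of_nonneg_left (norm_tmul_le n p) (norm_nonneg m)
    _ = ‖p‖ * (‖m‖ * ‖n‖) := by ring

noncomputable instance (M N : BanMod R) : Add (M ⟶ N) where
  add f g := ⟨f.toLin + g.toLin, by
    obtain ⟨C, hC⟩ := f.bounded
    obtain ⟨D, hD⟩ := g.bounded
    exact ⟨C + D, fun x => (norm_add_le _ _).trans (by
      rw [add_mul]; exact add_le_add (hC x) (hD x))⟩⟩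

noncomputable instance (M N : BanMod R) : SMul R (M ⟶ N) where
  smul a f := ⟨a • f.toLin, by
    obtain ⟨C, hC⟩ := f.bounded
    obtain ⟨D, hD0, hD⟩ := N.exists_norm_smul_le
    refine ⟨D * ‖a‖ * C, fun x => (hD a _).trans ?_⟩
    rw [mul_assoc _ C]
    exact mul_le_mul_of_nonneg_left (hC x) (by positivity)⟩

theorem add_hom_apply {M N : BanMod R} (f g : M ⟶ N) (x : M) :
    (f + g).toLin x = f.toLin x + g.toLin x := rfl

theorem smul_hom_apply {M N : BanMod R} (a : R) (f : M ⟶ N) (x : M) :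
    (a • f).toLin x = a • f.toLin x := rfl

noncomputable def assocHom (M N P : BanMod R) :
    tensor (tensor M N) P ⟶ tensor M (tensor N P) :=
  lift (LinearMap.mk₂ R (fun x p => (assocAux M N p).toLin x)
    (fun x y p => map_add _ x y) (fun a x p => map_smul _ a x)
    (fun x p q => by
      have : assocAux M N (p + q) = assocAux M N p + assocAux M N q :=
        tensor_ext fun m n => by simp [assocAux, add_hom_apply, tmul_add]
      rw [this, add_hom_apply])
    (fun a x p => by
      have : assocAux M N (a • p) = a • assocAux M N p :=
        tensor_ext fun m n => by simp [assocAux, smul_hom_apply, tmul_smul]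
      rw [this, smul_hom_apply]))
    ⟨1, zero_le_one, fun x p => by
      rw [one_mul, mul_comm]
      exact norm_assocAux_le p x⟩

@[simp]
theorem assocHom_tmul {M N P : BanMod R} (m : M) (n : N) (p : P) :
    (assocHom M N P).toLin (tmul (tmul m n) p) = tmul m (tmul n p) :=
  (lift_tmul _ _ _ _).trans (tensorMap_tmul _ _ _ _)

noncomputable def braidHom (M N : BanMod R) : tensor M N ⟶ tensor N M :=
  lift (tmulBilin N M).flip ⟨1, zero_le_one, fun m n => by
    rw [one_mul, mul_comm]
    exact norm_tmul_le n m⟩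

@[simp]
theorem braidHom_tmul {M N : BanMod R} (m : M) (n : N) :
    (braidHom M N).toLin (tmul m n) = tmul n m :=
  lift_tmul _ _ _ _

theorem braidHom_braidHom (M N : BanMod R) : braidHom M N ≫ braidHom N M = 𝟙 _ :=
  tensor_ext fun _ _ => by simp

noncomputable def assocInv (M N P : BanMod R) :
    tensor M (tensor N P) ⟶ tensor (tensor M N) P :=
  braidHom _ _ ≫ assocHom N P M ≫ braidHom _ _ ≫ assocHom P M N ≫ braidHom _ _

@[simp]
theorem assocInv_tmul {M N P : BanMod R} (m : M) (n : N) (p : P) :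
    (assocInv M N P).toLin (tmul m (tmul n p)) = tmul (tmul m n) p := by
  simp [assocInv]

/-- The ring as a Banach module over itself. -/
abbrev unit (R : Type u) [BanachCommRing R] : BanMod R where
  carrier := R
  exists_norm_smul_le := BanachCommRing.exists_norm_mul_le

noncomputable def leftHom (M : BanMod R) : tensor (unit R) M ⟶ M :=
  lift (LinearMap.lsmul R M) (by
    obtain ⟨C, hC0, hC⟩ := M.exists_norm_smul_le
    exact ⟨C, hC0.le, fun a m => (hC a m).trans (mul_assoc _ _ _).le⟩)

@[simp]
theorem leftHom_tmul {M : BanMod R} (a : R) (m : M) :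
    (leftHom M).toLin (tmul (M := unit R) a m) = a • m :=
  lift_tmul _ _ _ _

noncomputable def rightHom (M : BanMod R) : tensor M (unit R) ⟶ M :=
  braidHom _ _ ≫ leftHom M

@[simp]
theorem rightHom_tmul {M : BanMod R} (a : R) (m : M) :
    (rightHom M).toLin (tmul (N := unit R) m a) = a • m := by
  rw [rightHom, comp_apply, braidHom_tmul, leftHom_tmul]

theorem tmul_unit {M : BanMod R} (a : R) (m : M) :
    tmul (M := unit R) (1 : R) (a • m) = tmul (M := unit R) a m := by
  rw [tmul_smul, ← smul_tmul']
  exact congrArg (fun b : R => tmul (M := unit R) b m) (mul_one a)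

theorem unit_tmul {M : BanMod R} (a : R) (m : M) :
    tmul (N := unit R) (a • m) (1 : R) = tmul (N := unit R) m a := by
  rw [smul_tmul', ← tmul_smul]
  exact congrArg (fun b : R => tmul (N := unit R) m b) (mul_one a)

noncomputable instance : MonoidalCategoryStruct (BanMod R) where
  tensorObj := tensor
  tensorUnit := unit R
  tensorHom := tensorMap
  whiskerLeft X _ _ f := tensorMap (𝟙 X) f
  whiskerRight f Y := tensorMap f (𝟙 Y)
  associator X Y Z :=
    { hom := assocHom X Y Z
      inv := assocInv X Y Z
      hom_inv_id := tensor_ext₃ fun _ _ _ => by simp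
      inv_hom_id := tensor_ext₃' fun _ _ _ => by simp }
  leftUnitor X :=
    { hom := leftHom X
      inv := tmulLeft X (M := unit R) (1 : R)
      hom_inv_id := tensor_ext fun a m => by
        rw [comp_apply, leftHom_tmul, tmulLeft_apply, tmul_unit, id_apply]
      inv_hom_id := hom_ext fun m => by
        rw [comp_apply, tmulLeft_apply, leftHom_tmul, one_smul, id_apply] }
  rightUnitor X :=
    { hom := rightHom X
      inv := tmulRight X (N := unit R) (1 : R)
      hom_inv_id := tensor_ext fun m a => by
        rw [comp_apply, rightHom_tmul, tmulRight_apply, unit_tmul, id_apply]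
      inv_hom_id := hom_ext fun m => by
        rw [comp_apply, tmulRight_apply, rightHom_tmul, one_smul, id_apply] }

noncomputable instance : MonoidalCategory (BanMod R) :=
  MonoidalCategory.ofTensorHom
    (id_tensorHom_id := fun X Y => tensor_ext fun x y => tensorMap_tmul _ _ _ _)
    (id_tensorHom := fun _ _ _ _ => rfl)
    (tensorHom_id := fun _ _ => rfl)
    (tensorHom_comp_tensorHom := fun f₁ f₂ g₁ g₂ => tensor_ext fun x y => by
      change (tensorMap _ _ ≫ tensorMap _ _).toLin _ = (tensorMap _ _).toLin _
      simp)
    (associator_naturality := fun f₁ f₂ f₃ => tensor_ext₃ fun x y z => by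
      change (tensorMap (tensorMap _ _) _ ≫ assocHom _ _ _).toLin _ =
        (assocHom _ _ _ ≫ tensorMap _ (tensorMap _ _)).toLin _
      simp)
    (leftUnitor_naturality := fun {X Y} f => tensor_ext fun a x => by
      change (tensorMap (𝟙 (unit R)) _ ≫ leftHom _).toLin _ = (leftHom _ ≫ _).toLin _
      rw [comp_apply, tensorMap_tmul, id_apply, leftHom_tmul, comp_apply, leftHom_tmul, map_smul])
    (rightUnitor_naturality := fun {X Y} f => tensor_ext fun x a => by
      change (tensorMap _ (𝟙 (unit R)) ≫ rightHom _).toLin _ = (rightHom _ ≫ _).toLin _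
      rw [comp_apply, tensorMap_tmul, id_apply, rightHom_tmul, comp_apply, rightHom_tmul,
        map_smul])
    (pentagon := fun W X Y Z => tensor_ext₄ fun w x y z => by
      change (tensorMap (assocHom _ _ _) (𝟙 _) ≫ assocHom _ _ _ ≫
        tensorMap (𝟙 _) (assocHom _ _ _)).toLin _ = (assocHom _ _ _ ≫ assocHom _ _ _).toLin _
      simp)
    (triangle := fun X Y => tensor_ext₃ fun x a y => by
      change (assocHom _ (unit R) _ ≫ tensorMap (𝟙 _) (leftHom _)).toLin _ =
        (tensorMap (rightHom _) (𝟙 _)).toLin _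
      rw [comp_apply, assocHom_tmul, tensorMap_tmul, tensorMap_tmul, leftHom_tmul, rightHom_tmul,
        id_apply, id_apply, tmul_smul, smul_tmul'])

noncomputable instance : SymmetricCategory (BanMod R) where
  braiding X Y := ⟨braidHom X Y, braidHom Y X, braidHom_braidHom X Y, braidHom_braidHom Y X⟩
  braiding_naturality_right X Y Z f := tensor_ext fun x y => by
    change (tensorMap (𝟙 _) f ≫ braidHom _ _).toLin _ = (braidHom _ _ ≫ tensorMap f (𝟙 _)).toLin _
    simp
  braiding_naturality_left f Z := tensor_ext fun x y => by
    change (tensorMap f (𝟙 _) ≫ braidHom _ _).toLin _ = (braidHom _ _ ≫ tensorMap (𝟙 _) f).toLin _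
    simp
  hexagon_forward X Y Z := tensor_ext₃ fun x y z => by
    change (assocHom _ _ _ ≫ braidHom _ (tensor _ _) ≫ assocHom _ _ _).toLin _ =
      (tensorMap (braidHom _ _) (𝟙 _) ≫ assocHom _ _ _ ≫ tensorMap (𝟙 _) (braidHom _ _)).toLin _
    simp
  hexagon_reverse X Y Z := tensor_ext₃' fun x y z => by
    change (assocInv _ _ _ ≫ braidHom (tensor _ _) _ ≫ assocInv _ _ _).toLin _ =
      (tensorMap (𝟙 _) (braidHom _ _) ≫ assocInv _ _ _ ≫ tensorMap (braidHom _ _) (𝟙 _)).toLin _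
    simp
  symmetry X Y := braidHom_braidHom X Y

end BanMod
/-! ### Polydisc algebras -/

/-- The positive real numbers. -/
abbrev PosReal : Type := Set.Ioi (0 : ℝ)

namespace Polydisc

section Series

variable {σ : Type} [Fintype σ]

/-- The monomial `r ^ J`. -/
def weight (r : σ → PosReal) (J : σ →₀ ℕ) : ℝ := ∏ i, (r i : ℝ) ^ J i

theorem weight_pos (r : σ → PosReal) (J : σ →₀ ℕ) : 0 < weight r J :=
  Finset.prod_pos fun i _ => pow_pos (r i).2 _

theorem weight_zero (r : σ → PosReal) : weight r 0 = 1 := by simp [weight]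

theorem weight_add (r : σ → PosReal) (J K : σ →₀ ℕ) :
    weight r (J + K) = weight r J * weight r K := by
  simp [weight, pow_add, Finset.prod_mul_distrib]

theorem weight_mono {r s : σ → PosReal} (h : r ≤ s) (J : σ →₀ ℕ) : weight r J ≤ weight s J :=
  Finset.prod_le_prod (fun i _ => (pow_pos (r i).2 _).le)
    fun i _ => pow_le_pow_left₀ (le_of_lt (r i).2) (show (r i : ℝ) ≤ s i from h i) _

variable (R : Type u) [BanachCommRing R]

/-- The terms `‖a_J‖ r ^ J` for a power series `∑ a_J x ^ J`. -/
noncomputable def term (r : σ → PosReal) (f : MvPowerSeries σ R) (J : σ →₀ ℕ) : ℝ :=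
  ‖MvPowerSeries.coeff J f‖ * weight r J

variable {R}

theorem term_nonneg (r : σ → PosReal) (f : MvPowerSeries σ R) (J : σ →₀ ℕ) : 0 ≤ term R r f J :=
  mul_nonneg (norm_nonneg _) (weight_pos r J).le

theorem term_add_le (r : σ → PosReal) (f g : MvPowerSeries σ R) (J : σ →₀ ℕ) :
    term R r (f + g) J ≤ term R r f J + term R r g J := by
  rw [term, term, term, map_add, ← add_mul]
  exact mul_le_mul_of_nonneg_right (norm_add_le _ _) (weight_pos r J).le

theorem term_mul_le [DecidableEq σ] {C : ℝ} (hC : ∀ a b : R, ‖a * b‖ ≤ C * ‖a‖ * ‖b‖)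
    (r : σ → PosReal) (f g : MvPowerSeries σ R) (J : σ →₀ ℕ) :
    term R r (f * g) J ≤
      C * ∑ p ∈ Finset.HasAntidiagonal.antidiagonal J, term R r f p.1 * term R r g p.2 := by
  rw [term, MvPowerSeries.coeff_mul, Finset.mul_sum]
  refine (mul_le_mul_of_nonneg_right (norm_sum_le _ _) (weight_pos r J).le).trans ?_
  rw [Finset.sum_mul]
  refine Finset.sum_le_sum fun p hp => ?_
  rw [← Finset.HasAntidiagonal.mem_antidiagonal.1 hp, weight_add]
  refine (mul_le_mul_of_nonneg_right (hC _ _)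
    (mul_pos (weight_pos r _) (weight_pos r _)).le).trans (le_of_eq ?_)
  simp only [term]
  ring

theorem summable_mul {r : σ → PosReal} {f g : MvPowerSeries σ R} (hf : Summable (term R r f))
    (hg : Summable (term R r g)) :
    Summable fun x : (σ →₀ ℕ) × (σ →₀ ℕ) => term R r f x.1 * term R r g x.2 :=
  hf.mul_of_nonneg hg (term_nonneg r f) (term_nonneg r g)

theorem term_C_eq (r : σ → PosReal) (a : R) {J : σ →₀ ℕ} (h : J ≠ 0) :
    term R r (MvPowerSeries.C a) J = 0 := by
  classical
  rw [term, MvPowerSeries.coeff_C, if_neg h, norm_zero, zero_mul]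

theorem term_C_zero (r : σ → PosReal) (a : R) : term R r (MvPowerSeries.C a) 0 = ‖a‖ := by
  simp [term, weight_zero]

theorem hasSum_term_C (r : σ → PosReal) (a : R) : HasSum (term R r (MvPowerSeries.C a)) ‖a‖ := by
  rw [← term_C_zero r a]
  exact hasSum_single 0 fun J h => term_C_eq r a h

variable (R)

/-- The algebra of the power series `∑ a_J x ^ J` for which `∑ ‖a_J‖ r ^ J` is finite. -/
noncomputable def alg (r : σ → PosReal) : Subalgebra R (MvPowerSeries σ R) where
  carrier := {f | Summable (term R r f)}
  add_mem' {f g} hf hg := (hf.add hg).of_nonneg_of_le (term_nonneg r _) (term_add_le r f g)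
  mul_mem' {f g} hf hg := by
    classical
    obtain ⟨C, -, hC⟩ := BanachCommRing.exists_norm_mul_le (R := R)
    exact ((summable_sum_mul_antidiagonal_of_summable_mul (summable_mul hf hg)).mul_left C
      ).of_nonneg_of_le (term_nonneg r _) (term_mul_le hC r f g)
  algebraMap_mem' a := (hasSum_term_C r a).summable

variable {R}

theorem alg_summable {r : σ → PosReal} (f : alg R r) : Summable (term R r f.1) := f.2

/-- The norm `∑ ‖a_J‖ r ^ J`. -/
noncomputable instance (r : σ → PosReal) : NormedAddCommGroup (alg R r) :=
  AddGroupNorm.toNormedAddCommGroup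
    { toFun := fun f => ∑' J, term R r f.1 J
      map_zero' := by simp [term]
      add_le' := fun f g => by
        rw [← (alg_summable f).tsum_add (alg_summable g)]
        exact (alg_summable (f + g)).tsum_le_tsum (term_add_le r f.1 g.1)
          ((alg_summable f).add (alg_summable g))
      neg' := fun f => by simp [term]
      eq_zero_of_map_eq_zero' := fun f hf => by
        have h := (hasSum_zero_iff_of_nonneg (term_nonneg r f.1)).1
          (hf ▸ (alg_summable f).hasSum)
        refine Subtype.ext (MvPowerSeries.ext fun J => ?_)
        have hJ := congrFun h J
        exact norm_eq_zero.1 ((mul_eq_zero.1 hJ).resolve_right (weight_pos r J).ne') }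

theorem norm_def (r : σ → PosReal) (f : alg R r) : ‖f‖ = ∑' J, term R r f.1 J := rfl

theorem norm_coeff_mul_le {r : σ → PosReal} (f : alg R r) (J : σ →₀ ℕ) :
    term R r f.1 J ≤ ‖f‖ :=
  (alg_summable f).le_tsum J fun K _ => term_nonneg r f.1 K

theorem norm_mul_le {C : ℝ} (hC : ∀ a b : R, ‖a * b‖ ≤ C * ‖a‖ * ‖b‖)
    {r : σ → PosReal} (f g : alg R r) : ‖f * g‖ ≤ C * (‖f‖ * ‖g‖) := by
  classical
  rw [norm_def r f, norm_def r g, (alg_summable f).tsum_mul_tsum_eq_tsum_sum_antidiagonal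
    (alg_summable g) (summable_mul (alg_summable f) (alg_summable g)), ← tsum_mul_left]
  exact (alg_summable (f * g)).tsum_le_tsum (term_mul_le hC r f.1 g.1)
    ((summable_sum_mul_antidiagonal_of_summable_mul
      (summable_mul (alg_summable f) (alg_summable g))).mul_left C)

theorem norm_algebraMap (r : σ → PosReal) (a : R) : ‖algebraMap R (alg R r) a‖ = ‖a‖ :=
  (hasSum_term_C r a).tsum_eq

theorem norm_smul_le {C : ℝ} (hC : ∀ a b : R, ‖a * b‖ ≤ C * ‖a‖ * ‖b‖) {r : σ → PosReal}
    (a : R) (f : alg R r) : ‖a • f‖ ≤ C * ‖a‖ * ‖f‖ := by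
  rw [Algebra.smul_def, mul_assoc, ← norm_algebraMap r a]
  exact norm_mul_le hC _ _

instance (r : σ → PosReal) : CompleteSpace (alg R r) := by
  refine NormedAddCommGroup.completeSpace_of_summable_imp_tendsto fun u hu => ?_
  have hprod : Summable fun p : ℕ × (σ →₀ ℕ) => term R r (u p.1).1 p.2 :=
    (summable_prod_of_nonneg fun p => term_nonneg r _ _).2 ⟨fun n => alg_summable (u n), hu⟩
  have hsum : ∀ J, Summable fun n => term R r (u n).1 J := fun J =>
    hprod.comp_injective (i := fun n => (n, J)) fun a b h => (Prod.ext_iff.1 h).1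
  have hnorm : ∀ J, Summable fun n => ‖MvPowerSeries.coeff J (u n).1‖ := fun J =>
    (summable_mul_right_iff (weight_pos r J).ne').1 (hsum J)
  have hcoe : ∀ J, Summable fun n => MvPowerSeries.coeff J (u n).1 := fun J => (hnorm J).of_norm
  -- The remainders of the series of coefficients.
  have hrem : ∀ N J, ‖(∑' n, MvPowerSeries.coeff J (u (n + N)).1)‖ * weight r J ≤
      ∑' n, term R r (u (n + N)).1 J := fun N J => by
    have h1 := (summable_nat_add_iff N).2 (hnorm J)
    rw [show (∑' n, term R r (u (n + N)).1 J) =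
      (∑' n, ‖MvPowerSeries.coeff J (u (n + N)).1‖) * weight r J from tsum_mul_right]
    exact mul_le_mul_of_nonneg_right (norm_tsum_le_tsum_norm h1) (weight_pos r J).le
  have hprodN : ∀ N, Summable fun p : ℕ × (σ →₀ ℕ) => term R r (u (p.1 + N)).1 p.2 := fun N =>
    hprod.comp_injective (i := fun p : ℕ × (σ →₀ ℕ) => (p.1 + N, p.2)) fun a b h => by
      obtain ⟨h1, h2⟩ := Prod.ext_iff.1 h
      exact Prod.ext (Nat.add_right_cancel h1) h2
  have hsumN : ∀ N, Summable fun J => ∑' n, term R r (u (n + N)).1 J := fun N =>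
    (hprodN N).prod_symm.prod
  let rem : ℕ → MvPowerSeries σ R := fun N J => ∑' n, MvPowerSeries.coeff J (u (n + N)).1
  have hremmem : ∀ N, rem N ∈ alg R r := fun N =>
    (hsumN N).of_nonneg_of_le (term_nonneg r _) (hrem N)
  have hremnorm : ∀ N, ‖(⟨rem N, hremmem N⟩ : alg R r)‖ ≤ ∑' n, ‖u (n + N)‖ := fun N => by
    refine ((hremmem N).tsum_le_tsum (hrem N) (hsumN N)).trans (le_of_eq ?_)
    exact Summable.tsum_comm (f := fun (n : ℕ) (J : σ →₀ ℕ) => term R r (u (n + N)).1 J)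
      (hprodN N)
  refine ⟨⟨rem 0, hremmem 0⟩, ?_⟩
  rw [tendsto_iff_norm_sub_tendsto_zero]
  refine squeeze_zero (fun _ => norm_nonneg _) (fun N => ?_) (tendsto_sum_nat_add fun n => ‖u n‖)
  have e : ∑ i ∈ Finset.range N, u i - (⟨rem 0, hremmem 0⟩ : alg R r) = -⟨rem N, hremmem N⟩ := by
    rw [sub_eq_iff_eq_add, eq_neg_add_iff_add_eq, eq_comm]
    refine Subtype.ext (MvPowerSeries.ext fun J => ?_)
    have := (hcoe J).sum_add_tsum_nat_add N
    rw [add_comm] at this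
    simp only [Subalgebra.coe_add, AddSubmonoidClass.coe_finsetSum, map_add, map_sum]
    have hc : ∀ N, MvPowerSeries.coeff J (rem N) =
      ∑' n, MvPowerSeries.coeff J (u (n + N)).1 := fun _ => rfl
    rw [hc, hc]
    simp only [add_zero]
    exact this.symm
  rw [e, norm_neg]
  exact hremnorm N

/-- The Banach module underlying a polydisc algebra. -/
noncomputable abbrev mod (r : σ → PosReal) : BanMod R where
  carrier := alg R r
  exists_norm_smul_le := by
    obtain ⟨C, hC0, hC⟩ := BanachCommRing.exists_norm_mul_le (R := R)
    exact ⟨C, hC0, norm_smul_le hC⟩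

/-- The multiplication of a polydisc algebra. -/
noncomputable def mulHom (r : σ → PosReal) :
    BanMod.tensor (mod (R := R) r) (mod r) ⟶ mod r :=
  BanMod.lift (LinearMap.mul R (alg R r)) (by
    obtain ⟨C, hC0, hC⟩ := BanachCommRing.exists_norm_mul_le (R := R)
    exact ⟨C, hC0.le, norm_mul_le hC⟩)

@[simp]
theorem mulHom_tmul {r : σ → PosReal} (f g : alg R r) :
    (mulHom r).toLin (BanMod.tmul (M := mod r) (N := mod r) f g) = f * g :=
  BanMod.lift_tmul (M := mod r) (N := mod r) (P := mod r) _ _ _ _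

/-- The unit of a polydisc algebra. -/
noncomputable def oneHom (r : σ → PosReal) : BanMod.unit R ⟶ mod r where
  toLin := Algebra.linearMap R (alg R r)
  bounded := ⟨1, fun a => by
    rw [one_mul]
    exact (norm_algebraMap r a).le⟩

theorem oneHom_apply {r : σ → PosReal} (a : R) :
    (oneHom r).toLin a = algebraMap R (alg R r) a := rfl

theorem oneHom_mulHom (r : σ → PosReal) :
    BanMod.tensorMap (oneHom r) (𝟙 (mod (R := R) r)) ≫ mulHom r = BanMod.leftHom _ :=
  BanMod.tensor_ext fun a f => by
    rw [BanMod.comp_apply, BanMod.tensorMap_tmul, BanMod.id_apply, BanMod.leftHom_tmul]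
    exact (mulHom_tmul _ _).trans (Algebra.smul_def a f).symm

theorem mulHom_oneHom (r : σ → PosReal) :
    BanMod.tensorMap (𝟙 (mod (R := R) r)) (oneHom r) ≫ mulHom r = BanMod.rightHom _ :=
  BanMod.tensor_ext fun f a => by
    rw [BanMod.comp_apply, BanMod.tensorMap_tmul, BanMod.id_apply, BanMod.rightHom_tmul]
    exact (mulHom_tmul _ _).trans ((mul_comm _ _).trans (Algebra.smul_def a f).symm)

theorem mulHom_assoc (r : σ → PosReal) :
    BanMod.tensorMap (mulHom (R := R) r) (𝟙 _) ≫ mulHom r =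
      BanMod.assocHom _ _ _ ≫ BanMod.tensorMap (𝟙 _) (mulHom r) ≫ mulHom r :=
  BanMod.tensor_ext₃ fun f g h => by
    rw [BanMod.comp_apply, BanMod.comp_apply, BanMod.comp_apply, BanMod.assocHom_tmul,
      BanMod.tensorMap_tmul, BanMod.tensorMap_tmul, mulHom_tmul, mulHom_tmul, BanMod.id_apply,
      BanMod.id_apply, mulHom_tmul, mulHom_tmul, mul_assoc]

theorem mulHom_comm (r : σ → PosReal) :
    BanMod.braidHom _ _ ≫ mulHom (R := R) r = mulHom r :=
  BanMod.tensor_ext fun f g => by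
    rw [BanMod.comp_apply, BanMod.braidHom_tmul, mulHom_tmul, mulHom_tmul, mul_comm]

noncomputable instance (r : σ → PosReal) : MonObj (mod (R := R) r) where
  one := oneHom r
  mul := mulHom r
  one_mul := oneHom_mulHom r
  mul_one := mulHom_oneHom r
  mul_assoc := mulHom_assoc r

instance (r : σ → PosReal) : IsCommMonObj (mod (R := R) r) where
  mul_comm := mulHom_comm r

theorem term_mono {r s : σ → PosReal} (h : r ≤ s) (f : MvPowerSeries σ R) (J : σ →₀ ℕ) :
    term R r f J ≤ term R s f J :=
  mul_le_mul_of_nonneg_left (weight_mono h J) (norm_nonneg _)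

theorem alg_anti {r s : σ → PosReal} (h : r ≤ s) : alg R s ≤ alg R r := fun f hf =>
  Summable.of_nonneg_of_le (term_nonneg r f) (term_mono h f) (alg_summable ⟨f, hf⟩)

theorem norm_inclusion_le {r s : σ → PosReal} (h : r ≤ s) (f : alg R s) :
    ‖(⟨f.1, alg_anti h f.2⟩ : alg R r)‖ ≤ ‖f‖ := by
  rw [norm_def, norm_def]
  exact Summable.tsum_le_tsum (term_mono h f.1) (alg_summable ⟨f.1, alg_anti h f.2⟩)
    (alg_summable f)

/-- The restriction of convergent power series to a smaller polydisc. -/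
noncomputable def res {r s : σ → PosReal} (h : r ≤ s) : mod (R := R) s ⟶ mod r where
  toLin := (Subalgebra.inclusion (alg_anti h)).toLinearMap
  bounded := ⟨1, fun f => by
    rw [one_mul]
    exact norm_inclusion_le h f⟩

@[simp]
theorem coe_res {r s : σ → PosReal} (h : r ≤ s) (f : alg R s) :
    ((res (R := R) h).toLin f : alg R r).1 = f.1 :=
  Subalgebra.coe_inclusion (alg_anti h) f

theorem coe_oneHom (r : σ → PosReal) (a : R) :
    ((oneHom r).toLin a : alg R r).1 = algebraMap R (MvPowerSeries σ R) a := rfl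

theorem oneHom_res {r s : σ → PosReal} (h : r ≤ s) :
    oneHom s ≫ res (R := R) h = oneHom r :=
  BanMod.hom_ext fun a => Subtype.ext
    ((coe_res h ((oneHom s).toLin a)).trans ((coe_oneHom s a).trans (coe_oneHom r a).symm))

theorem mulHom_res {r s : σ → PosReal} (h : r ≤ s) :
    mulHom s ≫ res (R := R) h = BanMod.tensorMap (res h) (res h) ≫ mulHom r :=
  BanMod.tensor_ext fun f g => by
    rw [BanMod.comp_apply, BanMod.comp_apply, BanMod.tensorMap_tmul, mulHom_tmul, mulHom_tmul]
    refine Subtype.ext ((coe_res h _).trans ?_)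
    rw [MulMemClass.coe_mul, MulMemClass.coe_mul, coe_res, coe_res]

instance {r s : σ → PosReal} (h : r ≤ s) : IsMonHom (res (R := R) h) where
  one_hom := oneHom_res h
  mul_hom := mulHom_res h

variable (R) in
/-- The commutative Banach algebra `R{x/r}` of the power series `∑ a_J x ^ J` for which
`∑ ‖a_J‖ r ^ J` is finite. -/
noncomputable def disk (r : σ → PosReal) : CommMon (BanMod R) where
  X := mod r

theorem res_refl (r : σ → PosReal) : res (R := R) (le_refl r) = 𝟙 _ :=
  BanMod.hom_ext fun f => Subtype.ext (coe_res (le_refl r) f)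

theorem res_trans {r s t : σ → PosReal} (h : r ≤ s) (k : s ≤ t) :
    res (R := R) k ≫ res h = res (h.trans k) :=
  BanMod.hom_ext fun f => Subtype.ext
    ((coe_res h ((res k).toLin f)).trans ((coe_res k f).trans (coe_res (h.trans k) f).symm))

/-- The restriction as a morphism of algebras. -/
noncomputable def resMon {r s : σ → PosReal} (h : r ≤ s) : disk R s ⟶ disk R r :=
  CommMon.homMk (A := disk R s) (B := disk R r)
    (Mon.Hom.mk (M := (disk R s).toMon) (N := (disk R r).toMon) (res h)
      (isMonHom_hom := inferInstanceAs (IsMonHom (res (R := R) h))))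

variable (R) in
/-- The inverse system of the algebras `R{x/r}` for a monotone family of polyradii `r`. -/
noncomputable def diagram {P : Type} [Preorder P] (r : P →o (σ → PosReal)) :
    Pᵒᵖ ⥤ CommMon (BanMod R) where
  obj p := disk R (r p.unop)
  map h := resMon (r.monotone (leOfHom h.unop))
  map_id _ := InducedCategory.hom_ext (Mon.Hom.ext (res_refl _))
  map_comp h k := InducedCategory.hom_ext (Mon.Hom.ext 
    (res_trans (r.monotone (leOfHom k.unop)) (r.monotone (leOfHom h.unop))).symm)

end Series

section Ext

variable {R : Type u} [BanachCommRing R] {n m : ℕ}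

/-- The multi-index of the first variables. -/
noncomputable def fstIdx (L : Fin (n + m) →₀ ℕ) : Fin n →₀ ℕ :=
  Finsupp.equivFunOnFinite.symm fun i => L (Fin.castAdd m i)

/-- The multi-index of the last variables. -/
noncomputable def sndIdx (L : Fin (n + m) →₀ ℕ) : Fin m →₀ ℕ :=
  Finsupp.equivFunOnFinite.symm fun j => L (Fin.natAdd n j)

theorem idx_injective :
    Function.Injective fun L : Fin (n + m) →₀ ℕ => (fstIdx L, sndIdx L) := fun L L' h => by
  obtain ⟨h1, h2⟩ := Prod.ext_iff.1 h
  ext k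
  refine Fin.addCases (fun i => ?_) (fun j => ?_) k
  · exact DFunLike.congr_fun h1 i
  · exact DFunLike.congr_fun h2 j

theorem weight_append (r : Fin n → PosReal) (s : Fin m → PosReal) (L : Fin (n + m) →₀ ℕ) :
    weight (Fin.append r s) L = weight r (fstIdx L) * weight s (sndIdx L) := by
  simp [weight, Fin.prod_univ_add, fstIdx, sndIdx]

/-- The product `f(x) g(y)` of power series in different variables. -/
noncomputable def extMul (f : MvPowerSeries (Fin n) R) (g : MvPowerSeries (Fin m) R) :
    MvPowerSeries (Fin (n + m)) R :=
  fun L => MvPowerSeries.coeff (fstIdx L) f * MvPowerSeries.coeff (sndIdx L) g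

theorem coeff_extMul (f : MvPowerSeries (Fin n) R) (g : MvPowerSeries (Fin m) R)
    (L : Fin (n + m) →₀ ℕ) : MvPowerSeries.coeff L (extMul f g) =
      MvPowerSeries.coeff (fstIdx L) f * MvPowerSeries.coeff (sndIdx L) g := rfl

theorem term_extMul_le {C : ℝ} (hC : ∀ a b : R, ‖a * b‖ ≤ C * ‖a‖ * ‖b‖)
    (r : Fin n → PosReal) (s : Fin m → PosReal) (f : MvPowerSeries (Fin n) R)
    (g : MvPowerSeries (Fin m) R) (L : Fin (n + m) →₀ ℕ) :
    term R (Fin.append r s) (extMul f g) L ≤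
      C * (term R r f (fstIdx L) * term R s g (sndIdx L)) := by
  rw [term, coeff_extMul, weight_append]
  refine (mul_le_mul_of_nonneg_right (hC _ _)
    (mul_pos (weight_pos r _) (weight_pos s _)).le).trans (le_of_eq ?_)
  simp only [term]
  ring

theorem summable_ext {r : Fin n → PosReal} {s : Fin m → PosReal} (f : alg R r) (g : alg R s) :
    Summable fun x : (Fin n →₀ ℕ) × (Fin m →₀ ℕ) => term R r f.1 x.1 * term R s g.1 x.2 :=
  (alg_summable f).mul_of_nonneg (alg_summable g) (term_nonneg r _) (term_nonneg s _)

/-- The product `f(x) g(y)` of convergent power series in different variables. -/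
noncomputable def extAlg {r : Fin n → PosReal} {s : Fin m → PosReal} (f : alg R r) (g : alg R s) :
    alg R (Fin.append r s) :=
  ⟨extMul f.1 g.1, by
    obtain ⟨C, -, hC⟩ := BanachCommRing.exists_norm_mul_le (R := R)
    exact (((summable_ext f g).comp_injective idx_injective).mul_left C).of_nonneg_of_le
      (term_nonneg _ _) (term_extMul_le hC r s f.1 g.1)⟩

theorem norm_extAlg_le {C : ℝ} (hC0 : 0 < C) (hC : ∀ a b : R, ‖a * b‖ ≤ C * ‖a‖ * ‖b‖)
    {r : Fin n → PosReal} {s : Fin m → PosReal} (f : alg R r) (g : alg R s) :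
    ‖extAlg f g‖ ≤ C * (‖f‖ * ‖g‖) := by
  have h1 := (summable_ext f g).comp_injective idx_injective
  refine ((alg_summable (extAlg f g)).tsum_le_tsum (term_extMul_le hC r s f.1 g.1)
    (h1.mul_left C)).trans ?_
  rw [tsum_mul_left, norm_def r f, norm_def s g,
    (alg_summable f).tsum_mul_tsum (alg_summable g) (summable_ext f g)]
  refine mul_le_mul_of_nonneg_left ?_ hC0.le
  exact tsum_comp_le_tsum_of_inj (summable_ext f g)
    (fun x => mul_nonneg (term_nonneg r _ _) (term_nonneg s _ _)) idx_injective

/-- The canonical map `R{x/r} ⊗ R{y/s} ⟶ R{x/r, y/s}`, which maps `f ⊗ g` to `f(x) g(y)`. -/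
noncomputable def extHom (r : Fin n → PosReal) (s : Fin m → PosReal) :
    mod (R := R) r ⊗ mod s ⟶ mod (Fin.append r s) :=
  BanMod.lift (P := mod (Fin.append r s))
    (LinearMap.mk₂ R (extAlg (R := R) (r := r) (s := s))
      (fun f f' g => Subtype.ext (MvPowerSeries.ext fun L => add_mul _ _ _))
      (fun a f g => Subtype.ext (MvPowerSeries.ext fun L => mul_assoc _ _ _))
      (fun f g g' => Subtype.ext (MvPowerSeries.ext fun L => mul_add _ _ _))
      (fun a f g => Subtype.ext (MvPowerSeries.ext fun L => mul_left_comm _ _ _)))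
    (by
      obtain ⟨C, hC0, hC⟩ := BanachCommRing.exists_norm_mul_le (R := R)
      exact ⟨C, hC0.le, norm_extAlg_le hC0 hC⟩)

theorem extHom_tmul {r : Fin n → PosReal} {s : Fin m → PosReal} (f : alg R r) (g : alg R s) :
    (extHom r s).toLin (BanMod.tmul (M := mod r) (N := mod s) f g) = extAlg f g :=
  BanMod.lift_tmul (M := mod r) (N := mod s) (P := mod (Fin.append r s)) _ _ _ _

end Ext

end Polydisc
/-! ### Limits of Banach modules in the category of ind-objects -/

/-- The growth functions on a set. -/
@[ext]
structure Growth (J : Type) : Type u where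
  fn : J → PosReal

namespace Growth

instance (J : Type) : PartialOrder (Growth.{u} J) :=
  PartialOrder.lift fn fun _ _ => Growth.ext

theorem le_def {J : Type} {φ ψ : Growth.{u} J} : φ ≤ ψ ↔ ∀ j, (φ.fn j : ℝ) ≤ ψ.fn j := Iff.rfl

instance (J : Type) : Nonempty (Growth.{u} J) := ⟨⟨fun _ => ⟨1, Set.mem_Ioi.2 one_pos⟩⟩⟩

instance (J : Type) : IsDirectedOrder (Growth.{u} J) :=
  ⟨fun φ ψ => ⟨⟨fun j => max (φ.fn j) (ψ.fn j)⟩, fun _ => le_max_left _ _,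
    fun _ => le_max_right _ _⟩⟩

end Growth

namespace BanMod

section Limit

variable {R : Type u} [BanachCommRing R] {J : Type} [SmallCategory J] (F : J ⥤ BanMod R)

/-- The members of the diagram satisfy the estimate for the scalar multiplication with a common
constant. -/
def UniformSMul : Prop :=
  ∃ C : ℝ, 0 < C ∧ ∀ (j : J) (a : R) (m : F.obj j), ‖a • m‖ ≤ C * ‖a‖ * ‖m‖

/-- The compatible families `v` for which `‖v j‖` is bounded by a multiple of `ψ j`. -/
def limSub (hF : UniformSMul F) (ψ : Growth.{u} J) : Submodule R (∀ j, F.obj j) where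
  carrier := {v | (∀ {j k : J} (f : j ⟶ k), (F.map f).toLin (v j) = v k) ∧
    ∃ C : ℝ, ∀ j, ‖v j‖ ≤ C * ψ.fn j}
  zero_mem' := ⟨fun f => map_zero _, 0, fun j => by simp⟩
  add_mem' := by
    rintro v w ⟨hv, C, hC⟩ ⟨hw, D, hD⟩
    refine ⟨fun f => (map_add _ _ _).trans (congrArg₂ (· + ·) (hv f) (hw f)), C + D, fun j => ?_⟩
    rw [add_mul]
    exact (norm_add_le _ _).trans (add_le_add (hC j) (hD j))
  smul_mem' := by
    rintro a v ⟨hv, C, hC⟩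
    obtain ⟨D, hD0, hD⟩ := hF
    refine ⟨fun f => (map_smul _ _ _).trans (congrArg (a • ·) (hv f)), D * ‖a‖ * C, fun j => ?_⟩
    refine (hD j a (v j)).trans ?_
    rw [mul_assoc _ C]
    exact mul_le_mul_of_nonneg_left (hC j) (by positivity)

variable {F}

/-- The type of the compatible families of growth `ψ`. -/
def LimType (hF : UniformSMul F) (ψ : Growth.{u} J) : Type u := limSub F hF ψ

noncomputable instance (hF : UniformSMul F) (ψ : Growth.{u} J) : AddCommGroup (LimType hF ψ) :=
  inferInstanceAs (AddCommGroup (limSub F hF ψ))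

noncomputable instance (hF : UniformSMul F) (ψ : Growth.{u} J) : Module R (LimType hF ψ) :=
  inferInstanceAs (Module R (limSub F hF ψ))

theorem bddAbove_limSub {hF : UniformSMul F} {ψ : Growth.{u} J} (v : LimType hF ψ) :
    BddAbove (Set.range fun j => ‖v.1 j‖ / ψ.fn j) := by
  obtain ⟨C, hC⟩ := v.2.2
  refine ⟨C, ?_⟩
  rintro _ ⟨j, rfl⟩
  exact (div_le_iff₀ (ψ.fn j).2).2 (hC j)

/-- The supremum of `‖v j‖ / ψ j`. -/
noncomputable def supNorm {hF : UniformSMul F} {ψ : Growth.{u} J} (v : LimType hF ψ) : ℝ :=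
  ⨆ j, ‖v.1 j‖ / ψ.fn j

theorem le_supNorm {hF : UniformSMul F} {ψ : Growth.{u} J} (v : LimType hF ψ) (j : J) :
    ‖v.1 j‖ ≤ supNorm v * ψ.fn j :=
  (div_le_iff₀ (ψ.fn j).2).1 (le_ciSup (bddAbove_limSub v) j)

theorem supNorm_le {hF : UniformSMul F} {ψ : Growth.{u} J} {v : LimType hF ψ} {C : ℝ}
    (hC : 0 ≤ C) (h : ∀ j, ‖v.1 j‖ ≤ C * ψ.fn j) : supNorm v ≤ C :=
  Real.iSup_le (fun j => (div_le_iff₀ (ψ.fn j).2).2 (h j)) hC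

theorem supNorm_nonneg {hF : UniformSMul F} {ψ : Growth.{u} J} (v : LimType hF ψ) :
    0 ≤ supNorm v :=
  Real.iSup_nonneg fun j => div_nonneg (norm_nonneg _) (le_of_lt (ψ.fn j).2)

noncomputable instance (hF : UniformSMul F) (ψ : Growth.{u} J) :
    NormedAddCommGroup (LimType hF ψ) :=
  AddGroupNorm.toNormedAddCommGroup
    { toFun := supNorm
      map_zero' := le_antisymm (supNorm_le le_rfl fun j => by
          rw [zero_mul]
          exact norm_zero.le) (supNorm_nonneg _)
      add_le' := fun v w => supNorm_le (add_nonneg (supNorm_nonneg v) (supNorm_nonneg w))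
        fun j => by
          rw [add_mul]
          exact (norm_add_le _ _).trans (add_le_add (le_supNorm v j) (le_supNorm w j))
      neg' := fun v => iSup_congr fun j => congrArg (· / (ψ.fn j : ℝ)) (norm_neg (v.1 j))
      eq_zero_of_map_eq_zero' := fun v hv => Subtype.ext (funext fun j => by
        have h := le_supNorm v j
        rw [hv, zero_mul] at h
        exact norm_le_zero_iff.1 h) }

theorem norm_limSub {hF : UniformSMul F} {ψ : Growth.{u} J} (v : LimType hF ψ) :
    ‖v‖ = supNorm v := rfl

instance (hF : UniformSMul F) (ψ : Growth.{u} J) : CompleteSpace (LimType hF ψ) := by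
  refine NormedAddCommGroup.completeSpace_of_summable_imp_tendsto fun u hu => ?_
  have hle : ∀ n j, ‖(u n).1 j‖ ≤ ‖u n‖ * ψ.fn j := fun n j => le_supNorm (u n) j
  have hnorm : ∀ j, Summable fun n => ‖(u n).1 j‖ := fun j =>
    (hu.mul_right (ψ.fn j : ℝ)).of_nonneg_of_le (fun _ => norm_nonneg _) fun n => hle n j
  have hcoe : ∀ j, Summable fun n => (u n).1 j := fun j => (hnorm j).of_norm
  let rem : ℕ → ∀ j, F.obj j := fun N j => ∑' n, (u (n + N)).1 j
  have hrem : ∀ N j, ‖rem N j‖ ≤ (∑' n, ‖u (n + N)‖) * ψ.fn j := fun N j => by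
    have h1 : Summable fun n => ‖(u (n + N)).1 j‖ := (summable_nat_add_iff N).2 (hnorm j)
    have h2 : Summable fun n => ‖u (n + N)‖ * (ψ.fn j : ℝ) :=
      ((summable_nat_add_iff N).2 hu).mul_right _
    rw [← tsum_mul_right]
    exact (norm_tsum_le_tsum_norm h1).trans (h1.tsum_le_tsum (fun n => hle _ j) h2)
  have hmem : ∀ N, rem N ∈ limSub F hF ψ := fun N =>
    ⟨fun {j k} f => by
      have h1 : Summable fun n => (u (n + N)).1 j := (summable_nat_add_iff N).2 (hcoe j)
      refine ((h1.hasSum.map (F.map f).toLin (BanMod.continuous (F.map f))).tsum_eq.symm).trans ?_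
      exact tsum_congr fun n => (u (n + N)).2.1 f, _, hrem N⟩
  have hnn : ∀ N, 0 ≤ ∑' n, ‖u (n + N)‖ := fun N => tsum_nonneg fun _ => norm_nonneg _
  let lrem : ℕ → LimType hF ψ := fun N => ⟨rem N, hmem N⟩
  refine ⟨lrem 0, ?_⟩
  rw [tendsto_iff_norm_sub_tendsto_zero]
  refine squeeze_zero (fun _ => norm_nonneg _) (fun N => ?_) (tendsto_sum_nat_add fun n => ‖u n‖)
  have e : ∑ i ∈ Finset.range N, u i - lrem 0 = -lrem N := by
    rw [sub_eq_iff_eq_add, eq_neg_add_iff_add_eq, eq_comm]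
    refine Subtype.ext (funext fun j => ?_)
    have := (hcoe j).sum_add_tsum_nat_add N
    rw [add_comm] at this
    have hs : (∑ i ∈ Finset.range N, u i : LimType hF ψ).1 j = ∑ i ∈ Finset.range N, (u i).1 j :=
      map_sum ((LinearMap.proj j).comp (limSub F hF ψ).subtype) u _
    change rem 0 j = rem N j + (∑ i ∈ Finset.range N, u i : LimType hF ψ).1 j
    rw [hs]
    exact this.symm
  rw [e, norm_neg]
  exact supNorm_le (hnn N) (hrem N)

/-- The Banach module of the compatible families with growth `ψ`. -/
noncomputable abbrev limMod (hF : UniformSMul F) (ψ : Growth.{u} J) : BanMod R where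
  carrier := LimType hF ψ
  exists_norm_smul_le := by
    have hF' := hF
    obtain ⟨C, hC0, hC⟩ := hF'
    refine ⟨C, hC0, fun a v => supNorm_le (by positivity) fun j => ?_⟩
    refine (hC j a (v.1 j)).trans ?_
    rw [mul_assoc _ ‖v‖]
    exact mul_le_mul_of_nonneg_left (le_supNorm v j) (by positivity)

theorem limSub_mono {hF : UniformSMul F} {φ ψ : Growth.{u} J} (h : φ ≤ ψ) (v : LimType hF φ)
    (j : J) : ‖v.1 j‖ ≤ ‖v‖ * ψ.fn j :=
  (le_supNorm v j).trans (mul_le_mul_of_nonneg_left (h j) (norm_nonneg v))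

/-- The inclusion of the compatible families of smaller growth. -/
noncomputable def limIncl (hF : UniformSMul F) {φ ψ : Growth.{u} J} (h : φ ≤ ψ) :
    limMod hF φ ⟶ limMod hF ψ where
  toLin :=
    { toFun := fun v => (⟨v.1, v.2.1, ‖v‖, limSub_mono h v⟩ : LimType hF ψ)
      map_add' := fun _ _ => rfl
      map_smul' := fun _ _ => rfl }
  bounded := ⟨1, fun v => by
    rw [one_mul]
    exact supNorm_le (norm_nonneg v) (limSub_mono h v)⟩

/-- The evaluation of compatible families. -/
noncomputable def limEval (hF : UniformSMul F) (ψ : Growth.{u} J) (j : J) :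
    limMod hF ψ ⟶ F.obj j where
  toLin := (LinearMap.proj j).comp (limSub F hF ψ).subtype
  bounded := ⟨ψ.fn j, fun v => (le_supNorm v j).trans (mul_comm _ _).le⟩

theorem limEval_apply {hF : UniformSMul F} {ψ : Growth.{u} J} (j : J) (v : LimType hF ψ) :
    (limEval hF ψ j).toLin v = v.1 j := rfl

theorem limIncl_eval (hF : UniformSMul F) {φ ψ : Growth.{u} J} (h : φ ≤ ψ) (j : J) :
    limIncl hF h ≫ limEval hF ψ j = limEval hF φ j := rfl

theorem limEval_map (hF : UniformSMul F) (ψ : Growth.{u} J) {j k : J} (f : j ⟶ k) :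
    limEval hF ψ j ≫ F.map f = limEval hF ψ k :=
  hom_ext fun v => v.2.1 f

theorem limMod_ext {hF : UniformSMul F} {ψ : Growth.{u} J} {M : BanMod R}
    {f g : M ⟶ limMod hF ψ} (h : ∀ j, f ≫ limEval hF ψ j = g ≫ limEval hF ψ j) : f = g :=
  hom_ext fun x => Subtype.ext (funext fun j => congrArg (fun k => k.toLin x) (h j))

/-- A compatible family of bounded maps takes values in the families of a suitable growth. -/
theorem exists_limLift (hF : UniformSMul F) {M : BanMod R} (g : ∀ j, M ⟶ F.obj j)
    (hg : ∀ {j k : J} (f : j ⟶ k), g j ≫ F.map f = g k) :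
    ∃ (ψ : Growth.{u} J) (l : M ⟶ limMod hF ψ), ∀ j, l ≫ limEval hF ψ j = g j := by
  choose C hC0 hC using fun j => exists_bound_nonneg (g j)
  let ψ : Growth.{u} J := ⟨fun j => ⟨C j + 1, add_pos_of_nonneg_of_pos (hC0 j) one_pos⟩⟩
  have hb : ∀ (x : M) (j : J), ‖(g j).toLin x‖ ≤ ‖x‖ * ψ.fn j := fun x j =>
    (hC j x).trans ((mul_comm _ _).le.trans (mul_le_mul_of_nonneg_left
      (le_add_of_nonneg_right zero_le_one) (norm_nonneg x)))
  refine ⟨ψ, ⟨(LinearMap.pi fun j => (g j).toLin).codRestrict (limSub F hF ψ) fun x =>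
    ⟨fun f => congrArg (fun k => k.toLin x) (hg f), ‖x‖, hb x⟩, 1, fun x => ?_⟩, fun j => rfl⟩
  rw [one_mul]
  exact supNorm_le (norm_nonneg x) (hb x)

/-- The formal colimit of the Banach modules of compatible families of bounded growth. -/
noncomputable abbrev limSys (hF : UniformSMul F) : IndSystem (BanMod R) where
  Idx := Growth.{u} J
  sys :=
    { obj := limMod hF
      map := fun h => limIncl hF (leOfHom h)
      map_id := fun _ => rfl
      map_comp := fun _ _ => rfl }

noncomputable def limπ (hF : UniformSMul F) (j : J) :
    limSys hF ⟶ IndSystem.const.obj (F.obj j) :=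
  IndSystem.desc (fun ψ => IndSystem.const.map (limEval hF ψ j)) fun φ ψ a => by
    rw [← Functor.map_comp]
    exact congrArg IndSystem.const.map (limIncl_eval hF (leOfHom a) j)

theorem incl_limπ (hF : UniformSMul F) (ψ : Growth.{u} J) (j : J) :
    (limSys hF).incl ψ ≫ limπ hF j = IndSystem.const.map (limEval hF ψ j) :=
  IndSystem.incl_desc (X := limSys hF) _ _ ψ

theorem limπ_map (hF : UniformSMul F) {j k : J} (f : j ⟶ k) :
    limπ hF j ≫ IndSystem.const.map (F.map f) = limπ hF k :=
  IndSystem.hom_ext fun (ψ : Growth.{u} J) => by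
    rw [← Category.assoc, incl_limπ, ← Functor.map_comp, limEval_map, incl_limπ]

theorem limSys_ext {hF : UniformSMul F} {M : BanMod R}
    {x y : IndSystem.const.obj M ⟶ limSys hF} (h : ∀ j, x ≫ limπ hF j = y ≫ limπ hF j) :
    x = y := by
  obtain ⟨φ, a, rfl⟩ := IndSystem.exists_fac x
  obtain ⟨ψ, b, rfl⟩ := IndSystem.exists_fac y
  obtain ⟨χ, hφ, hψ⟩ := exists_ge_ge (α := Growth.{u} J) φ ψ
  have hφ' := (limSys hF).incl_w (i := φ) (j := χ) (homOfLE hφ)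
  have hψ' := (limSys hF).incl_w (i := ψ) (j := χ) (homOfLE hψ)
  rw [← hφ', ← hψ', ← Functor.map_comp_assoc, ← Functor.map_comp_assoc]
  congr 2
  refine limMod_ext fun j => IndSystem.const.map_injective ?_
  have hj := h j
  rw [Category.assoc, Category.assoc, incl_limπ, incl_limπ, ← Functor.map_comp,
    ← Functor.map_comp] at hj
  exact hj

/-- The canonical cone on `limSys`. -/
noncomputable def limCone (hF : UniformSMul F) : Cone (F ⋙ IndSystem.const) where
  pt := limSys hF
  π :=
    { app := limπ hF
      naturality := fun _ _ f => (Category.id_comp _).trans (limπ_map hF f).symm }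

theorem exists_lift (hF : UniformSMul F) (s : Cone (F ⋙ IndSystem.const)) :
    ∃ l : s.pt ⟶ limSys hF, ∀ j, l ≫ limπ hF j = s.π.app j := by
  have key : ∀ i : s.pt.Idx, ∃ l : IndSystem.const.obj (s.pt.sys.obj i) ⟶ limSys hF,
      ∀ j, l ≫ limπ hF j = s.pt.incl i ≫ s.π.app j := fun i => by
    obtain ⟨ψ, l, hl⟩ := exists_limLift hF
      (fun j => IndSystem.const.preimage (s.pt.incl i ≫ s.π.app j)) (fun {j k} f =>
        IndSystem.const.map_injective (by
          rw [Functor.map_comp, Functor.map_preimage, Functor.map_preimage, Category.assoc]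
          exact congrArg (s.pt.incl i ≫ ·) (s.w f)))
    refine ⟨IndSystem.const.map l ≫ (limSys hF).incl ψ, fun j => ?_⟩
    rw [Category.assoc, incl_limπ, ← Functor.map_comp, hl, Functor.map_preimage]
  choose l hl using key
  refine ⟨IndSystem.desc l fun i k a => limSys_ext fun j => ?_, fun j =>
    IndSystem.hom_ext fun i => ?_⟩
  · rw [Category.assoc, hl, hl, ← Category.assoc, IndSystem.incl_w]
  · rw [← Category.assoc, IndSystem.incl_desc, hl]

/-- The formal colimit `limSys` is the limit of the diagram in the category of ind-objects. -/
noncomputable def limIsLimit (hF : UniformSMul F) : IsLimit (limCone hF) where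
  lift s := (exists_lift hF s).choose
  fac s := (exists_lift hF s).choose_spec
  uniq s m hm := IndSystem.elt_ext fun c x => limSys_ext fun j => by
    have h1 : m ≫ limπ hF j = (exists_lift hF s).choose ≫ limπ hF j :=
      (hm j).trans ((exists_lift hF s).choose_spec j).symm
    exact (Category.assoc x m _).trans ((congrArg (x ≫ ·) h1).trans (Category.assoc _ _ _).symm)

theorem hasLimit_const (hF : UniformSMul F) : HasLimit (F ⋙ IndSystem.const) :=
  ⟨⟨⟨limCone hF, limIsLimit hF⟩⟩⟩

end Limit

end BanMod
/-! ### Limits of commutative algebra objects -/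

section CommMonLimit

variable {J : Type} [SmallCategory J] {D : Type u} [Category.{v} D] [MonoidalCategory D]
  [BraidedCategory D]

open MonObj in
theorem isCommMonObj_limit (G : J ⥤ CommMon D)
    (c : Cone ((G ⋙ CommMon.forget₂Mon D) ⋙ Mon.forget D)) (hc : IsLimit c) :
    IsCommMonObj (Mon.limit (G ⋙ CommMon.forget₂Mon D) c hc).X where
  mul_comm := hc.hom_ext fun j => by
    have h : (Mon.limit (G ⋙ CommMon.forget₂Mon D) c hc).mon.mul ≫ c.π.app j =
        (c.π.app j ⊗ₘ c.π.app j) ≫ (G.obj j).mon.mul := hc.fac _ j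
    have h2 : (β_ (G.obj j).X (G.obj j).X).hom ≫ (G.obj j).mon.mul = (G.obj j).mon.mul :=
      (G.obj j).comm.mul_comm
    refine (Category.assoc _ _ _).trans ((congrArg (_ ≫ ·) h).trans (Eq.trans ?_ h.symm))
    have h3 := BraidedCategory.braiding_naturality (c.π.app j) (c.π.app j)
    refine (Category.assoc _ _ _).symm.trans ((congrArg (· ≫ _) h3.symm).trans
      ((Category.assoc _ _ _).trans (congrArg (_ ≫ ·) h2)))

/-- Limits of commutative algebra objects are computed in the underlying category. -/
theorem hasLimit_commMon (G : J ⥤ CommMon D)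
    [HasLimit ((G ⋙ CommMon.forget₂Mon D) ⋙ Mon.forget D)] : HasLimit G := by
  let F := G ⋙ CommMon.forget₂Mon D
  have hc := limit.isLimit (F ⋙ Mon.forget D)
  have hcomm := isCommMonObj_limit G _ hc
  let L : CommMon D := { X := (Mon.limit F _ hc).X }
  let c : Cone G :=
    { pt := L
      π :=
        { app := fun j => CommMon.homMk (A := L) ((Mon.limitCone F _ hc).π.app j)
          naturality := fun j k f => InducedCategory.hom_ext
            ((Mon.limitCone F _ hc).π.naturality f) } }
  have hl : IsLimit ((CommMon.forget₂Mon D).mapCone c) :=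
    (Mon.limitConeIsLimit F _ hc).ofIsoLimit (Cone.ext (Iso.refl _) fun j =>
      (Category.id_comp _).symm)
  exact ⟨⟨⟨c, isLimitOfReflects (CommMon.forget₂Mon D) hl⟩⟩⟩

end CommMonLimit

/-! ### Functions on open polydiscs and on affine spaces -/

namespace Polydisc

section Functions

variable (R : Type u) [BanachCommRing R]

/-- The symmetric monoidal category `Ind(Ban_R)`. -/
abbrev IndBan : Type (u + 1) := IndSystem (BanMod R)

/-- The inverse system of the algebras `R{x/r}` in `Comm(Ind(Ban_R))`. -/
noncomputable def indDiagram {σ : Type} [Fintype σ] {P : Type} [Preorder P]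
    (r : P →o (σ → PosReal)) : Pᵒᵖ ⥤ CommMon (IndBan R) :=
  diagram R r ⋙ IndSystem.const.mapCommMon

instance {σ : Type} [Fintype σ] {P : Type} [Preorder P] (r : P →o (σ → PosReal)) :
    HasLimit (indDiagram R r) := by
  have hF : BanMod.UniformSMul (diagram R r ⋙ CommMon.forget (BanMod R)) := by
    obtain ⟨C, hC0, hC⟩ := BanachCommRing.exists_norm_mul_le (R := R)
    exact ⟨C, hC0, fun p => norm_smul_le hC (r := r p.unop)⟩
  have h := BanMod.hasLimit_const hF
  have : HasLimit ((indDiagram R r ⋙ CommMon.forget₂Mon (IndBan R)) ⋙ Mon.forget (IndBan R)) := h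
  exact hasLimit_commMon (indDiagram R r)

variable {σ : Type} [Fintype σ] {P : Type} [Preorder P]

/-- The limit of the algebras `R{x/r}` in `Comm(Ind(Ban_R))`. -/
noncomputable def limAlg (r : P →o (σ → PosReal)) : CommMon (IndBan R) := limit (indDiagram R r)

/-- The canonical projection of `limAlg` to `R{x/r}`. -/
noncomputable def proj (r : P →o (σ → PosReal)) (p : P) :
    (limAlg R r).X ⟶ IndSystem.const.obj (mod (R := R) (r p)) :=
  (limit.π (indDiagram R r) (op p)).hom.hom

/-- The polyradii `r` with `r i < τ i` for all `i`. -/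
abbrev Radii {n : ℕ} (τ : Fin n → ENNReal) : Type :=
  {r : Fin n → PosReal // ∀ i, ENNReal.ofReal (r i) < τ i}

/-- The family of the polyradii which are smaller than `τ`. -/
def discRadius {n : ℕ} (τ : Fin n → ENNReal) : Radii τ →o (Fin n → PosReal) :=
  ⟨Subtype.val, fun _ _ h => h⟩

/-- The algebra of functions on the open polydisc of polyradius `τ`: the limit of `R{x/r}` over
`r < τ`. -/
noncomputable def discAlg {n : ℕ} (τ : Fin n → ENNReal) : CommMon (IndBan R) :=
  limAlg R (discRadius τ)

/-- The restriction of functions on the open polydisc to the closed polydisc of polyradius `r`. -/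
noncomputable def discProj {n : ℕ} {τ : Fin n → ENNReal} (r : Radii τ) :
    (discAlg R τ).X ⟶ IndSystem.const.obj (mod (R := R) r.1) :=
  proj R (discRadius τ) r

/-- The family of the polyradii `(k, …, k)` for the positive integers `k`. -/
def affineRadius (n : ℕ) : ℕ+ →o (Fin n → PosReal) where
  toFun k := fun _ => ⟨(k : ℕ), Set.mem_Ioi.2 (Nat.cast_pos.2 k.pos)⟩
  monotone' := fun _ _ h _ => Subtype.coe_le_coe.1 (Nat.cast_le.2 h)

/-- The algebra of functions on the affine space: the limit of `R{x/k}` over the positive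
integers `k`. -/
noncomputable def affineAlg (n : ℕ) : CommMon (IndBan R) := limAlg R (affineRadius n)

/-- The restriction of functions on the affine space to the polydisc of polyradius
`(k, …, k)`. -/
noncomputable def affineProj (n : ℕ) (k : ℕ+) :
    (affineAlg R n).X ⟶ IndSystem.const.obj (mod (R := R) (affineRadius n k)) :=
  proj R (affineRadius n) k

variable {R}

/-- The concatenation of polyradii. -/
def Radii.append {n m : ℕ} {τ : Fin n → ENNReal} {ρ : Fin m → ENNReal} (r : Radii τ)
    (s : Radii ρ) : Radii (Fin.append τ ρ) :=
  ⟨Fin.append r.1 s.1, Fin.addCases (fun i => by simpa using r.2 i) fun j => by simpa using s.2 j⟩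

theorem affineRadius_append (n m : ℕ) (k : ℕ+) :
    affineRadius (n + m) k = Fin.append (affineRadius n k) (affineRadius m k) :=
  funext (Fin.addCases (fun i => by rw [Fin.append_left]; rfl)
    fun j => by rw [Fin.append_right]; rfl)

variable (R) in
/-- The canonical morphism `R{x/r} ⊗ R{y/s} ⟶ R{x/r, y/s}` in `Ind(Ban_R)`, which maps `f ⊗ g` to
`f(x) g(y)`. -/
noncomputable def indExt {n m : ℕ} (r : Fin n → PosReal) (s : Fin m → PosReal) :
    IndSystem.const.obj (mod (R := R) r) ⊗ IndSystem.const.obj (mod s) ⟶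
      IndSystem.const.obj (mod (Fin.append r s)) :=
  IndSystem.constMul _ _ ≫ IndSystem.const.map (extHom r s)

end Functions

end Polydisc

/-! A limit of Banach modules in Ind(Ban_R) is the formal colimit, over growth functions `φ` on the
index set, of the Banach modules of compatible families `v` with `‖v p‖ ≤ C * φ p`. For the algebras
R{x/r} over a nonempty directed set of polyradii, such a family is one power series whose norm on
the polydisc of index `p` is O(φ p). The tensor product of two limits is therefore the formal
colimit of the completed tensor products of such modules, and the expected limit is the formal
colimit of the modules of series in both sets of variables. The maps f ⊗ g ↦ f(x) g(y) induce a
morphism from the first to the second, and it is a morphism of algebras because the target is a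
limit of algebras (`exists_comparison`).

The content is that separation of variables, ∑ a_L x^J y^K ↦ ∑ a_L x^J ⊗ y^K with `L` = (J, K),
inverts this morphism once growth functions may be enlarged. Take a cofinal sequence `w` of indices
and numbers `W k` growing so fast that ∑_k r(w k)^J / W k converges for each of the countably many
J. Let `ψ` be a growth which at each `p` dominates some `W k` with `p ≤ w k`. In the module of
growth `ψ` the norm of x^J is then at most ‖1‖ ∑_k r(w k)^J / W k (`Adapted.norm_le`). By Tonelli,
∑_J ‖a_J‖ ‖x^J‖ is at most ‖1‖ times the sum over k of the norms of f at `w k` divided by `W k`, and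
this is finite if f has growth `φ` and ∑_k φ(w k) / W k converges. So every series of growth `φ` is
the absolutely convergent sum of its monomials in the module of growth `ψ` (`Adapted.hasSum`), a
form of nuclearity of the transition maps. The same estimate with two indices shows that separation
of variables is a bounded map (`exists_separation`).

Separation followed by multiplication is evaluation (`separation_evExt`). Multiplication followed by
separation is a transition map of the tensor system (`multiplication_separation`). The first gives
surjectivity and the second injectivity of the comparison on morphisms from constant systems, which
suffices (`isIso_of_bijective`). It is never needed that a completed tensor product embeds into
power series. -/

namespace Polydisc

/-! ### The external product f(x) g(y) as a morphism of algebras -/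

section Ext

variable {R : Type u} [BanachCommRing R] {n m : ℕ}

/-- A multi-index is the pair of its parts in the first and in the last variables. -/
noncomputable def idxEquiv (n m : ℕ) : (Fin (n + m) →₀ ℕ) ≃ (Fin n →₀ ℕ) × (Fin m →₀ ℕ) where
  toFun L := (fstIdx L, sndIdx L)
  invFun p := Finsupp.equivFunOnFinite.symm (Fin.append p.1 p.2)
  left_inv L := idx_injective (Prod.ext
    (Finsupp.ext fun i => by simp [fstIdx]) (Finsupp.ext fun j => by simp [sndIdx]))
  right_inv p := Prod.ext
    (Finsupp.ext fun i => by simp [fstIdx]) (Finsupp.ext fun j => by simp [sndIdx])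

theorem idxEquiv_apply (L : Fin (n + m) →₀ ℕ) : idxEquiv n m L = (fstIdx L, sndIdx L) := rfl

theorem idxEquiv_add (L K : Fin (n + m) →₀ ℕ) :
    idxEquiv n m (L + K) = idxEquiv n m L + idxEquiv n m K :=
  Prod.ext (Finsupp.ext fun i => by simp [idxEquiv_apply, fstIdx])
    (Finsupp.ext fun j => by simp [idxEquiv_apply, sndIdx])

theorem eq_zero_iff_idx {L : Fin (n + m) →₀ ℕ} : L = 0 ↔ fstIdx L = 0 ∧ sndIdx L = 0 := by
  have h0 : idxEquiv n m 0 = 0 :=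
    Prod.ext (Finsupp.ext fun _ => rfl) (Finsupp.ext fun _ => rfl)
  rw [← (idxEquiv n m).injective.eq_iff, h0, idxEquiv_apply, Prod.ext_iff]
  rfl

/-- Splitting a multi-index into its two parts is additive, so the antidiagonal of `L` is the
product of the antidiagonals of the parts, up to exchanging the two middle factors. The rest is
commutativity of `R`. -/
theorem extMul_mul (f f' : MvPowerSeries (Fin n) R) (g g' : MvPowerSeries (Fin m) R) :
    extMul (f * f') (g * g') = extMul f g * extMul f' g' := by
  classical
  refine MvPowerSeries.ext fun L => ?_
  rw [coeff_extMul, MvPowerSeries.coeff_mul, MvPowerSeries.coeff_mul, MvPowerSeries.coeff_mul,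
    Finset.sum_mul_sum, ← Finset.sum_product']
  refine (Finset.sum_equiv
    (((idxEquiv n m).prodCongr (idxEquiv n m)).trans (Equiv.prodProdProdComm _ _ _ _)) ?_ ?_).symm
  · intro p
    rw [Finset.mem_product, Finset.HasAntidiagonal.mem_antidiagonal, Finset.HasAntidiagonal.mem_antidiagonal,
      Finset.HasAntidiagonal.mem_antidiagonal, ← (idxEquiv n m).injective.eq_iff, idxEquiv_add, Prod.ext_iff]
    rfl
  · intro p _
    exact mul_mul_mul_comm _ _ _ _

theorem extMul_C (a b : R) :
    extMul (n := n) (m := m) (MvPowerSeries.C a) (MvPowerSeries.C b) =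
      MvPowerSeries.C (a * b) := by
  classical
  refine MvPowerSeries.ext fun L => ?_
  rw [coeff_extMul, MvPowerSeries.coeff_C, MvPowerSeries.coeff_C, MvPowerSeries.coeff_C]
  by_cases h1 : fstIdx L = 0 <;> by_cases h2 : sndIdx L = 0 <;>
    simp [eq_zero_iff_idx, h1, h2]

/-- The multiplication of a tensor product of algebras is `tensorμ` followed by both
multiplications. Unfolding `tensorμ` into associators and one braiding makes it explicit on pure
tensors. -/
theorem tensorμ_tmul {M N P Q : BanMod R} (x : M) (y : N) (z : P) (w : Q) :
    (tensorμ M N P Q).toLin (BanMod.tmul (M := BanMod.tensor M N) (N := BanMod.tensor P Q)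
        (BanMod.tmul x y) (BanMod.tmul z w)) =
      BanMod.tmul (M := BanMod.tensor M P) (N := BanMod.tensor N Q)
        (BanMod.tmul x z) (BanMod.tmul y w) := by
  change (BanMod.assocHom M N (BanMod.tensor P Q) ≫
    BanMod.tensorMap (𝟙 M) (BanMod.assocInv N P Q) ≫
    BanMod.tensorMap (𝟙 M) (BanMod.tensorMap (BanMod.braidHom N P) (𝟙 Q)) ≫
    BanMod.tensorMap (𝟙 M) (BanMod.assocHom P N Q) ≫
    BanMod.assocInv M P (BanMod.tensor N Q)).toLin _ = _
  simp

/-- Fixing one argument leaves a bounded map on a completed tensor product of two modules, so the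
density of pure tensors can be applied to one factor at a time. -/
theorem tensor_ext_pairs {M N P Q S : BanMod R}
    {f g : BanMod.tensor (BanMod.tensor M N) (BanMod.tensor P Q) ⟶ S}
    (h : ∀ x y z w, f.toLin (BanMod.tmul (BanMod.tmul x y) (BanMod.tmul z w)) =
      g.toLin (BanMod.tmul (BanMod.tmul x y) (BanMod.tmul z w))) : f = g :=
  BanMod.tensor_ext fun t z => by
    have : BanMod.tmulRight (BanMod.tensor M N) z ≫ f =
        BanMod.tmulRight (BanMod.tensor M N) z ≫ g :=
      BanMod.tensor_ext fun x y => by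
        have h2 : BanMod.tmulLeft (BanMod.tensor P Q) (BanMod.tmul x y) ≫ f =
            BanMod.tmulLeft (BanMod.tensor P Q) (BanMod.tmul x y) ≫ g :=
          BanMod.tensor_ext fun z w => h x y z w
        exact congrArg (fun k => k.toLin z) h2
    exact congrArg (fun k => k.toLin t) this

/-- The inverse unitor of the unit module is `a ↦ 1 ⊗ a`, so the left side is the unit of the tensor
product algebra followed by `extHom`. -/
theorem one_extHom (r : Fin n → PosReal) (s : Fin m → PosReal) :
    BanMod.tmulLeft (BanMod.unit R) (M := BanMod.unit R) (1 : R) ≫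
      BanMod.tensorMap (oneHom r) (oneHom s) ≫ extHom r s = oneHom (Fin.append r s) :=
  BanMod.hom_ext fun a => by
    rw [BanMod.comp_apply, BanMod.comp_apply, BanMod.tmulLeft_apply, BanMod.tensorMap_tmul]
    refine (extHom_tmul _ _).trans (Subtype.ext ?_)
    exact (extMul_C (1 : R) a).trans (congrArg _ (one_mul a))

theorem mul_extHom (r : Fin n → PosReal) (s : Fin m → PosReal) :
    (tensorμ (mod (R := R) r) (mod s) (mod r) (mod s) ≫
      BanMod.tensorMap (mulHom r) (mulHom s)) ≫ extHom r s =
      BanMod.tensorMap (extHom r s) (extHom r s) ≫ mulHom (Fin.append r s) :=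
  tensor_ext_pairs fun f g f' g' => by
    rw [BanMod.comp_apply, BanMod.comp_apply, BanMod.comp_apply, tensorμ_tmul,
      BanMod.tensorMap_tmul, BanMod.tensorMap_tmul, mulHom_tmul, mulHom_tmul]
    refine (extHom_tmul _ _).trans ?_
    rw [extHom_tmul f g, extHom_tmul f' g', mulHom_tmul]
    exact Subtype.ext (extMul_mul f.1 f'.1 g.1 g'.1)

instance (r : Fin n → PosReal) (s : Fin m → PosReal) : IsMonHom (extHom (R := R) r s) where
  one_hom := (Category.assoc _ _ _).trans (one_extHom r s)
  mul_hom := mul_extHom r s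

end Ext

end Polydisc

/-! ### Detecting isomorphisms of ind-objects; an explicit model for limits of algebras -/

namespace IndSystem

/-- A morphism of systems which is bijective on generalized elements is an isomorphism. -/
theorem isIso_of_bijective {C : Type u} [Category.{v} C] {X Y : IndSystem C} (f : X ⟶ Y)
    (h : ∀ c : C, Function.Bijective fun x : const.obj c ⟶ X => x ≫ f) : IsIso f := by
  -- Lifts through `f` of the inclusions of the members of `Y` are the components of the inverse;
  -- injectivity makes these lifts compatible.
  choose x hx using fun i => (h _).2 (Y.incl i)
  have hw : ∀ (i j : Y.Idx) (a : i ⟶ j), const.map (Y.sys.map a) ≫ x j = x i := fun i j a =>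
    (h _).1 (by
      have hi := hx i
      have hj := hx j
      dsimp only at hi hj ⊢
      rw [Category.assoc, hi, hj, incl_w])
  have hinv : desc x hw ≫ f = 𝟙 Y := hom_ext fun i => by
    rw [← Category.assoc, incl_desc, Category.comp_id]
    exact hx i
  -- The morphism built so far is a section of `f`. It is also a retraction, because `f` can be
  -- cancelled on generalized elements.
  refine ⟨desc x hw, elt_ext fun c y => (h c).1 ?_, hinv⟩
  simp only [Category.assoc, hinv, Category.comp_id]

end IndSystem

section CommMonLimit

variable {J : Type} [SmallCategory J] {D : Type u} [Category.{v} D] [MonoidalCategory D]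
  [BraidedCategory D]

/-- The limit of commutative algebra objects is the limit in the underlying category. -/
theorem exists_limit_toMon_iso (G : J ⥤ CommMon D) [HasLimit G]
    (c : Cone ((G ⋙ CommMon.forget₂Mon D) ⋙ Mon.forget D)) (hc : IsLimit c) :
    ∃ e : (limit G).toMon ≅ Mon.limit (G ⋙ CommMon.forget₂Mon D) c hc,
      ∀ j, e.hom.hom ≫ c.π.app j = (limit.π G j).hom.hom := by
  let F := G ⋙ CommMon.forget₂Mon D
  have hcomm := isCommMonObj_limit G c hc
  let L : CommMon D := { X := (Mon.limit F c hc).X }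
  let d : Cone G :=
    { pt := L
      π :=
        { app := fun j => CommMon.homMk (A := L) ((Mon.limitCone F c hc).π.app j)
          naturality := fun j k f => InducedCategory.hom_ext
            ((Mon.limitCone F c hc).π.naturality f) } }
  -- The forgetful functor to `Mon D` is fully faithful, hence reflects limits; the image of `d` is
  -- the limit cone of `Mon D` with the same vertex.
  have hl : IsLimit ((CommMon.forget₂Mon D).mapCone d) :=
    (Mon.limitConeIsLimit F c hc).ofIsoLimit (Cone.ext (Iso.refl _) fun j =>
      (Category.id_comp _).symm)
  have hd : IsLimit d := isLimitOfReflects (CommMon.forget₂Mon D) hl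
  refine ⟨(CommMon.forget₂Mon D).mapIso ((limit.isLimit G).conePointUniqueUpToIso hd), fun j => ?_⟩
  exact congrArg (fun k => k.hom.hom)
    ((limit.isLimit G).conePointUniqueUpToIso_hom_comp hd j)

end CommMonLimit

/-! ### The comparison morphism of algebras -/

namespace Polydisc

section

variable (R : Type u) [BanachCommRing R]

/-- The multiplication constant of `R` serves for all polyradii at once. A common constant is what
makes the families of a given growth a Banach module. -/
theorem uniformSMul_diagram {σ : Type} [Fintype σ] {P : Type} [Preorder P]
    (r : P →o (σ → PosReal)) :
    BanMod.UniformSMul (diagram R r ⋙ CommMon.forget (BanMod R)) := by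
  obtain ⟨C, hC0, hC⟩ := BanachCommRing.exists_norm_mul_le (R := R)
  exact ⟨C, hC0, fun p => norm_smul_le hC (r := r p.unop)⟩

/-- The limit of the algebras `R{x/r}`, as the formal colimit of the Banach modules of series of
bounded growth. -/
noncomputable abbrev growthSys {σ : Type} [Fintype σ] {P : Type} [Preorder P]
    (r : P →o (σ → PosReal)) : IndBan R :=
  BanMod.limSys (uniformSMul_diagram R r)

/-- The projection of `growthSys` to `R{x/r}`. -/
noncomputable def growthπ {σ : Type} [Fintype σ] {P : Type} [Preorder P]
    (r : P →o (σ → PosReal)) (p : P) :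
    growthSys R r ⟶ IndSystem.const.obj (mod (R := R) (r p)) :=
  BanMod.limπ (uniformSMul_diagram R r) (op p)

theorem growthπ_res {σ : Type} [Fintype σ] {P : Type} [Preorder P]
    (r : P →o (σ → PosReal)) {p q : P} (h : p ≤ q) :
    growthπ R r q ≫ IndSystem.const.map (res (r.monotone h)) = growthπ R r p :=
  BanMod.limπ_map (uniformSMul_diagram R r) (homOfLE h).op

/-- The algebra structure of `growthSys`. -/
noncomputable def growthMon {σ : Type} [Fintype σ] {P : Type} [Preorder P]
    (r : P →o (σ → PosReal)) : Mon (IndBan R) :=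
  Mon.limit (indDiagram R r ⋙ CommMon.forget₂Mon (IndBan R))
    (BanMod.limCone (uniformSMul_diagram R r)) (BanMod.limIsLimit (uniformSMul_diagram R r))

/-- This replaces the abstractly chosen limit by the model with underlying ind-object `growthSys`,
where norms can be estimated. -/
theorem exists_limAlg_iso {σ : Type} [Fintype σ] {P : Type} [Preorder P]
    (r : P →o (σ → PosReal)) :
    ∃ e : (limAlg R r).toMon ≅ growthMon R r,
      ∀ p, e.hom.hom ≫ growthπ R r p = proj R r p := by
  obtain ⟨e, he⟩ := exists_limit_toMon_iso (indDiagram R r)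
    (BanMod.limCone (uniformSMul_diagram R r)) (BanMod.limIsLimit (uniformSMul_diagram R r))
  exact ⟨e, fun p => he (op p)⟩

/-- The limit cone with vertex `growthMon`. -/
noncomputable def growthMonCone {σ : Type} [Fintype σ] {P : Type} [Preorder P]
    (r : P →o (σ → PosReal)) : Cone (indDiagram R r ⋙ CommMon.forget₂Mon (IndBan R)) :=
  Mon.limitCone (indDiagram R r ⋙ CommMon.forget₂Mon (IndBan R))
    (BanMod.limCone (uniformSMul_diagram R r)) (BanMod.limIsLimit (uniformSMul_diagram R r))

/-- The algebra `growthMon` is the limit of the algebras `R{x/r}`. -/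
noncomputable def growthMonIsLimit {σ : Type} [Fintype σ] {P : Type} [Preorder P]
    (r : P →o (σ → PosReal)) : IsLimit (growthMonCone R r) :=
  Mon.limitConeIsLimit (indDiagram R r ⋙ CommMon.forget₂Mon (IndBan R))
    (BanMod.limCone (uniformSMul_diagram R r)) (BanMod.limIsLimit (uniformSMul_diagram R r))

/-- The projection of `growthMon` to `R{x/r}`. -/
noncomputable def growthMonπ {σ : Type} [Fintype σ] {P : Type} [Preorder P]
    (r : P →o (σ → PosReal)) (p : P) :
    growthMon R r ⟶ (IndSystem.const (C := BanMod R)).mapMon.obj (disk R (r p)).toMon :=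
  (growthMonCone R r).π.app (op p)

theorem hom_growthSys_ext {σ : Type} [Fintype σ] {P : Type} [Preorder P]
    (r : P →o (σ → PosReal)) {X : IndBan R} {f g : X ⟶ growthSys R r}
    (h : ∀ p, f ≫ growthπ R r p = g ≫ growthπ R r p) : f = g :=
  (BanMod.limIsLimit (uniformSMul_diagram R r)).hom_ext fun p => h p.unop

variable {R} {n m : ℕ}

/-- The canonical map `R{x/r} ⊗ R{y/s} ⟶ R{x/r, y/s}` as a morphism of algebras. -/
noncomputable def extMon (r : Fin n → PosReal) (s : Fin m → PosReal) :
    (disk R r).toMon ⊗ (disk R s).toMon ⟶ (disk R (Fin.append r s)).toMon :=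
  Mon.Hom.mk (M := (disk R r).toMon ⊗ (disk R s).toMon) (N := (disk R (Fin.append r s)).toMon)
    (extHom r s) (isMonHom_hom := inferInstanceAs (IsMonHom (extHom (R := R) r s)))

/-- Restriction does not change coefficients, so both sides send f ⊗ g to f(x) g(y). The extra
polyradius `t` is a common target for comparing two choices of `(r, s)`. -/
theorem res_extHom {r r' : Fin n → PosReal} {s s' : Fin m → PosReal} (hr : r ≤ r') (hs : s ≤ s')
    {t : Fin (n + m) → PosReal} (h : t ≤ Fin.append r s) (h' : t ≤ Fin.append r' s') :
    (res (R := R) hr ⊗ₘ res hs) ≫ extHom r s ≫ res h = extHom r' s' ≫ res h' :=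
  BanMod.tensor_ext fun f g => by
    change ((BanMod.tensorMap (res hr) (res hs)) ≫ extHom r s ≫ res h).toLin _ = _
    rw [BanMod.comp_apply, BanMod.comp_apply, BanMod.comp_apply, BanMod.tensorMap_tmul]
    have e1 := extHom_tmul (R := R) (r := r) (s := s) ((res hr).toLin f) ((res hs).toLin g)
    have e2 := extHom_tmul (R := R) (r := r') (s := s') f g
    refine (congrArg (res h).toLin e1).trans (Eq.trans ?_ (congrArg (res h').toLin e2).symm)
    refine Subtype.ext ((coe_res h _).trans (Eq.trans ?_ (coe_res h' _).symm))
    exact congrArg₂ extMul (coe_res hr f) (coe_res hs g)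

variable {P Q S : Type} [Preorder P] [Preorder Q] [Preorder S]
  (r : P →o (Fin n → PosReal)) (s : Q →o (Fin m → PosReal)) (t : S →o (Fin (n + m) → PosReal))

variable (R) in
/-- The component at `t c` of the comparison morphism. -/
noncomputable def leg {p : P} {q : Q} {c : S} (h : t c ≤ Fin.append (r p) (s q)) :
    growthSys R r ⊗ growthSys R s ⟶ IndSystem.const.obj (mod (R := R) (t c)) :=
  (growthπ R r p ⊗ₘ growthπ R s q) ≫ indExt R (r p) (s q) ≫ IndSystem.const.map (res h)

/-- The projections at `p`, `q` factor through those at `p'`, `q'`. Naturality of `constMul` moves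
the restrictions inside the embedding of constant systems, where `res_extHom` applies. -/
theorem leg_eq_of_le {p p' : P} {q q' : Q} (hp : p ≤ p') (hq : q ≤ q') {c : S}
    (h : t c ≤ Fin.append (r p) (s q)) (h' : t c ≤ Fin.append (r p') (s q')) :
    leg R r s t h = leg R r s t h' := by
  rw [leg, leg, ← growthπ_res R r hp, ← growthπ_res R s hq,
    ← MonoidalCategory.tensorHom_comp_tensorHom, Category.assoc]
  have hnat : (IndSystem.const.map (res (R := R) (r.monotone hp)) ⊗ₘ
      IndSystem.const.map (res (R := R) (s.monotone hq))) ≫ IndSystem.constMul _ _ =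
      IndSystem.constMul _ _ ≫ IndSystem.const.map
        (res (R := R) (r.monotone hp) ⊗ₘ res (R := R) (s.monotone hq)) :=
    Functor.LaxMonoidal.μ_natural IndSystem.const _ _
  rw [indExt, indExt, Category.assoc, Category.assoc, ← Category.assoc _ (IndSystem.constMul _ _),
    hnat, Category.assoc, ← Functor.map_comp, ← Functor.map_comp, ← Functor.map_comp,
    res_extHom (r.monotone hp) (s.monotone hq) h h']

/-- Both choices are compared with a common upper bound. The component at `c` is thus well defined,
and no coherent choice of `p` and `q` is required. -/
theorem leg_eq [IsDirectedOrder P] [IsDirectedOrder Q] {p p' : P} {q q' : Q} {c : S}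
    (h : t c ≤ Fin.append (r p) (s q)) (h' : t c ≤ Fin.append (r p') (s q')) :
    leg R r s t h = leg R r s t h' := by
  obtain ⟨p'', h1, h2⟩ := exists_ge_ge p p'
  obtain ⟨q'', h3, h4⟩ := exists_ge_ge q q'
  have h'' : t c ≤ Fin.append (r p'') (s q'') := fun i => by
    refine (h i).trans ?_
    refine Fin.addCases (fun i => ?_) (fun j => ?_) i
    · rw [Fin.append_left, Fin.append_left]
      exact r.monotone h1 i
    · rw [Fin.append_right, Fin.append_right]
      exact s.monotone h3 j
  rw [leg_eq_of_le r s t h1 h3 h h'', leg_eq_of_le r s t h2 h4 h' h'']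

theorem leg_res {p : P} {q : Q} {c c' : S} (hc : c ≤ c')
    (h : t c' ≤ Fin.append (r p) (s q)) :
    leg R r s t h ≫ IndSystem.const.map (res (t.monotone hc)) =
      leg R r s t ((t.monotone hc).trans h) := by
  rw [leg, leg, Category.assoc, Category.assoc, ← Functor.map_comp, res_trans]

variable (R) in
/-- The component at `t c` of the comparison morphism as a morphism of algebras. -/
noncomputable def legMon {p : P} {q : Q} {c : S} (h : t c ≤ Fin.append (r p) (s q)) :
    growthMon R r ⊗ growthMon R s ⟶
      (indDiagram R t ⋙ CommMon.forget₂Mon (IndBan R)).obj (op c) :=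
  (growthMonπ R r p ⊗ₘ growthMonπ R s q) ≫
    Functor.LaxMonoidal.μ (IndSystem.const (C := BanMod R)).mapMon _ _ ≫
      (IndSystem.const (C := BanMod R)).mapMon.map (extMon (r p) (s q)) ≫
        (IndSystem.const (C := BanMod R)).mapMon.map (resMon h).hom

/-- The tensor comparison of `mapMon` has `constMul` as its underlying morphism, so the two sides
agree by definition after reassociation. -/
theorem legMon_hom {p : P} {q : Q} {c : S} (h : t c ≤ Fin.append (r p) (s q)) :
    (legMon R r s t h).hom = leg R r s t h := by
  rw [leg, indExt, Category.assoc]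
  rfl

/-- The comparison morphism of algebras. -/
theorem exists_comparison [IsDirectedOrder P] [IsDirectedOrder Q]
    (hST : ∀ c, ∃ p q, t c ≤ Fin.append (r p) (s q)) :
    ∃ h : growthMon R r ⊗ growthMon R s ⟶ growthMon R t,
      ∀ (p : P) (q : Q) (c : S) (hc : t c ≤ Fin.append (r p) (s q)),
        h.hom ≫ growthπ R t c = leg R r s t hc := by
  -- These choices need not be monotone in `c`: naturality of the cone follows from `leg_res`
  -- together with `leg_eq`.
  choose p q hpq using hST
  let d : Cone (indDiagram R t ⋙ CommMon.forget₂Mon (IndBan R)) :=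
    { pt := growthMon R r ⊗ growthMon R s
      π :=
        { app := fun c => legMon R r s t (hpq c.unop)
          naturality := fun c c' f => Mon.Hom.ext <| by
            have h1 := leg_res (R := R) r s t (leOfHom f.unop) (hpq c.unop)
            have h2 := leg_eq (R := R) r s t ((t.monotone (leOfHom f.unop)).trans (hpq c.unop))
              (hpq c'.unop)
            exact (Category.id_comp _).trans ((legMon_hom r s t _).trans
              ((h1.trans h2).symm.trans (congrArg (· ≫ _) (legMon_hom r s t _).symm))) } }
  have hl := growthMonIsLimit R t
  exact ⟨hl.lift d, fun p' q' c hc => (congrArg Mon.Hom.hom (hl.fac d (op c))).trans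
    ((legMon_hom r s t _).trans (leg_eq r s t _ _))⟩

end

end Polydisc

/-! ### Summation -/

/-- Tonelli for nonnegative terms. In the applications `i` is a multi-index and `k` a position, or a
pair of positions, in cofinal sequences; norm bounds on each polydisc become bounds on sums over
monomials. -/
theorem Summable.tsum_of_nonneg {ι κ : Type*} {g : ι → κ → ℝ} {b : κ → ℝ}
    (h0 : ∀ i k, 0 ≤ g i k) (hg : ∀ k, Summable fun i => g i k) (hb : ∀ k, ∑' i, g i k ≤ b k)
    (hs : Summable b) :
    (∀ i, Summable (g i)) ∧ Summable (fun i => ∑' k, g i k) ∧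
      ∑' i, ∑' k, g i k ≤ ∑' k, b k := by
  have hsum : Summable fun k => ∑' i, g i k :=
    hs.of_nonneg_of_le (fun k => tsum_nonneg fun i => h0 i k) hb
  have hprod : Summable fun x : κ × ι => g x.2 x.1 :=
    (summable_prod_of_nonneg fun x => h0 x.2 x.1).2 ⟨hg, hsum⟩
  have hprod' : Summable fun x : ι × κ => g x.1 x.2 := hprod.prod_symm
  refine ⟨fun i => hprod'.prod_factor i, hprod'.prod, ?_⟩
  rw [Summable.tsum_comm (f := fun k i => g i k) hprod]
  exact hsum.tsum_le_tsum hb hs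

/-- A sequence which grows faster than countably many given sequences. -/
theorem exists_summable_div {ι : Type*} [Countable ι] [Nonempty ι] (h : ι → ℕ → ℝ) :
    ∃ W : ℕ → ℝ, (∀ k, 0 < W k) ∧ ∀ i, Summable fun k => h i k / W k := by
  obtain ⟨f, hf⟩ := exists_surjective_nat ι
  have hpos : ∀ k, 0 < 1 + ∑ j ∈ Finset.range (k + 1), |h (f j) k| := fun k =>
    add_pos_of_pos_of_nonneg one_pos (Finset.sum_nonneg fun _ _ => abs_nonneg _)
  -- A diagonal choice: at `k` the bracket dominates the first `k + 1` sequences, so the quotient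
  -- for the sequence `f j` is at most `(1 / 2) ^ k` as soon as `k ≥ j`. The summand `1` keeps `W`
  -- positive.
  refine ⟨fun k => 2 ^ k * (1 + ∑ j ∈ Finset.range (k + 1), |h (f j) k|),
    fun k => mul_pos (by positivity) (hpos k), fun i => ?_⟩
  obtain ⟨j, rfl⟩ := hf i
  refine Summable.of_norm_bounded_eventually_nat summable_geometric_two ?_
  filter_upwards [Filter.eventually_ge_atTop j] with k hk
  have h1 : |h (f j) k| ≤ ∑ j ∈ Finset.range (k + 1), |h (f j) k| :=
    Finset.single_le_sum (f := fun j => |h (f j) k|) (fun _ _ => abs_nonneg _)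
      (Finset.mem_range.2 (Nat.lt_succ_of_le hk))
  rw [norm_div, Real.norm_eq_abs, Real.norm_of_nonneg (mul_pos (by positivity) (hpos k)).le,
    div_le_iff₀ (mul_pos (by positivity) (hpos k)), ← mul_assoc, ← mul_pow]
  norm_num
  linarith

/-! ### Absolutely convergent series in Banach modules -/

namespace BanMod

variable {R : Type u} [BanachCommRing R]

instance (M : BanMod R) : ContinuousConstSMul R M where
  continuous_const_smul a := by
    obtain ⟨C, -, hC⟩ := M.exists_norm_smul_le
    exact AddMonoidHomClass.continuous_of_bound (DistribSMul.toAddMonoidHom M a) (C * ‖a‖) (hC a)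

theorem hasSum_map {M N : BanMod R} (f : M ⟶ N) {ι : Type*} {g : ι → M} {x : M}
    (h : HasSum g x) : HasSum (fun i => f.toLin (g i)) (f.toLin x) :=
  h.map f.toLin (BanMod.continuous f)

theorem summable_smul {N : BanMod R} {ι : Type*} {e : ι → N} {a : ι → R}
    (h : Summable fun i => ‖a i‖ * ‖e i‖) : Summable fun i => a i • e i := by
  obtain ⟨C, -, hC⟩ := N.exists_norm_smul_le
  exact (h.mul_left C).of_norm_bounded fun i => (hC _ _).trans (mul_assoc _ _ _).le

/-- The bounded map which is given by an absolutely convergent series. -/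
theorem exists_hom_hasSum {M N : BanMod R} {ι : Type*} (a : ι → M →ₗ[R] R) (e : ι → N) {K : ℝ}
    (hs : ∀ x, Summable fun i => ‖a i x‖ * ‖e i‖)
    (hK : ∀ x, ∑' i, ‖a i x‖ * ‖e i‖ ≤ K * ‖x‖) :
    ∃ T : M ⟶ N, ∀ x, HasSum (fun i => a i x • e i) (T.toLin x) := by
  have h : ∀ x, Summable fun i => a i x • e i := fun x => summable_smul (hs x)
  obtain ⟨C, hC0, hC⟩ := N.exists_norm_smul_le
  -- The scalar action on `N` is bounded only up to the constant `C`, whence the bound `C * K`.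
  refine ⟨⟨⟨⟨fun x => ∑' i, a i x • e i, fun x y => ?_⟩, fun b x => ?_⟩, C * K, fun x => ?_⟩,
    fun x => (h x).hasSum⟩
  · simp only [map_add, add_smul]
    exact (h x).tsum_add (h y)
  · simp only [map_smul, smul_eq_mul, mul_smul]
    exact (h x).tsum_const_smul b
  · have h1 : ∀ i, ‖a i x • e i‖ ≤ C * (‖a i x‖ * ‖e i‖) := fun i =>
      (hC _ _).trans (mul_assoc _ _ _).le
    refine (tsum_of_norm_bounded ((hs x).mul_left C).hasSum h1).trans ?_
    rw [tsum_mul_left, mul_assoc]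
    exact mul_le_mul_of_nonneg_left (hK x) hC0.le

end BanMod

namespace Polydisc

variable {R : Type u} [BanachCommRing R]

/-! ### Monomials and coefficients in R{x/r} -/

section Monomials

variable {σ : Type} [Fintype σ]

/-- The norm of `1` in `R` need not be 1, so the factor `‖1‖` persists in all later estimates. -/
theorem hasSum_term_monomial (r : σ → PosReal) (J : σ →₀ ℕ) :
    HasSum (term R r (MvPowerSeries.monomial J 1)) (‖(1 : R)‖ * weight r J) := by
  classical
  have h : term R r (MvPowerSeries.monomial J 1) J = ‖(1 : R)‖ * weight r J := by
    rw [term, MvPowerSeries.coeff_monomial_same]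
  rw [← h]
  refine hasSum_single J fun K hK => ?_
  rw [term, MvPowerSeries.coeff_monomial_ne hK, norm_zero, zero_mul]

variable (R) in
/-- The monomial `x ^ J` in `R{x/r}`. -/
noncomputable def mono (r : σ → PosReal) (J : σ →₀ ℕ) : alg R r :=
  ⟨MvPowerSeries.monomial J 1, (hasSum_term_monomial r J).summable⟩

theorem coe_mono (r : σ → PosReal) (J : σ →₀ ℕ) :
    (mono R r J).1 = MvPowerSeries.monomial J 1 := rfl

theorem norm_mono (r : σ → PosReal) (J : σ →₀ ℕ) : ‖mono R r J‖ = ‖(1 : R)‖ * weight r J :=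
  (hasSum_term_monomial r J).tsum_eq

/-- The coefficient of `x ^ J`. -/
noncomputable def coeffHom (r : σ → PosReal) (J : σ →₀ ℕ) : mod (R := R) r ⟶ BanMod.unit R where
  toLin := (MvPowerSeries.coeff J).comp (alg R r).val.toLinearMap
  bounded := ⟨(weight r J)⁻¹, fun f => by
    rw [inv_mul_eq_div, le_div_iff₀ (weight_pos r J)]
    exact norm_coeff_mul_le f J⟩

/-- A power series is determined by its expansion. -/
theorem coe_eq_of_hasSum {r : σ → PosReal} {a : MvPowerSeries σ R} {f : alg R r}
    (h : HasSum (fun J => MvPowerSeries.coeff J a • mono R r J) f) : f.1 = a := by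
  classical
  refine MvPowerSeries.ext fun K => ?_
  -- A coefficient is a bounded functional, so it may be applied termwise, and only the monomial of
  -- index `K` contributes.
  have h1 : HasSum (fun J => (coeffHom r K).toLin (MvPowerSeries.coeff J a • mono R r J))
      ((coeffHom r K).toLin f) := BanMod.hasSum_map (M := mod (R := R) r) (coeffHom r K) h
  have h2 : ∀ J, (coeffHom r K).toLin (MvPowerSeries.coeff J a • mono R r J) =
      MvPowerSeries.coeff J a * MvPowerSeries.coeff K (MvPowerSeries.monomial J (1 : R)) :=
    fun J => (map_smul (coeffHom r K).toLin _ _).trans rfl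
  have h3 := hasSum_single (f := fun J => (coeffHom r K).toLin
    (MvPowerSeries.coeff J a • mono R r J)) K fun J hJ => by
      rw [h2, MvPowerSeries.coeff_monomial_ne hJ.symm, mul_zero]
  rw [h2, MvPowerSeries.coeff_monomial_same, mul_one] at h3
  exact h1.unique h3

end Monomials

/-! ### Families of prescribed growth and their monomial expansions -/

section Growth

variable {σ : Type} [Fintype σ] {P : Type} [Preorder P] (r : P →o (σ → PosReal))

variable (R) in
/-- The Banach module of the compatible families of series with growth `φ`. -/
noncomputable abbrev growthMod (φ : Growth.{u} Pᵒᵖ) : BanMod R :=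
  BanMod.limMod (uniformSMul_diagram R r) φ

variable (R) in
/-- The evaluation of a compatible family. -/
noncomputable def growthEv (φ : Growth.{u} Pᵒᵖ) (p : P) : growthMod R r φ ⟶ mod (R := R) (r p) :=
  BanMod.limEval (uniformSMul_diagram R r) φ (op p)

variable (R) in
/-- The inclusion of the families of smaller growth. -/
noncomputable def growthIncl {φ ψ : Growth.{u} Pᵒᵖ} (h : φ ≤ ψ) :
    growthMod R r φ ⟶ growthMod R r ψ :=
  BanMod.limIncl (uniformSMul_diagram R r) h

theorem growthEv_res (φ : Growth.{u} Pᵒᵖ) {p q : P} (h : p ≤ q) :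
    growthEv R r φ q ≫ res (r.monotone h) = growthEv R r φ p :=
  BanMod.limEval_map (uniformSMul_diagram R r) φ (homOfLE h).op

theorem norm_growthEv_le {φ : Growth.{u} Pᵒᵖ} (v : growthMod R r φ) (p : P) :
    ‖((growthEv R r φ p).toLin v : alg R (r p))‖ ≤ ‖v‖ * φ.fn (op p) :=
  BanMod.le_supNorm v (op p)

variable (R) in
theorem mem_limSub {φ : Growth.{u} Pᵒᵖ} (v : ∀ p, alg R (r p))
    (hv : ∀ {p q : P} (_ : p ≤ q), (v q).1 = (v p).1) {C : ℝ}
    (hC : ∀ p, ‖v p‖ ≤ C * φ.fn (op p)) :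
    (fun p : Pᵒᵖ => v p.unop) ∈ BanMod.limSub (diagram R r ⋙ CommMon.forget (BanMod R))
      (uniformSMul_diagram R r) φ := by
  refine ⟨fun {p q} f => ?_, C, fun p => hC p.unop⟩
  have h1 : ((res (R := R) (r.monotone (leOfHom f.unop))).toLin (v p.unop) : alg R (r q.unop)) =
      v q.unop := Subtype.ext ((coe_res _ _).trans (hv (leOfHom f.unop)))
  exact h1

variable (R) in
/-- The element of `growthMod` which is given by a compatible family. -/
noncomputable def mkGrowth {φ : Growth.{u} Pᵒᵖ} (v : ∀ p, alg R (r p))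
    (hv : ∀ {p q : P} (_ : p ≤ q), (v q).1 = (v p).1) {C : ℝ}
    (hC : ∀ p, ‖v p‖ ≤ C * φ.fn (op p)) : growthMod R r φ :=
  (⟨fun p => v p.unop, mem_limSub R r v hv hC⟩ :
    BanMod.LimType (uniformSMul_diagram R r) φ)

theorem norm_growthMod_le {φ : Growth.{u} Pᵒᵖ} {v : growthMod R r φ} {C : ℝ} (hC0 : 0 ≤ C)
    (hC : ∀ p, ‖((growthEv R r φ p).toLin v : alg R (r p))‖ ≤ C * φ.fn (op p)) : ‖v‖ ≤ C :=
  BanMod.supNorm_le hC0 fun p => hC p.unop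

theorem growthMod_ext {φ : Growth.{u} Pᵒᵖ} {M : BanMod R} {f g : M ⟶ growthMod R r φ}
    (h : ∀ p, f ≫ growthEv R r φ p = g ≫ growthEv R r φ p) : f = g :=
  BanMod.limMod_ext fun p => h p.unop

theorem growthMod_eq {φ : Growth.{u} Pᵒᵖ} {v w : growthMod R r φ}
    (h : ∀ p, ((growthEv R r φ p).toLin v : alg R (r p)).1 =
      ((growthEv R r φ p).toLin w : alg R (r p)).1) : v = w :=
  Subtype.ext (funext fun p => Subtype.ext (h p.unop))

variable [Nonempty P] [IsDirectedOrder P]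

variable (R) in
/-- The power series which underlies a compatible family. -/
noncomputable def series (φ : Growth.{u} Pᵒᵖ) : growthMod R r φ →ₗ[R] MvPowerSeries σ R :=
  (alg R (r (Classical.arbitrary P))).val.toLinearMap.comp
    (growthEv R r φ (Classical.arbitrary P)).toLin

/-- Restriction preserves coefficients, so by directedness all members of a compatible family are
one power series; the arbitrary index in `series` plays no role. -/
theorem coe_growthEv {φ : Growth.{u} Pᵒᵖ} (v : growthMod R r φ) (p : P) :
    ((growthEv R r φ p).toLin v : alg R (r p)).1 = series R r φ v := by
  obtain ⟨q, h1, h2⟩ := exists_ge_ge p (Classical.arbitrary P)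
  have e : ∀ {p' : P} (h : p' ≤ q), ((growthEv R r φ p').toLin v : alg R (r p')).1 =
      ((growthEv R r φ q).toLin v : alg R (r q)).1 := fun h => by
    rw [← growthEv_res r φ h, BanMod.comp_apply]
    exact coe_res _ _
  exact (e h1).trans (e h2).symm

/-- The sequence `W` is a lower bound for the growth `φ` along the cofinal sequence `w`, and it
grows faster than the monomials. -/
structure Adapted (w : ℕ → P) (φ : Growth.{u} Pᵒᵖ) (W : ℕ → ℝ) : Prop where
  pos : ∀ k, 0 < W k
  dom : ∀ p, ∃ k, p ≤ w k ∧ W k ≤ φ.fn (op p)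
  summable : ∀ J, Summable fun k => weight (r (w k)) J / W k

-- Only countably many sequences have to be outgrown: the monomial weights along `w`, the given
-- growth along `w`, and a free sequence `A`. The last one carries the growth of the series in both
-- sets of variables when variables are separated.
omit [Nonempty P] [IsDirectedOrder P] in
theorem exists_adapted {w : ℕ → P} (hw : ∀ p, ∃ k, p ≤ w k) (φ : Growth.{u} Pᵒᵖ) (A : ℕ → ℝ) :
    ∃ (ψ : Growth.{u} Pᵒᵖ) (W : ℕ → ℝ), φ ≤ ψ ∧ Adapted r w ψ W ∧
      (Summable fun k => (φ.fn (op (w k)) : ℝ) / W k) ∧ Summable fun k => A k / W k := by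
  -- In the index type, `true` stands for `φ` along `w`, `false` for `A`, and the right summand for
  -- the weights.
  obtain ⟨W, hW, hs⟩ := exists_summable_div (ι := Bool ⊕ (σ →₀ ℕ))
    (Sum.elim (fun b k => cond b (φ.fn (op (w k)) : ℝ) (A k)) fun J k => weight (r (w k)) J)
  choose k hk using hw
  -- The growth is raised at each `p` to the value of `W` at some position `k` with `p ≤ w k`.
  refine ⟨⟨fun p => max (φ.fn p) ⟨W (k p.unop), hW _⟩⟩, W, fun p => le_max_left _ _,
    ⟨hW, fun p => ⟨k p, hk p, ?_⟩, fun J => hs (Sum.inr J)⟩, hs (Sum.inl true),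
    hs (Sum.inl false)⟩
  exact le_max_right (φ.fn (op p)) ⟨W (k p), hW _⟩

variable {r}

omit [Nonempty P] [IsDirectedOrder P]

/-- If `p ≤ w k` and `W k ≤ φ p`, the weight at `p` is at most the quotient for `k` times `φ p`.
Bounding this quotient by the sum over all `k` removes the dependence on `p` and prepares the
exchange of summations. -/
theorem Adapted.weight_le {w : ℕ → P} {φ : Growth.{u} Pᵒᵖ} {W : ℕ → ℝ} (h : Adapted r w φ W)
    (J : σ →₀ ℕ) (p : P) :
    weight (r p) J ≤ (∑' k, weight (r (w k)) J / W k) * φ.fn (op p) := by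
  obtain ⟨k, hk, hW⟩ := h.dom p
  have h0 : ∀ k, 0 ≤ weight (r (w k)) J / W k := fun k =>
    div_nonneg (weight_pos _ _).le (h.pos k).le
  calc weight (r p) J ≤ weight (r (w k)) J := weight_mono (r.monotone hk) J
    _ = weight (r (w k)) J / W k * W k := (div_mul_cancel₀ _ (h.pos k).ne').symm
    _ ≤ _ := mul_le_mul ((h.summable J).le_tsum k fun l _ => h0 l) hW (h.pos k).le
      (tsum_nonneg h0)

theorem Adapted.norm_mono_le {w : ℕ → P} {φ : Growth.{u} Pᵒᵖ} {W : ℕ → ℝ}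
    (h : Adapted r w φ W) (J : σ →₀ ℕ) (p : P) :
    ‖mono R (r p) J‖ ≤ ‖(1 : R)‖ * (∑' k, weight (r (w k)) J / W k) * φ.fn (op p) := by
  rw [norm_mono, mul_assoc]
  exact mul_le_mul_of_nonneg_left (h.weight_le J p) (norm_nonneg _)

variable (R) in
/-- The monomials as compatible families. -/
noncomputable def Adapted.mono {w : ℕ → P} {φ : Growth.{u} Pᵒᵖ} {W : ℕ → ℝ}
    (h : Adapted r w φ W) (J : σ →₀ ℕ) : growthMod R r φ :=
  mkGrowth R r (fun p => Polydisc.mono R (r p) J)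
    (fun _ => (coe_mono _ J).trans (coe_mono _ J).symm) (h.norm_mono_le J)

theorem Adapted.ev_mono {w : ℕ → P} {φ : Growth.{u} Pᵒᵖ} {W : ℕ → ℝ}
    (h : Adapted r w φ W) (J : σ →₀ ℕ) (p : P) :
    (growthEv R r φ p).toLin (h.mono R J) = Polydisc.mono R (r p) J := rfl

theorem Adapted.norm_le {w : ℕ → P} {φ : Growth.{u} Pᵒᵖ} {W : ℕ → ℝ}
    (h : Adapted r w φ W) (J : σ →₀ ℕ) :
    ‖h.mono R J‖ ≤ ‖(1 : R)‖ * ∑' k, weight (r (w k)) J / W k :=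
  norm_growthMod_le r (mul_nonneg (norm_nonneg _) (tsum_nonneg fun k =>
    div_nonneg (weight_pos _ _).le (h.pos k).le)) fun p => by
      rw [h.ev_mono]
      exact h.norm_mono_le J p

variable [Nonempty P] [IsDirectedOrder P]

/-- The expansion of a compatible family in monomials. -/
theorem Adapted.hasSum {w : ℕ → P} {φ ψ : Growth.{u} Pᵒᵖ} {W : ℕ → ℝ} (h : Adapted r w ψ W)
    (hle : φ ≤ ψ) (hs : Summable fun k => (φ.fn (op (w k)) : ℝ) / W k) (v : growthMod R r φ) :
    HasSum (fun J => MvPowerSeries.coeff J (series R r φ v) • h.mono R J)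
      ((growthIncl R r hle).toLin v) := by
  have hterm : ∀ J k, ‖MvPowerSeries.coeff J (series R r φ v)‖ * (weight (r (w k)) J / W k) =
      term R (r (w k)) (series R r φ v) J / W k := fun J k => (mul_div_assoc _ _ _).symm
  have hsum : ∀ k, HasSum (term R (r (w k)) (series R r φ v))
      ‖((growthEv R r φ (w k)).toLin v : alg R (r (w k)))‖ := fun k => by
    rw [← coe_growthEv r v (w k)]
    exact (alg_summable ((growthEv R r φ (w k)).toLin v)).hasSum
  -- For fixed `k`, the sum over `J` is the norm at `w k` divided by `W k`, which is at most `‖v‖ *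
  -- φ (w k) / W k`. In the other order, the sum over `k` bounds the norm of the monomial of index
  -- `J` up to `‖1‖`.
  obtain ⟨-, h2, -⟩ := Summable.tsum_of_nonneg
    (g := fun J k => ‖MvPowerSeries.coeff J (series R r φ v)‖ * (weight (r (w k)) J / W k))
    (b := fun k => ‖v‖ * ((φ.fn (op (w k)) : ℝ) / W k))
    (fun J k => mul_nonneg (norm_nonneg _) (div_nonneg (weight_pos _ _).le (h.pos k).le))
    (fun k => by
      simp only [hterm]
      exact ((hsum k).div_const _).summable)
    (fun k => by
      simp only [hterm]
      rw [((hsum k).div_const _).tsum_eq, ← mul_div_assoc]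
      exact div_le_div_of_nonneg_right (norm_growthEv_le r v (w k)) (h.pos k).le)
    (hs.mul_left _)
  simp only [tsum_mul_left] at h2
  have h3 : Summable fun J => MvPowerSeries.coeff J (series R r φ v) • h.mono R J := by
    refine BanMod.summable_smul (N := growthMod R r ψ) ((h2.mul_left ‖(1 : R)‖).of_nonneg_of_le
      (fun J => mul_nonneg (norm_nonneg _) (norm_nonneg _)) fun J => ?_)
    rw [mul_left_comm]
    exact mul_le_mul_of_nonneg_left (h.norm_le J) (norm_nonneg _)
  -- The limit is identified at each `p`: evaluation is bounded, and it turns the sum into a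
  -- monomial expansion in a single polydisc algebra.
  have h4 : (∑' J, MvPowerSeries.coeff J (series R r φ v) • h.mono R J) =
      (growthIncl R r hle).toLin v := growthMod_eq r fun p => by
    have h5 := BanMod.hasSum_map (growthEv R r ψ p) h3.hasSum
    simp only [map_smul] at h5
    refine (coe_eq_of_hasSum h5).trans (coe_growthEv r v p).symm
  rw [← h4]
  exact h3.hasSum

end Growth

end Polydisc

/-! ### Separation of variables -/

namespace Polydisc

section Comparison

variable {R : Type u} [BanachCommRing R] {n m : ℕ}
  {P Q S : Type} [Preorder P] [Preorder Q] [Preorder S]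
  {r : P →o (Fin n → PosReal)} {s : Q →o (Fin m → PosReal)} {t : S →o (Fin (n + m) → PosReal)}

theorem extMul_monomial (L : Fin (n + m) →₀ ℕ) :
    extMul (MvPowerSeries.monomial (fstIdx L) (1 : R)) (MvPowerSeries.monomial (sndIdx L) 1) =
      MvPowerSeries.monomial L 1 := by
  classical
  refine MvPowerSeries.ext fun K => ?_
  have h : K = L ↔ fstIdx K = fstIdx L ∧ sndIdx K = sndIdx L := by
    rw [← (idxEquiv n m).injective.eq_iff, idxEquiv_apply, idxEquiv_apply, Prod.ext_iff]
  rw [coeff_extMul, MvPowerSeries.coeff_monomial, MvPowerSeries.coeff_monomial,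
    MvPowerSeries.coeff_monomial]
  by_cases h1 : fstIdx K = fstIdx L <;> by_cases h2 : sndIdx K = sndIdx L <;> simp [h, h1, h2]

/-- The polyradius `ρ` need not belong to the family `t`. This is needed for the concatenations of
`r (w k)` and `s (w' l)`, which are only assumed to lie below members of `t`. -/
theorem sum_term_le [Nonempty S] [IsDirectedOrder S] {χ : Growth.{u} Sᵒᵖ} (f : growthMod R t χ)
    {c : S} {ρ : Fin (n + m) → PosReal} (h : ρ ≤ t c) :
    Summable (term R ρ (series R t χ f)) ∧
      ∑' L, term R ρ (series R t χ f) L ≤ ‖f‖ * χ.fn (op c) := by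
  rw [← coe_growthEv t f c]
  exact ⟨alg_anti h ((growthEv R t χ c).toLin f : alg R (t c)).2,
    (norm_inclusion_le h ((growthEv R t χ c).toLin f)).trans (norm_growthEv_le t f c)⟩

/-- The bounded map `∑ a_L x ^ J y ^ K ↦ ∑ a_L x ^ J ⊗ y ^ K`. -/
theorem exists_separation [Nonempty S] [IsDirectedOrder S] {w : ℕ → P} {w' : ℕ → Q}
    {φ : Growth.{u} Pᵒᵖ} {ψ : Growth.{u} Qᵒᵖ} {W V : ℕ → ℝ} (hr : Adapted r w φ W)
    (hs : Adapted s w' ψ V) (χ : Growth.{u} Sᵒᵖ) (d : ℕ × ℕ → S)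
    (hd : ∀ x, Fin.append (r (w x.1)) (s (w' x.2)) ≤ t (d x))
    (hsum : Summable fun x : ℕ × ℕ => (χ.fn (op (d x)) : ℝ) / (W x.1 * V x.2)) :
    ∃ T : growthMod R t χ ⟶ BanMod.tensor (growthMod R r φ) (growthMod R s ψ),
      ∀ f, HasSum (fun L => MvPowerSeries.coeff L (series R t χ f) •
        BanMod.tmul (hr.mono R (fstIdx L)) (hs.mono R (sndIdx L))) (T.toLin f) := by
  have hpos : ∀ x : ℕ × ℕ, 0 < W x.1 * V x.2 := fun x => mul_pos (hr.pos _) (hs.pos _)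
  have hterm : ∀ (f : growthMod R t χ) (L : Fin (n + m) →₀ ℕ) (x : ℕ × ℕ),
      ‖MvPowerSeries.coeff L (series R t χ f)‖ *
        ((weight (r (w x.1)) (fstIdx L) / W x.1) * (weight (s (w' x.2)) (sndIdx L) / V x.2)) =
      term R (Fin.append (r (w x.1)) (s (w' x.2))) (series R t χ f) L / (W x.1 * V x.2) :=
    fun f L x => by rw [term, weight_append, div_mul_div_comm, ← mul_div_assoc]
  have h0r : ∀ J k, 0 ≤ weight (r (w k)) J / W k := fun J k =>
    div_nonneg (weight_pos _ _).le (hr.pos k).le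
  have h0s : ∀ J k, 0 ≤ weight (s (w' k)) J / V k := fun J k =>
    div_nonneg (weight_pos _ _).le (hs.pos k).le
  -- The product of the two sums over positions bounds the norm of x^J ⊗ y^K up to `‖1‖ * ‖1‖`.
  -- Written as a double sum and exchanged with the sum over `L`, it produces the norm of `f` on the
  -- polydisc of polyradius `(r (w k), s (w' l))`, divided by `W k * V l`; `hsum` controls the
  -- total.
  have key : ∀ f : growthMod R t χ,
      Summable (fun L => ‖MvPowerSeries.coeff L (series R t χ f)‖ *
        ((∑' k, weight (r (w k)) (fstIdx L) / W k) * ∑' k, weight (s (w' k)) (sndIdx L) / V k)) ∧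
      ∑' L, ‖MvPowerSeries.coeff L (series R t χ f)‖ *
        ((∑' k, weight (r (w k)) (fstIdx L) / W k) *
          ∑' k, weight (s (w' k)) (sndIdx L) / V k) ≤
        ‖f‖ * ∑' x : ℕ × ℕ, (χ.fn (op (d x)) : ℝ) / (W x.1 * V x.2) := fun f => by
    obtain ⟨-, h2, h3⟩ := Summable.tsum_of_nonneg
      (g := fun L (x : ℕ × ℕ) => ‖MvPowerSeries.coeff L (series R t χ f)‖ *
        ((weight (r (w x.1)) (fstIdx L) / W x.1) * (weight (s (w' x.2)) (sndIdx L) / V x.2)))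
      (b := fun x => ‖f‖ * ((χ.fn (op (d x)) : ℝ) / (W x.1 * V x.2)))
      (fun L x => mul_nonneg (norm_nonneg _) (mul_nonneg (h0r _ _) (h0s _ _)))
      (fun x => by
        simp only [hterm]
        exact (sum_term_le f (hd x)).1.div_const _)
      (fun x => by
        simp only [hterm]
        rw [tsum_div_const, ← mul_div_assoc]
        exact div_le_div_of_nonneg_right (sum_term_le f (hd x)).2 (hpos x).le)
      (hsum.mul_left _)
    have h4 : ∀ L : Fin (n + m) →₀ ℕ, ((∑' k, weight (r (w k)) (fstIdx L) / W k) *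
        ∑' k, weight (s (w' k)) (sndIdx L) / V k) = ∑' x : ℕ × ℕ,
          (weight (r (w x.1)) (fstIdx L) / W x.1) * (weight (s (w' x.2)) (sndIdx L) / V x.2) :=
      fun L => (hr.summable _).tsum_mul_tsum (hs.summable _)
        ((hr.summable _).mul_of_nonneg (hs.summable _) (h0r _) (h0s _))
    simp only [h4, ← tsum_mul_left]
    refine ⟨h2, ?_⟩
    rw [tsum_mul_left] at h3
    simpa only [tsum_mul_left] using h3
  have hnorm : ∀ L, ‖BanMod.tmul (hr.mono R (fstIdx L)) (hs.mono R (sndIdx L))‖ ≤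
      (‖(1 : R)‖ * ‖(1 : R)‖) * ((∑' k, weight (r (w k)) (fstIdx L) / W k) *
        ∑' k, weight (s (w' k)) (sndIdx L) / V k) := fun L => by
    rw [mul_mul_mul_comm]
    exact (BanMod.norm_tmul_le _ _).trans (mul_le_mul (hr.norm_le _) (hs.norm_le _)
      (norm_nonneg _) (mul_nonneg (norm_nonneg _) (tsum_nonneg (h0r _))))
  have hle : ∀ (f : growthMod R t χ) (L), ‖MvPowerSeries.coeff L (series R t χ f)‖ *
      ‖BanMod.tmul (hr.mono R (fstIdx L)) (hs.mono R (sndIdx L))‖ ≤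
      (‖(1 : R)‖ * ‖(1 : R)‖) * (‖MvPowerSeries.coeff L (series R t χ f)‖ *
        ((∑' k, weight (r (w k)) (fstIdx L) / W k) *
          ∑' k, weight (s (w' k)) (sndIdx L) / V k)) := fun f L => by
    rw [mul_left_comm]
    exact mul_le_mul_of_nonneg_left (hnorm L) (norm_nonneg _)
  have hs1 : ∀ f : growthMod R t χ, Summable fun L =>
      ‖MvPowerSeries.coeff L (series R t χ f)‖ *
        ‖BanMod.tmul (hr.mono R (fstIdx L)) (hs.mono R (sndIdx L))‖ := fun f =>
    ((key f).1.mul_left _).of_nonneg_of_le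
      (fun L => mul_nonneg (norm_nonneg _) (norm_nonneg _)) (hle f)
  refine BanMod.exists_hom_hasSum (M := growthMod R t χ)
    (a := fun L => (MvPowerSeries.coeff L).comp (series R t χ))
    (K := (‖(1 : R)‖ * ‖(1 : R)‖) *
      ∑' x : ℕ × ℕ, (χ.fn (op (d x)) : ℝ) / (W x.1 * V x.2)) _ hs1 fun f => ?_
  refine ((hs1 f).tsum_le_tsum (hle f) ((key f).1.mul_left _)).trans ?_
  rw [tsum_mul_left, mul_assoc (‖(1 : R)‖ * ‖(1 : R)‖) _ ‖f‖, mul_comm _ ‖f‖]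
  exact mul_le_mul_of_nonneg_left (key f).2 (mul_nonneg (norm_nonneg _) (norm_nonneg _))

variable (R) in
/-- The product of compatible families in different variables at `t c`. -/
noncomputable def evExt (φ : Growth.{u} Pᵒᵖ) (ψ : Growth.{u} Qᵒᵖ) {p : P} {q : Q} {c : S}
    (h : t c ≤ Fin.append (r p) (s q)) :
    BanMod.tensor (growthMod R r φ) (growthMod R s ψ) ⟶ mod (R := R) (t c) :=
  BanMod.tensorMap (growthEv R r φ p) (growthEv R s ψ q) ≫ extHom (r p) (s q) ≫ res h

theorem coe_evExt_tmul {φ : Growth.{u} Pᵒᵖ} {ψ : Growth.{u} Qᵒᵖ} {p : P} {q : Q} {c : S}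
    (h : t c ≤ Fin.append (r p) (s q)) (f : growthMod R r φ) (g : growthMod R s ψ) :
    ((evExt R φ ψ h).toLin (BanMod.tmul f g) : alg R (t c)).1 =
      extMul ((growthEv R r φ p).toLin f : alg R (r p)).1
        ((growthEv R s ψ q).toLin g : alg R (s q)).1 := by
  rw [evExt, BanMod.comp_apply, BanMod.comp_apply, BanMod.tensorMap_tmul]
  refine (coe_res h _).trans (congrArg Subtype.val (extHom_tmul _ _))

theorem evExt_mono {w : ℕ → P} {w' : ℕ → Q} {φ : Growth.{u} Pᵒᵖ} {ψ : Growth.{u} Qᵒᵖ}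
    {W V : ℕ → ℝ} (hr : Adapted r w φ W) (hs : Adapted s w' ψ V) {p : P} {q : Q} {c : S}
    (h : t c ≤ Fin.append (r p) (s q)) (L : Fin (n + m) →₀ ℕ) :
    (evExt R φ ψ h).toLin (BanMod.tmul (hr.mono R (fstIdx L)) (hs.mono R (sndIdx L))) =
      mono R (t c) L :=
  Subtype.ext ((coe_evExt_tmul h _ _).trans ((congrArg₂ extMul
    ((congrArg Subtype.val (hr.ev_mono (fstIdx L) p)).trans (coe_mono _ _))
    ((congrArg Subtype.val (hs.ev_mono (sndIdx L) q)).trans (coe_mono _ _))).trans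
      ((extMul_monomial L).trans (coe_mono _ _).symm)))

/-- The separation of variables is a right inverse of the multiplication. -/
theorem separation_evExt [Nonempty S] [IsDirectedOrder S] {w : ℕ → P} {w' : ℕ → Q}
    {φ : Growth.{u} Pᵒᵖ} {ψ : Growth.{u} Qᵒᵖ} {W V : ℕ → ℝ} {hr : Adapted r w φ W}
    {hs : Adapted s w' ψ V} {χ : Growth.{u} Sᵒᵖ}
    {T : growthMod R t χ ⟶ BanMod.tensor (growthMod R r φ) (growthMod R s ψ)}
    (hT : ∀ f, HasSum (fun L => MvPowerSeries.coeff L (series R t χ f) •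
        BanMod.tmul (hr.mono R (fstIdx L)) (hs.mono R (sndIdx L))) (T.toLin f))
    {p : P} {q : Q} {c : S} (h : t c ≤ Fin.append (r p) (s q)) :
    T ≫ evExt R φ ψ h = growthEv R t χ c :=
  BanMod.hom_ext fun f => by
    -- A bounded map may be applied termwise. Here it sends each x^J ⊗ y^K back to the monomial of
    -- index `L`, leaving the expansion of `f`.
    have h1 := BanMod.hasSum_map (evExt R φ ψ h) (hT f)
    have e : ∀ L, (evExt R φ ψ h).toLin (MvPowerSeries.coeff L (series R t χ f) •
        BanMod.tmul (hr.mono R (fstIdx L)) (hs.mono R (sndIdx L))) =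
        MvPowerSeries.coeff L (series R t χ f) • mono R (t c) L := fun L =>
      (map_smul _ _ _).trans (congrArg _ (evExt_mono hr hs h L))
    rw [funext e] at h1
    exact Subtype.ext ((coe_eq_of_hasSum h1).trans (coe_growthEv t f c).symm)

/-- The separation of variables is a left inverse of the multiplication up to enlarging the
growth. -/
theorem multiplication_separation [Nonempty S] [IsDirectedOrder S] [Nonempty P]
    [IsDirectedOrder P] [Nonempty Q] [IsDirectedOrder Q] {w : ℕ → P} {w' : ℕ → Q}
    {φ φ' : Growth.{u} Pᵒᵖ} {ψ ψ' : Growth.{u} Qᵒᵖ} {W V : ℕ → ℝ} {hr : Adapted r w φ' W}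
    {hs : Adapted s w' ψ' V} (hφ : φ ≤ φ') (hψ : ψ ≤ ψ')
    (hW : Summable fun k => (φ.fn (op (w k)) : ℝ) / W k)
    (hV : Summable fun k => (ψ.fn (op (w' k)) : ℝ) / V k) {χ : Growth.{u} Sᵒᵖ}
    {T : growthMod R t χ ⟶ BanMod.tensor (growthMod R r φ') (growthMod R s ψ')}
    (hT : ∀ f, HasSum (fun L => MvPowerSeries.coeff L (series R t χ f) •
        BanMod.tmul (hr.mono R (fstIdx L)) (hs.mono R (sndIdx L))) (T.toLin f))
    {E : BanMod.tensor (growthMod R r φ) (growthMod R s ψ) ⟶ growthMod R t χ}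
    (hE : ∀ c, ∃ (p : P) (q : Q) (h : t c ≤ Fin.append (r p) (s q)),
      E ≫ growthEv R t χ c = evExt R φ ψ h) :
    E ≫ T = BanMod.tensorMap (growthIncl R r hφ) (growthIncl R s hψ) :=
  BanMod.tensor_ext fun f g => by
    -- One index of `S` suffices, since every member of a compatible family has the same underlying
    -- series.
    have hser : series R t χ (E.toLin (BanMod.tmul f g)) =
        extMul (series R r φ f) (series R s ψ g) := by
      obtain ⟨p, q, h, e⟩ := hE (Classical.arbitrary S)
      rw [← coe_growthEv t _ (Classical.arbitrary S), ← coe_growthEv r f p,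
        ← coe_growthEv s g q, ← coe_evExt_tmul h, ← e]
      rfl
    have h1 := hT (E.toLin (BanMod.tmul f g))
    simp only [hser, coeff_extMul] at h1
    rw [BanMod.comp_apply, BanMod.tensorMap_tmul]
    -- The series defining `T` is read over pairs (J, K). Summing over K gives the expansion of `g`
    -- tensored with x^J, and then summing over J gives that of `f`. The value is f ⊗ g in the
    -- larger growths, by uniqueness of sums.
    have h2 : HasSum (fun x : (Fin n →₀ ℕ) × (Fin m →₀ ℕ) =>
        (MvPowerSeries.coeff x.1 (series R r φ f) * MvPowerSeries.coeff x.2 (series R s ψ g)) •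
          BanMod.tmul (hr.mono R x.1) (hs.mono R x.2))
        (T.toLin (E.toLin (BanMod.tmul f g))) := (idxEquiv n m).hasSum_iff.1 h1
    have h3 : ∀ J, HasSum (fun K =>
        (MvPowerSeries.coeff J (series R r φ f) * MvPowerSeries.coeff K (series R s ψ g)) •
          BanMod.tmul (hr.mono R J) (hs.mono R K))
        (MvPowerSeries.coeff J (series R r φ f) •
          BanMod.tmul (hr.mono R J) ((growthIncl R s hψ).toLin g)) := fun J => by
      have h4 := BanMod.hasSum_map (BanMod.tmulLeft (growthMod R s ψ')
        (MvPowerSeries.coeff J (series R r φ f) • hr.mono R J)) (hs.hasSum hψ hV g)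
      have e : ∀ K, (BanMod.tmulLeft (growthMod R s ψ')
          (MvPowerSeries.coeff J (series R r φ f) • hr.mono R J)).toLin
            (MvPowerSeries.coeff K (series R s ψ g) • hs.mono R K) =
          (MvPowerSeries.coeff J (series R r φ f) * MvPowerSeries.coeff K (series R s ψ g)) •
            BanMod.tmul (hr.mono R J) (hs.mono R K) := fun K =>
        (BanMod.smul_tmul' _ _ _).trans
          ((congrArg _ (BanMod.tmul_smul _ _ _)).trans (smul_smul _ _ _))
      rw [funext e] at h4
      exact (BanMod.smul_tmul' (MvPowerSeries.coeff J (series R r φ f)) (hr.mono R J)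
        ((growthIncl R s hψ).toLin g)) ▸ h4
    have h5 := BanMod.hasSum_map (BanMod.tmulRight (growthMod R r φ')
      ((growthIncl R s hψ).toLin g)) (hr.hasSum hφ hW f)
    have e : ∀ J, (BanMod.tmulRight (growthMod R r φ') ((growthIncl R s hψ).toLin g)).toLin
        (MvPowerSeries.coeff J (series R r φ f) • hr.mono R J) =
        MvPowerSeries.coeff J (series R r φ f) •
          BanMod.tmul (hr.mono R J) ((growthIncl R s hψ).toLin g) := fun J =>
      BanMod.smul_tmul' _ _ _
    rw [funext e] at h5
    exact (h2.prod_fiberwise h3).unique h5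

end Comparison

end Polydisc

/-! ### The comparison morphism is an isomorphism -/

namespace Polydisc

section Comparison

variable {R : Type u} [BanachCommRing R] {n m : ℕ}
  {P Q S : Type} [Preorder P] [Preorder Q] [Preorder S]
  {r : P →o (Fin n → PosReal)} {s : Q →o (Fin m → PosReal)} {t : S →o (Fin (n + m) → PosReal)}

/-- A cofinal sequence in a preorder. -/
structure IsCofinalSeq {P : Type} [Preorder P] (w : ℕ → P) : Prop where
  monotone : Monotone w
  exists_le : ∀ p, ∃ k, p ≤ w k

theorem IsCofinalSeq.isDirectedOrder {w : ℕ → P} (hw : IsCofinalSeq w) : IsDirectedOrder P :=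
  ⟨fun p q => by
    obtain ⟨k, hk⟩ := hw.exists_le p
    obtain ⟨l, hl⟩ := hw.exists_le q
    exact ⟨w (max k l), hk.trans (hw.monotone (le_max_left k l)),
      hl.trans (hw.monotone (le_max_right k l))⟩⟩

theorem append_le_append {a a' : Fin n → PosReal} {b b' : Fin m → PosReal} (ha : a ≤ a')
    (hb : b ≤ b') : Fin.append a b ≤ Fin.append a' b' :=
  Fin.addCases (fun i => by rw [Fin.append_left, Fin.append_left]; exact ha i)
    fun j => by rw [Fin.append_right, Fin.append_right]; exact hb j

/-- `W` and `V` are chosen against `φ`, `ψ` and `χ` simultaneously, so that separation is defined on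
growth `χ` and the expansions of series of growth `φ` and `ψ` converge. The obstacle is that `χ`
involves both positions jointly, while the denominator `W k * V l` is a product. -/
theorem exists_adapted_separation [Nonempty S] [IsDirectedOrder S] {w : ℕ → P} {w' : ℕ → Q}
    (hw : IsCofinalSeq w) (hw' : IsCofinalSeq w')
    (hTS : ∀ p q, ∃ c, Fin.append (r p) (s q) ≤ t c) (φ : Growth.{u} Pᵒᵖ) (ψ : Growth.{u} Qᵒᵖ)
    (χ : Growth.{u} Sᵒᵖ) :
    ∃ (φ' : Growth.{u} Pᵒᵖ) (ψ' : Growth.{u} Qᵒᵖ) (W V : ℕ → ℝ) (hr : Adapted r w φ' W)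
      (hs : Adapted s w' ψ' V)
      (T : growthMod R t χ ⟶ BanMod.tensor (growthMod R r φ') (growthMod R s ψ')),
      φ ≤ φ' ∧ ψ ≤ ψ' ∧ (Summable fun k => (φ.fn (op (w k)) : ℝ) / W k) ∧
      (Summable fun k => (ψ.fn (op (w' k)) : ℝ) / V k) ∧
      ∀ f, HasSum (fun L => MvPowerSeries.coeff L (series R t χ f) •
        BanMod.tmul (hr.mono R (fstIdx L)) (hs.mono R (sndIdx L))) (T.toLin f) := by
  choose d hd using fun k => hTS (w k) (w' k)
  -- `A` is at least 1 and dominates `χ` along `d`. As `max k l` is `k` or `l`, the value at `d (max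
  -- k l)` is at most `A k * A l`, and the double series is dominated by a product of two convergent
  -- ones.
  let A : ℕ → ℝ := fun k => 1 + ∑ i ∈ Finset.range (k + 1), (χ.fn (op (d i)) : ℝ)
  have hχ : ∀ i, 0 ≤ (χ.fn (op (d i)) : ℝ) := fun i => le_of_lt (χ.fn (op (d i))).2
  have hA1 : ∀ k, 1 ≤ A k := fun k =>
    le_add_of_nonneg_right (Finset.sum_nonneg fun i _ => hχ i)
  have hA0 : ∀ k, 0 ≤ A k := fun k => zero_le_one.trans (hA1 k)
  have hA : ∀ k, (χ.fn (op (d k)) : ℝ) ≤ A k := fun k =>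
    (Finset.single_le_sum (f := fun i => (χ.fn (op (d i)) : ℝ)) (fun i _ => hχ i)
      (Finset.self_mem_range_succ k)).trans (le_add_of_nonneg_left zero_le_one)
  have hmax : ∀ k l, (χ.fn (op (d (max k l))) : ℝ) ≤ A k * A l := fun k l => by
    refine (hA _).trans ?_
    rcases max_choice k l with h | h <;> rw [h]
    · exact le_mul_of_one_le_right (hA0 k) (hA1 l)
    · exact le_mul_of_one_le_left (hA0 l) (hA1 k)
  obtain ⟨φ', W, hφ, hr, hW, hAW⟩ := exists_adapted r hw.exists_le φ A
  obtain ⟨ψ', V, hψ, hs, hV, hAV⟩ := exists_adapted s hw'.exists_le ψ A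
  obtain ⟨T, hT⟩ := exists_separation (R := R) (t := t) hr hs χ (fun x => d (max x.1 x.2))
    (fun x => (append_le_append (r.monotone (hw.monotone (le_max_left x.1 x.2)))
      (s.monotone (hw'.monotone (le_max_right x.1 x.2)))).trans (hd _))
    ((hAW.mul_of_nonneg hAV (fun k => div_nonneg (hA0 k) (hr.pos k).le)
      fun k => div_nonneg (hA0 k) (hs.pos k).le).of_nonneg_of_le
      (fun x => div_nonneg (hχ _) (mul_pos (hr.pos _) (hs.pos _)).le) fun x => by
        rw [div_mul_div_comm]
        exact div_le_div_of_nonneg_right (hmax x.1 x.2) (mul_pos (hr.pos _) (hs.pos _)).le)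
  exact ⟨φ', ψ', W, V, hr, hs, T, hφ, hψ, hW, hV, hT⟩

theorem incl_growthπ (φ : Growth.{u} Pᵒᵖ) (p : P) :
    (growthSys R r).incl φ ≫ growthπ R r p = IndSystem.const.map (growthEv R r φ p) :=
  BanMod.incl_limπ (uniformSMul_diagram R r) φ (op p)

/-- On a member of the tensor system, a component of the comparison comes from a bounded map.
Identities of ind-objects thereby reduce to identities of maps of Banach modules. -/
theorem tincl_leg (φ : Growth.{u} Pᵒᵖ) (ψ : Growth.{u} Qᵒᵖ) {p : P} {q : Q} {c : S}
    (h : t c ≤ Fin.append (r p) (s q)) :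
    IndSystem.tincl (growthSys R r) (growthSys R s) φ ψ ≫ leg R r s t h =
      IndSystem.const.map (evExt R φ ψ h) := by
  have h1 : IndSystem.box ((growthSys R r).incl φ) ((growthSys R s).incl ψ) ≫
      IndSystem.tensorMap (growthπ R r p) (growthπ R s q) ≫ IndSystem.constMul _ _ =
      IndSystem.const.map (growthEv R r φ p ⊗ₘ growthEv R s ψ q) := by
    rw [IndSystem.box_tensorMap_assoc, incl_growthπ, incl_growthπ, IndSystem.box_constMul]
  rw [leg, indExt, IndSystem.tincl_eq_box, Category.assoc, ← Category.assoc,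
    ← Category.assoc]
  rw [Category.assoc (IndSystem.box _ _)]
  refine (congrArg (· ≫ _) h1).trans ?_
  rw [← Functor.map_comp, ← Functor.map_comp]
  rfl

theorem tincl_growthIncl {φ φ' : Growth.{u} Pᵒᵖ} {ψ ψ' : Growth.{u} Qᵒᵖ} (hφ : φ ≤ φ')
    (hψ : ψ ≤ ψ') :
    IndSystem.const.map (BanMod.tensorMap (growthIncl R r hφ) (growthIncl R s hψ)) ≫
      IndSystem.tincl (growthSys R r) (growthSys R s) φ' ψ' =
      IndSystem.tincl (growthSys R r) (growthSys R s) φ ψ :=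
  IndSystem.tincl_w (growthSys R r) (growthSys R s) (homOfLE hφ) (homOfLE hψ)

/-- A morphism from a constant system factors through a member of its target. On members,
injectivity comes from `multiplication_separation` and surjectivity from `separation_evExt`. -/
theorem isIso_comparison {w : ℕ → P} {w' : ℕ → Q} (hw : IsCofinalSeq w)
    (hw' : IsCofinalSeq w') [Nonempty S] [IsDirectedOrder S]
    (hST : ∀ c, ∃ p q, t c ≤ Fin.append (r p) (s q))
    (hTS : ∀ p q, ∃ c, Fin.append (r p) (s q) ≤ t c)
    (h : growthSys R r ⊗ growthSys R s ⟶ growthSys R t)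
    (hh : ∀ (p : P) (q : Q) (c : S) (hc : t c ≤ Fin.append (r p) (s q)),
      h ≫ growthπ R t c = leg R r s t hc) : IsIso h := by
  have := hw.isDirectedOrder
  have := hw'.isDirectedOrder
  have : Nonempty P := ⟨w 0⟩
  have : Nonempty Q := ⟨w' 0⟩
  have hproj : ∀ {M : BanMod R} {φ : Growth.{u} Pᵒᵖ} {ψ : Growth.{u} Qᵒᵖ}
      (a : M ⟶ BanMod.tensor (growthMod R r φ) (growthMod R s ψ)) {p : P} {q : Q} {c : S}
      (hc : t c ≤ Fin.append (r p) (s q)),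
      ((IndSystem.const.map a ≫ IndSystem.tincl (growthSys R r) (growthSys R s) φ ψ) ≫ h) ≫
        growthπ R t c = IndSystem.const.map (a ≫ evExt R φ ψ hc) := fun a p q c hc => by
    rw [Category.assoc, Category.assoc, Functor.map_comp, ← tincl_leg, ← hh _ _ _ hc]
  refine IndSystem.isIso_of_bijective h fun M => ⟨fun x y hxy => ?_, fun y => ?_⟩
  · obtain ⟨φ₁, ψ₁, a, rfl⟩ := IndSystem.exists_tfac x
    obtain ⟨φ₂, ψ₂, b, rfl⟩ := IndSystem.exists_tfac y
    obtain ⟨φ, hφ₁, hφ₂⟩ := exists_ge_ge (α := Growth.{u} Pᵒᵖ) φ₁ φ₂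
    obtain ⟨ψ, hψ₁, hψ₂⟩ := exists_ge_ge (α := Growth.{u} Qᵒᵖ) ψ₁ ψ₂
    rw [← tincl_growthIncl hφ₁ hψ₁, ← tincl_growthIncl hφ₂ hψ₂, ← Functor.map_comp_assoc,
      ← Functor.map_comp_assoc] at hxy ⊢
    generalize a ≫ BanMod.tensorMap _ _ = a' at hxy ⊢
    generalize b ≫ BanMod.tensorMap _ _ = b' at hxy ⊢
    -- The comparison restricted to one member has a constant source, so its values have a single
    -- growth `χ`. This is the bounded multiplication map `E` to be inverted.
    obtain ⟨χ, E, hE⟩ := IndSystem.exists_fac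
      (IndSystem.tincl (growthSys R r) (growthSys R s) φ ψ ≫ h)
    have hE' : ∀ {p : P} {q : Q} {c : S} (hc : t c ≤ Fin.append (r p) (s q)),
        E ≫ growthEv R t χ c = evExt R φ ψ hc := fun {p q c} hc =>
      IndSystem.const.map_injective (by
        have h1 := congrArg (· ≫ growthπ R t c) hE
        simp only [Category.assoc] at h1
        rw [hh _ _ _ hc, tincl_leg] at h1
        rw [Functor.map_comp, ← incl_growthπ]
        exact h1.symm)
    obtain ⟨φ', ψ', W, V, hr, hs, T, hφ', hψ', hW, hV, hT⟩ :=
      exists_adapted_separation (R := R) hw hw' hTS φ ψ χ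
    have hET := multiplication_separation hφ' hψ' hW hV hT (E := E) fun c => by
      obtain ⟨p, q, hc⟩ := hST c
      exact ⟨p, q, hc, hE' hc⟩
    -- Unlike elements of the completed tensor product, compatible families are determined by their
    -- evaluations, and these agree by hypothesis.
    have hab : a' ≫ E = b' ≫ E := growthMod_ext t fun c => by
      obtain ⟨p, q, hc⟩ := hST c
      rw [Category.assoc, Category.assoc, hE' hc]
      refine IndSystem.const.map_injective ?_
      rw [← hproj, ← hproj]
      exact congrArg (· ≫ growthπ R t c) hxy
    -- Composing `hab` with `T` shows that `a'` and `b'` agree after the transition to `φ'`, `ψ'`,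
    -- hence in the formal colimit.
    rw [← tincl_growthIncl hφ' hψ', ← hET, ← Functor.map_comp_assoc, ← Functor.map_comp_assoc,
      ← Category.assoc, ← Category.assoc, hab]
  · obtain ⟨χ, a, rfl⟩ := IndSystem.exists_fac y
    -- For surjectivity the initial growths are immaterial; only `χ` constrains the construction of
    -- `T`.
    obtain ⟨φ⟩ := (inferInstance : Nonempty (Growth.{u} Pᵒᵖ))
    obtain ⟨ψ⟩ := (inferInstance : Nonempty (Growth.{u} Qᵒᵖ))
    obtain ⟨φ', ψ', W, V, hr, hs, T, -, -, -, -, hT⟩ :=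
      exists_adapted_separation (R := R) hw hw' hTS φ ψ χ
    refine ⟨IndSystem.const.map (a ≫ T) ≫
      IndSystem.tincl (growthSys R r) (growthSys R s) φ' ψ', hom_growthSys_ext R t fun c => ?_⟩
    obtain ⟨p, q, hc⟩ := hST c
    refine (hproj (a ≫ T) hc).trans ?_
    rw [Category.assoc, separation_evExt hT hc, Category.assoc, incl_growthπ, ← Functor.map_comp]

/-- In this abstract form, the projection formula is transported along the isomorphisms to the
explicit models without unfolding any of the objects. -/
theorem tensorHom_comp_fac {D : Type*} [Category* D] [MonoidalCategory D]
    {A A' B B' C C' X Y Z : D} (a : A ⟶ A') (b : B ⟶ B') {f : A' ⊗ B' ⟶ C'} {g : C' ⟶ C}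
    {x : A' ⟶ X} {y : B' ⟶ Y} {z : C ⟶ Z} {z' : C' ⟶ Z} {k : X ⊗ Y ⟶ Z} (hz : g ≫ z = z')
    (hf : f ≫ z' = (x ⊗ₘ y) ≫ k) :
    ((a ⊗ₘ b) ≫ f ≫ g) ≫ z = ((a ≫ x) ⊗ₘ (b ≫ y)) ≫ k := by
  rw [Category.assoc, Category.assoc, hz, hf, ← MonoidalCategory.tensorHom_comp_tensorHom,
    Category.assoc]

/-- The algebra of functions on a product of two exhausted polydiscs. -/
theorem exists_limAlg_tensor_iso {w : ℕ → P} {w' : ℕ → Q} (hw : IsCofinalSeq w)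
    (hw' : IsCofinalSeq w') [Nonempty S] [IsDirectedOrder S]
    (hST : ∀ c, ∃ p q, t c ≤ Fin.append (r p) (s q))
    (hTS : ∀ p q, ∃ c, Fin.append (r p) (s q) ≤ t c) :
    ∃ e : (limAlg R r).toMon ⊗ (limAlg R s).toMon ≅ (limAlg R t).toMon,
      ∀ (p : P) (q : Q) (c : S) (hc : t c ≤ Fin.append (r p) (s q)),
        e.hom.hom ≫ proj R t c =
          (proj R r p ⊗ₘ proj R s q) ≫ indExt R (r p) (s q) ≫ IndSystem.const.map (res hc) := by
  have := hw.isDirectedOrder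
  have := hw'.isDirectedOrder
  obtain ⟨er, her⟩ := exists_limAlg_iso R r
  obtain ⟨es, hes⟩ := exists_limAlg_iso R s
  obtain ⟨et, het⟩ := exists_limAlg_iso R t
  obtain ⟨h, hh⟩ := exists_comparison (R := R) r s t hST
  have hiso : IsIso ((Mon.forget (IndBan R)).map h) :=
    isIso_comparison (R := R) hw hw' hST hTS h.hom hh
  -- The forgetful functor from algebras reflects isomorphisms, so multiplicativity of the inverse
  -- is automatic.
  have := isIso_of_reflects_iso h (Mon.forget (IndBan R))
  refine ⟨(er ⊗ᵢ es) ≪≫ asIso h ≪≫ et.symm, fun p q c hc => ?_⟩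
  have h1 : et.inv.hom ≫ proj R t c = growthπ R t c := by
    rw [← het c]
    have h2 : et.inv.hom ≫ et.hom.hom = 𝟙 (growthSys R t) :=
      congrArg Mon.Hom.hom et.inv_hom_id
    refine (Category.assoc _ _ _).symm.trans ((congrArg (· ≫ _) h2).trans (Category.id_comp _))
  exact (tensorHom_comp_fac er.hom.hom es.hom.hom h1 (hh p q c hc)).trans
    (congrArg₂ (fun x y => (x ⊗ₘ y) ≫ indExt R (r p) (s q) ≫ IndSystem.const.map (res hc))
      (her p) (hes q))

end Comparison

/-! ### Cofinal sequences of polyradii and the two geometric cases -/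

theorem exists_isCofinalSeq_radii {n : ℕ} {τ : Fin n → ENNReal} (hτ : ∀ i, 0 < τ i) :
    ∃ w : ℕ → Radii τ, IsCofinalSeq w := by
  -- Each coordinate is exhausted by radii strictly between 0 and `τ i`. They are finite even when
  -- `τ i` is infinite, so they can be converted to real numbers.
  choose v hv1 hv2 hv3 using fun i => exists_seq_strictMono_tendsto' (hτ i)
  have hne : ∀ i k, v i k ≠ ⊤ := fun i k => ((hv2 i k).2.trans_le le_top).ne
  refine ⟨fun k => ⟨fun i => ⟨(v i k).toReal, ENNReal.toReal_pos (hv2 i k).1.ne' (hne i k)⟩,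
    fun i => (ENNReal.ofReal_toReal (hne i k)).trans_lt (hv2 i k).2⟩, fun k l hkl i =>
      ENNReal.toReal_mono (hne i l) ((hv1 i).monotone hkl), fun p => ?_⟩
  -- There are finitely many coordinates, so one `k` works for all of them.
  have h : ∀ᶠ k in Filter.atTop, ∀ i, ENNReal.ofReal (p.1 i) < v i k :=
    Filter.eventually_all.2 fun i => (hv3 i).eventually_const_lt (p.2 i)
  obtain ⟨k, hk⟩ := h.exists
  exact ⟨k, fun i => (ENNReal.ofReal_le_iff_le_toReal (hne i k)).1 (hk i).le⟩

theorem isCofinalSeq_pnat : IsCofinalSeq Nat.succPNat :=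
  ⟨fun _ _ h => PNat.coe_le_coe _ _ |>.1 (Nat.succ_le_succ h), fun k =>
    ⟨k, PNat.coe_le_coe _ _ |>.1 (Nat.le_succ _)⟩⟩

end Polydisc

theorem mainTheorem7 {R : Type u} [BanachCommRing R] :
    (∀ (n m : ℕ) (τ : Fin n → ENNReal) (ρ : Fin m → ENNReal),
      (∀ i, 0 < τ i) → (∀ j, 0 < ρ j) →
        ∃ e : (Polydisc.discAlg R τ).toMon ⊗ (Polydisc.discAlg R ρ).toMon ≅
            (Polydisc.discAlg R (Fin.append τ ρ)).toMon,
          ∀ (r : Polydisc.Radii τ) (s : Polydisc.Radii ρ),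
            e.hom.hom ≫ Polydisc.discProj R (Polydisc.Radii.append r s) =
              (Polydisc.discProj R r ⊗ₘ Polydisc.discProj R s) ≫ Polydisc.indExt R r.1 s.1) ∧
    (∀ n m : ℕ,
      ∃ e : (Polydisc.affineAlg R n).toMon ⊗ (Polydisc.affineAlg R m).toMon ≅
          (Polydisc.affineAlg R (n + m)).toMon,
        ∀ k : ℕ+,
          e.hom.hom ≫ Polydisc.affineProj R (n + m) k =
            (Polydisc.affineProj R n k ⊗ₘ Polydisc.affineProj R m k) ≫
              Polydisc.indExt R (Polydisc.affineRadius n k) (Polydisc.affineRadius m k) ≫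
                IndSystem.const.map (Polydisc.res (Polydisc.affineRadius_append n m k).le)) := by
  refine ⟨fun n m τ ρ hτ hρ => ?_, fun n m => ?_⟩
  · obtain ⟨w, hw⟩ := Polydisc.exists_isCofinalSeq_radii hτ
    obtain ⟨w', hw'⟩ := Polydisc.exists_isCofinalSeq_radii hρ
    have hτρ : ∀ i, 0 < Fin.append τ ρ i :=
      Fin.addCases (fun i => by simpa using hτ i) fun j => by simpa using hρ j
    -- This sequence serves only to show that the index set for `(τ, ρ)` is nonempty and directed.
    obtain ⟨w'', hw''⟩ := Polydisc.exists_isCofinalSeq_radii hτρ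
    have := hw''.isDirectedOrder
    have : Nonempty (Polydisc.Radii (Fin.append τ ρ)) := ⟨w'' 0⟩
    obtain ⟨e, he⟩ := Polydisc.exists_limAlg_tensor_iso (R := R)
      (r := Polydisc.discRadius τ) (s := Polydisc.discRadius ρ)
      (t := Polydisc.discRadius (Fin.append τ ρ)) hw hw'
      -- A polyradius below `(τ, ρ)` is the concatenation of its two parts, so both cofinality
      -- conditions hold with equality of polyradii.
      (fun c => ⟨⟨fun i => c.1 (Fin.castAdd m i), fun i => by simpa using c.2 (Fin.castAdd m i)⟩,
        ⟨fun j => c.1 (Fin.natAdd n j), fun j => by simpa using c.2 (Fin.natAdd n j)⟩,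
        Fin.addCases (fun i => by rw [Fin.append_left]; exact le_rfl)
          fun j => by rw [Fin.append_right]; exact le_rfl⟩)
      (fun p q => ⟨Polydisc.Radii.append p q, le_rfl⟩)
    refine ⟨e, fun r s => (he r s (Polydisc.Radii.append r s) le_rfl).trans ?_⟩
    have h1 : Polydisc.indExt R r.1 s.1 ≫
        IndSystem.const.map (Polydisc.res (le_refl (Fin.append r.1 s.1))) =
        Polydisc.indExt R r.1 s.1 := by
      rw [Polydisc.res_refl, CategoryTheory.Functor.map_id, Category.comp_id]
    exact congrArg (_ ≫ ·) h1
  · obtain ⟨e, he⟩ := Polydisc.exists_limAlg_tensor_iso (R := R)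
      (r := Polydisc.affineRadius n) (s := Polydisc.affineRadius m)
      (t := Polydisc.affineRadius (n + m)) Polydisc.isCofinalSeq_pnat Polydisc.isCofinalSeq_pnat
      (fun c => ⟨c, c, (Polydisc.affineRadius_append n m c).le⟩)
      -- The family for the product uses one integer for all variables, so two different integers
      -- are dominated by their maximum.
      (fun p q => ⟨max p q, (Polydisc.append_le_append
        ((Polydisc.affineRadius n).monotone (le_max_left p q))
        ((Polydisc.affineRadius m).monotone (le_max_right p q))).trans
        (Polydisc.affineRadius_append n m (max p q)).ge⟩)
    exact ⟨e, fun k => he k k k (Polydisc.affineRadius_append n m k).le⟩
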